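/- Let $\hat\mu=\varprojlim_k\mu_k$ be the projective limit of the groups $\mu_k$ of complex $k$-th roots of unity (transition maps $\mu_{kl}\to\mu_k$, $\xi\mapsto\xi^{l}$). Let $K_0^{\hat\mu}(\mathrm{Var}_{\mathbb C})$ be the monodromic Grothendieck ring of complex varieties with good $\hat\mu$-action (an action that factors through some $\mu_k$ and whose orbits lie in affine open subsets): it is generated by the classes $[X]$, with the relations $[X]=[Y]$ for equivariantly isomorphic $X,Y$; $[X]=[Z]+[X\setminus Z]$ for invariant closed $Z\subset X$; $[X\times V]=[X\times\mathbb A^r]$ when $V$ is $\mathbb A^r$ with a linear $\hat\mu$-action and $\mathbb A^r$ on the right has the trivial action; and the product $[X][Y]=[X\times Y]$ (diagonal action). Let $\mathbb L=[\mathbb A^1]$ (trivial action) and $\mathcal M_{\mathbb C}^{\hat\mu}=K_0^{\hat\mu}(\mathrm{Var}_{\mathbb C})[\mathbb L^{-1}]$. For $f\in\mathbb C[x,y]$ and $N\ge1$ let $\mathcal X_{N,1}(f)$ be the variety of $N$-jets $\varphi$ at the origin of $\mathbb C^2$ with $(f\circ\varphi)(t)=t^N+\text{higher order terms}$, on which $\zeta\in\mu_N$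 acts by $\varphi(t)\mapsto\varphi(\zeta t)$, and let $$Z(f)=\sum_{N\ge1}[\mathcal X_{N,1}(f)]\,\mathbb L^{-2N}T^N\in\mathcal M_{\mathbb C}^{\hat\mu}[[T]].$$ If $Z(f)$ is the expansion of a rational function $P/Q$, where $P\in\mathcal M_{\mathbb C}^{\hat\mu}[T]$, $Q$ is a finite product of factors $1-\mathbb L^{e}T^{i}$ ($e\in\mathbb Z$, $i\ge1$) and $\deg P\le\deg Q$, then $\lim_{T\to\infty}Z(f)$ is its value at infinity (the quotient of the coefficients of $P$ and $Q$ in degree $\deg Q$), and the motivic Milnor fiber of $f$ at the origin is $S(f)=-\lim_{T\to\infty}Z(f)$. **Theorem.** Let $m,n$ be coprime positive integers, let $d'\ge1$ be an integer, and let $f_1=y^m-x^n$. Then $Z((f_1)^{d'})$ is a rational function of this kind, and in $\mathcal M_{\mathbb C}^{\hat\mu}$ $$S((f_1)^{d'})=[(f_1)^{d'}-1]-[\mu_{d'}](\mathbb L-1).$$ Here $[(f_1)^{d'}-1]$ is the class of the curve $\{(x,y)\in\mathbb C^2 : (y^m-x^n)^{d'}=1\}$, on which $\mu_{mnd'}$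 acts by $\zeta\cdot(x,y)=(\zeta^m x,\zeta^n y)$, and $[\mu_{d'}]$ is the class of the variety of $d'$-th roots of unity, on which $\mu_{d'}$ acts by multiplication. -/

import Mathlib

open CategoryTheory AlgebraicGeometry

/-! ## The group `μ̂` and varieties with good `μ̂`-action -/

/-- The projective limit `μ̂` of the groups `μ_n` of complex `n`-th roots of unity, with respect
to the transition maps `μ_{nk} → μ_n`, `ξ ↦ ξ ^ k`. -/
def MuHat : Subgroup (∀ n : ℕ+, rootsOfUnity (n : ℕ) ℂ) where
  carrier := {ξ | ∀ n k : ℕ+, (ξ (n * k) : ℂˣ) ^ (k : ℕ) = (ξ n : ℂˣ)}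
  mul_mem' := fun {a b} ha hb n k => by
    simp only [Pi.mul_apply, Subgroup.coe_mul, mul_pow, ha n k, hb n k]
  one_mem' := fun n k => by simp
  inv_mem' := fun {a} ha n k => by
    simp only [Pi.inv_apply, Subgroup.coe_inv, inv_pow, ha n k]

/-- The projection `μ̂ → μ_n`. -/
def MuHat.proj (n : ℕ+) : MuHat →* rootsOfUnity (n : ℕ) ℂ :=
  (Pi.evalMonoidHom (fun n : ℕ+ => rootsOfUnity (n : ℕ) ℂ) n).comp MuHat.subtype

/-- A complex algebraic variety (reduced separated scheme of finite type over `ℂ`, not necessarily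
irreducible) with a good `μ̂`-action: the action factors through some `μ_k`, and every orbit lies
in an affine open subset. -/
structure MuHatVariety : Type 1 where
  /-- the underlying `ℂ`-scheme with its action by automorphisms over `ℂ` -/
  act : Action (Over (Spec (CommRingCat.of ℂ))) MuHat
  reduced : IsReduced act.V.left
  separated : IsSeparated act.V.hom
  finiteType : LocallyOfFiniteType act.V.hom
  quasiCompact : QuasiCompact act.V.hom
  factors : ∃ (k : ℕ+) (σ : rootsOfUnity (k : ℕ) ℂ →* End act.V),
    ∀ ξ : MuHat, act.ρ ξ = σ (MuHat.proj k ξ)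
  orbits : ∀ x : act.V.left, ∃ U : act.V.left.Opens, IsAffineOpen U ∧
    ∀ ξ : MuHat, (act.ρ ξ).left x ∈ U

/-- The action on `Spec A` induced by an action of `μ_k` on a `ℂ`-algebra `A`.  (The group is
commutative, so left and right actions agree.) -/
noncomputable def specEnd (k : ℕ+) (A : Type) [CommRing A] [Algebra ℂ A]
    (ρ : rootsOfUnity (k : ℕ) ℂ →* (A →ₐ[ℂ] A)) :
    rootsOfUnity (k : ℕ) ℂ →*
      End (Over.mk (Spec.map (CommRingCat.ofHom (algebraMap ℂ A)))) where
  toFun ζ := Over.homMk (Spec.map (CommRingCat.ofHom (ρ ζ).toRingHom)) (by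
    simp only [Over.mk_left, Over.mk_hom, ← Spec.map_comp, ← CommRingCat.ofHom_comp]
    congr 2
    exact (ρ ζ).comp_algebraMap)
  map_one' := by
    apply Over.OverMorphism.ext
    simp only [map_one, Over.homMk_left, End.one_def, Over.id_left]
    exact Spec.map_id _
  map_mul' a b := by
    apply Over.OverMorphism.ext
    rw [mul_comm a b]
    simp only [map_mul, Over.homMk_left, End.mul_def, Over.comp_left, ← Spec.map_comp,
      ← CommRingCat.ofHom_comp]
    rfl

/-- The affine variety `Spec A` with the `μ̂`-action induced by an action of `μ_k` on `A`. -/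
noncomputable def MuHatVariety.affine (k : ℕ+) (A : Type) [CommRing A] [Algebra ℂ A]
    [Algebra.FiniteType ℂ A] [_root_.IsReduced A]
    (ρ : rootsOfUnity (k : ℕ) ℂ →* (A →ₐ[ℂ] A)) : MuHatVariety where
  act := ⟨Over.mk (Spec.map (CommRingCat.ofHom (algebraMap ℂ A))),
    (specEnd k A ρ).comp (MuHat.proj k)⟩
  reduced := inferInstanceAs (IsReduced (Spec (CommRingCat.of A)))
  separated := inferInstanceAs
    (IsSeparated (Spec.map (CommRingCat.ofHom (algebraMap ℂ A))))
  finiteType := by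
    change LocallyOfFiniteType (Spec.map (CommRingCat.ofHom (algebraMap ℂ A)))
    rw [HasRingHomProperty.Spec_iff (P := @LocallyOfFiniteType)]
    exact RingHom.finiteType_algebraMap.mpr inferInstance
  quasiCompact := inferInstanceAs
    (QuasiCompact (Spec.map (CommRingCat.ofHom (algebraMap ℂ A))))
  factors := ⟨k, specEnd k A ρ, fun _ => rfl⟩
  orbits := fun _ => ⟨⊤, isAffineOpen_top (Spec (CommRingCat.of A)), fun _ => trivial⟩

/-! ## The monodromic Grothendieck ring -/

/-- The defining relations of the monodromic Grothendieck ring.  Since the product of classes is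
the class of the product, `linear` gives `[X × V] = [X × 𝔸ⁿ]` for every `X`. -/
inductive MuHatVariety.Rel : FreeCommRing MuHatVariety → FreeCommRing MuHatVariety → Prop
  /-- isomorphic varieties with `μ̂`-action have the same class -/
  | iso (X Y : MuHatVariety) (h : Nonempty (X.act ≅ Y.act)) :
      Rel (FreeCommRing.of X) (FreeCommRing.of Y)
  /-- `[X] = [Z] + [X ∖ Z]` for an invariant closed subvariety `Z` of `X` -/
  | scissor (X Z U : MuHatVariety) (i : Z.act ⟶ X.act) (j : U.act ⟶ X.act)
      (hi : IsClosedImmersion i.hom.left) (hj : IsOpenImmersion j.hom.left)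
      (hij : Set.range j.hom.left = (Set.range i.hom.left)ᶜ) :
      Rel (FreeCommRing.of X) (FreeCommRing.of Z + FreeCommRing.of U)
  /-- `[X × Y] = [X] [Y]`, where `X × Y` carries the diagonal action -/
  | prod (X Y W : MuHatVariety) (p : W.act ⟶ X.act) (q : W.act ⟶ Y.act)
      (h : IsPullback p.hom.left q.hom.left X.act.V.hom Y.act.V.hom) :
      Rel (FreeCommRing.of W) (FreeCommRing.of X * FreeCommRing.of Y)
  /-- the class of the point is `1` -/
  | point (X : MuHatVariety) (h : IsIso X.act.V.hom) : Rel (FreeCommRing.of X) 1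
  /-- an affine space with a linear action has the same class as the affine space of the same
  dimension with the trivial action -/
  | linear (n : ℕ) (k : ℕ+)
      (ρ : rootsOfUnity (k : ℕ) ℂ →* (MvPolynomial (Fin n) ℂ →ₐ[ℂ] MvPolynomial (Fin n) ℂ))
      (h : ∀ ζ i, (ρ ζ (MvPolynomial.X i)).IsHomogeneous 1) :
      Rel (FreeCommRing.of (MuHatVariety.affine k (MvPolynomial (Fin n) ℂ) ρ))
        (FreeCommRing.of (MuHatVariety.affine 1 (MvPolynomial (Fin n) ℂ) 1))

/-- The monodromic Grothendieck ring `K₀^μ̂(Var_ℂ)`. -/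
abbrev KMuHat : Type 1 := FreeCommRing MuHatVariety ⧸ Ideal.ofRel MuHatVariety.Rel

/-- The class of a variety in `K₀^μ̂(Var_ℂ)`. -/
noncomputable def MuHatVariety.class₀ (X : MuHatVariety) : KMuHat :=
  Ideal.Quotient.mk _ (FreeCommRing.of X)

/-- The class of the affine line (with trivial action) in `K₀^μ̂(Var_ℂ)`. -/
noncomputable def lefschetz₀ : KMuHat :=
  (MuHatVariety.affine 1 (MvPolynomial (Fin 1) ℂ) 1).class₀

/-- The ring `M_ℂ^μ̂ = K₀^μ̂(Var_ℂ)[𝕃⁻¹]`. -/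
abbrev MMuHat : Type 1 := Localization.Away lefschetz₀

/-- The motive of a variety with good `μ̂`-action. -/
noncomputable def MuHatVariety.motive (X : MuHatVariety) : MMuHat :=
  algebraMap KMuHat MMuHat X.class₀

/-- The class `𝕃` of the affine line, as a unit of `M_ℂ^μ̂`. -/
noncomputable def lefschetz : MMuHatˣ :=
  (IsLocalization.Away.algebraMap_isUnit (S := MMuHat) lefschetz₀).unit

/-! ## Affine varieties with a diagonal action -/

/-- The automorphism `zᵢ ↦ ζ ^ (wᵢ) zᵢ` of the polynomial ring. -/
noncomputable def scaleHom {σ : Type} (w : σ → ℕ) (ζ : ℂ) :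
    MvPolynomial σ ℂ →ₐ[ℂ] MvPolynomial σ ℂ :=
  MvPolynomial.aeval fun i => MvPolynomial.C (ζ ^ w i) * MvPolynomial.X i

theorem aeval_scaleHom {σ : Type} (w : σ → ℕ) (ζ : ℂ) (a : σ → ℂ) (p : MvPolynomial σ ℂ) :
    MvPolynomial.aeval a (scaleHom w ζ p) = MvPolynomial.aeval (fun i => ζ ^ w i * a i) p := by
  have : (MvPolynomial.aeval a).comp (scaleHom w ζ) =
      (MvPolynomial.aeval (fun i => ζ ^ w i * a i) : MvPolynomial σ ℂ →ₐ[ℂ] ℂ) := by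
    ext i
    simp [scaleHom]
  exact DFunLike.congr_fun this p

theorem scaleHom_one {σ : Type} (w : σ → ℕ) : scaleHom w 1 = AlgHom.id ℂ _ := by
  ext i
  simp [scaleHom]

theorem scaleHom_mul {σ : Type} (w : σ → ℕ) (ζ ξ : ℂ) :
    scaleHom w (ζ * ξ) = (scaleHom w ζ).comp (scaleHom w ξ) := by
  apply MvPolynomial.algHom_ext
  intro i
  have hC : ∀ c : ℂ, scaleHom w ζ (MvPolynomial.C c) = MvPolynomial.C c :=
    fun c => (scaleHom w ζ).commutes c
  have hX : ∀ ζ : ℂ, scaleHom w ζ (MvPolynomial.X i) =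
      MvPolynomial.C (ζ ^ w i) * MvPolynomial.X i := fun ζ => MvPolynomial.aeval_X _ i
  rw [AlgHom.comp_apply, hX, hX, map_mul, hC, hX, mul_pow, MvPolynomial.C_mul]
  ring

/-- The set `Z ⊆ ℂ^σ` is invariant under `ζ · a = (ζ ^ (wᵢ) aᵢ)ᵢ` for all `ζ ∈ μ_k`. -/
def ScaleInvariant {σ : Type} (k : ℕ+) (w : σ → ℕ) (Z : Set (σ → ℂ)) : Prop :=
  ∀ ζ : ℂ, ζ ^ (k : ℕ) = 1 → ∀ a ∈ Z, (fun i => ζ ^ w i * a i) ∈ Z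

/-- The coordinate ring of an algebraic subset of `ℂ^σ`, with its reduced structure. -/
abbrev CoordRing {σ : Type} (Z : Set (σ → ℂ)) : Type :=
  MvPolynomial σ ℂ ⧸ MvPolynomial.vanishingIdeal ℂ Z

theorem isReduced_coordRing {σ : Type} (Z : Set (σ → ℂ)) :
    _root_.IsReduced (CoordRing Z) := by
  rw [← Ideal.isRadical_iff_quotient_reduced]
  rintro p ⟨n, hn⟩ x hx
  have := hn x hx
  rw [map_pow] at this
  exact eq_zero_of_pow_eq_zero this

/-- The action of `μ_k` on the coordinate ring of a scale invariant set. -/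
noncomputable def coordAction {σ : Type} (k : ℕ+) (w : σ → ℕ) (Z : Set (σ → ℂ))
    (hZ : ScaleInvariant k w Z) :
    rootsOfUnity (k : ℕ) ℂ →* (CoordRing Z →ₐ[ℂ] CoordRing Z) where
  toFun ζ := Ideal.quotientMapₐ _ (scaleHom w ((ζ : ℂˣ) : ℂ)) (by
    intro p hp a ha
    rw [aeval_scaleHom]
    refine hp _ (hZ _ ?_ a ha)
    have := (mem_rootsOfUnity _ _).mp ζ.2
    have h := congrArg Units.val this
    rwa [Units.val_pow_eq_pow_val, Units.val_one] at h)
  map_one' := by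
    apply AlgHom.ext
    intro p
    obtain ⟨p, rfl⟩ := Ideal.Quotient.mk_surjective p
    change Ideal.Quotient.mk _ (scaleHom w 1 p) = Ideal.Quotient.mk _ p
    rw [scaleHom_one, AlgHom.id_apply]
  map_mul' a b := by
    apply AlgHom.ext
    intro p
    obtain ⟨p, rfl⟩ := Ideal.Quotient.mk_surjective p
    change Ideal.Quotient.mk _ (scaleHom w (((a : ℂˣ) : ℂ) * ((b : ℂˣ) : ℂ)) p) =
      Ideal.Quotient.mk _ (scaleHom w ((a : ℂˣ) : ℂ) (scaleHom w ((b : ℂˣ) : ℂ) p))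
    rw [scaleHom_mul, AlgHom.comp_apply]

/-- The algebraic set `Z ⊆ ℂ^σ`, as a reduced affine variety, on which `μ̂` acts through `μ_k` by
`ζ · a = (ζ ^ (wᵢ) aᵢ)ᵢ`. -/
noncomputable def MuHatVariety.ofSet {σ : Type} [Finite σ] (k : ℕ+) (w : σ → ℕ)
    (Z : Set (σ → ℂ)) (hZ : ScaleInvariant k w Z) : MuHatVariety :=
  haveI := isReduced_coordRing Z
  MuHatVariety.affine k (CoordRing Z) (coordAction k w Z hZ)

/-- The variety of `d`-th roots of unity, on which `μ_d` acts by multiplication. -/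
noncomputable def muVariety (d : ℕ+) : MuHatVariety :=
  MuHatVariety.ofSet (σ := Fin 1) d (fun _ => 1) {z | z 0 ^ (d : ℕ) = 1} (by
    intro ζ hζ a ha
    simpa [mul_pow, hζ] using ha)

/-- The curve `{(x, y) ∈ ℂ² | (y ^ m - x ^ n) ^ d = 1}` (`x = a 0`, `y = a 1`), on which `μ_{mnd}`
acts by `ζ · (x, y) = (ζ ^ m x, ζ ^ n y)`. -/
noncomputable def quasiHomFiber (m n d : ℕ+) : MuHatVariety :=
  MuHatVariety.ofSet (σ := Fin 2) (m * n * d) ![(m : ℕ), (n : ℕ)]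
    {a | (a 1 ^ (m : ℕ) - a 0 ^ (n : ℕ)) ^ (d : ℕ) = 1} (by
    intro ζ hζ a ha
    have h : (ζ ^ (n : ℕ) * a 1) ^ (m : ℕ) - (ζ ^ (m : ℕ) * a 0) ^ (n : ℕ) =
        ζ ^ ((m : ℕ) * n) * (a 1 ^ (m : ℕ) - a 0 ^ (n : ℕ)) := by ring
    have h' : (ζ ^ ((m : ℕ) * n)) ^ (d : ℕ) = 1 := by
      rw [← pow_mul]; simpa using hζ
    change ((ζ ^ (n : ℕ) * a 1) ^ (m : ℕ) - (ζ ^ (m : ℕ) * a 0) ^ (n : ℕ)) ^ (d : ℕ) = 1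
    change (a 1 ^ (m : ℕ) - a 0 ^ (n : ℕ)) ^ (d : ℕ) = 1 at ha
    rw [h, mul_pow, h', ha, one_mul])

/-! ## Jets, the local motivic zeta function and the motivic Milnor fiber -/

/-- The `N`-jet at the origin of `ℂ²` with coefficients `a`: its `j`-th component is
`∑_{1 ≤ k ≤ N} a (j, k - 1) t ^ k`. -/
noncomputable def jet (N : ℕ+) (a : Fin 2 × Fin N → ℂ) (j : Fin 2) : Polynomial ℂ :=
  ∑ k : Fin N, Polynomial.C (a (j, k)) * Polynomial.X ^ ((k : ℕ) + 1)

/-- The `N`-jets `φ` at the origin with `f ∘ φ ≡ t ^ N` modulo `t ^ (N + 1)`. -/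
def jetSet (f : MvPolynomial (Fin 2) ℂ) (N : ℕ+) : Set (Fin 2 × Fin N → ℂ) :=
  {a | (Polynomial.X ^ ((N : ℕ) + 1) : Polynomial ℂ) ∣
    MvPolynomial.aeval (jet N a) f - Polynomial.X ^ (N : ℕ)}

/-- Scaling the `k`-th coefficient by `ζ ^ k` amounts to replacing `φ(t)` by `φ(ζ t)`. -/
theorem jetSet_invariant (f : MvPolynomial (Fin 2) ℂ) (N : ℕ+) :
    ScaleInvariant N (fun i : Fin 2 × Fin N => (i.2 : ℕ) + 1) (jetSet f N) := by
  intro ζ hζ a ha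
  have h1 : jet N (fun i => ζ ^ ((i.2 : ℕ) + 1) * a i) =
      fun j => Polynomial.aeval (Polynomial.C ζ * Polynomial.X) (jet N a j) := by
    funext j
    simp only [jet, map_sum, map_mul, map_pow, Polynomial.aeval_X, Polynomial.aeval_C]
    refine Finset.sum_congr rfl fun k _ => ?_
    simp only [Polynomial.algebraMap_eq]
    ring
  have h2 : MvPolynomial.aeval (fun j => Polynomial.aeval
      (Polynomial.C ζ * Polynomial.X : Polynomial ℂ) (jet N a j)) f =
      Polynomial.aeval (Polynomial.C ζ * Polynomial.X : Polynomial ℂ)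
        (MvPolynomial.aeval (jet N a) f) := by
    have := MvPolynomial.map_aeval (jet N a)
      (Polynomial.aeval (R := ℂ) (Polynomial.C ζ * Polynomial.X : Polynomial ℂ)).toRingHom f
    rw [MvPolynomial.aeval_def, MvPolynomial.coe_eval₂Hom] at *
    refine Eq.trans ?_ this.symm
    congr 1
    ext c
    simp
  obtain ⟨g, hg⟩ := ha
  refine ⟨Polynomial.C (ζ ^ ((N : ℕ) + 1)) *
    Polynomial.aeval (Polynomial.C ζ * Polynomial.X : Polynomial ℂ) g, ?_⟩
  have h3 := congrArg (Polynomial.aeval (Polynomial.C ζ * Polynomial.X : Polynomial ℂ)) hg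
  simp only [map_sub, map_mul, map_pow, Polynomial.aeval_X, mul_pow] at h3
  rw [← Polynomial.C_pow (n := (N : ℕ)), hζ, Polynomial.C_1, one_mul] at h3
  change MvPolynomial.aeval (jet N (fun i => ζ ^ ((i.2 : ℕ) + 1) * a i)) f - _ = _
  rw [h1, h2, h3]
  simp only [Polynomial.C_pow]
  ring

/-- The variety `X_{N,1}(f)`, on which `ζ ∈ μ_N` acts by `φ(t) ↦ φ(ζ t)`. -/
noncomputable def jetVariety (f : MvPolynomial (Fin 2) ℂ) (N : ℕ+) : MuHatVariety :=
  MuHatVariety.ofSet N (fun i : Fin 2 × Fin N => (i.2 : ℕ) + 1) (jetSet f N)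
    (jetSet_invariant f N)

/-- The local motivic zeta function `Z(f) = ∑_{N ≥ 1} [X_{N,1}(f)] 𝕃 ^ (-2N) T ^ N`. -/
noncomputable def motivicZeta (f : MvPolynomial (Fin 2) ℂ) : PowerSeries MMuHat :=
  PowerSeries.mk fun N => if h : 0 < N then
    (jetVariety f ⟨N, h⟩).motive * ((lefschetz ^ (-2 * (N : ℤ)) : MMuHatˣ) : MMuHat) else 0

/-- The denominators that are allowed in a rational function of `T`: the finite products of
factors `1 - 𝕃 ^ e T ^ i` with `e ∈ ℤ` and `i ≥ 1`. -/
noncomputable def zetaDenominators : Submonoid (Polynomial MMuHat) :=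
  Submonoid.closure {Q | ∃ (e : ℤ) (i : ℕ), 0 < i ∧
    Q = 1 - Polynomial.C ((lefschetz ^ e : MMuHatˣ) : MMuHat) * Polynomial.X ^ i}

/-- `Z` is the expansion of a rational function `P / Q` with `deg P ≤ deg Q` whose value at
`T = ∞`, the quotient of the coefficients of `P` and `Q` in degree `deg Q`, is `l`. -/
def IsLimitAtInfinity (Z : PowerSeries MMuHat) (l : MMuHat) : Prop :=
  ∃ P Q : Polynomial MMuHat, Q ∈ zetaDenominators ∧
    (Q : PowerSeries MMuHat) * Z = (P : PowerSeries MMuHat) ∧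
    P.natDegree ≤ Q.natDegree ∧ P.coeff Q.natDegree = l * Q.leadingCoeff

theorem isUnit_leadingCoeff_of_mem {Q : Polynomial MMuHat} (hQ : Q ∈ zetaDenominators) :
    IsUnit Q.leadingCoeff := by
  rcases subsingleton_or_nontrivial MMuHat with hs | hn
  · exact isUnit_of_subsingleton _
  induction hQ using Submonoid.closure_induction with
  | mem Q h =>
    obtain ⟨e, i, hi, rfl⟩ := h
    have hu : IsUnit (-((lefschetz ^ e : MMuHatˣ) : MMuHat)) := (Units.isUnit _).neg
    have hd : (1 - Polynomial.C ((lefschetz ^ e : MMuHatˣ) : MMuHat) * Polynomial.X ^ i) =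
        Polynomial.C (-((lefschetz ^ e : MMuHatˣ) : MMuHat)) * Polynomial.X ^ i
          + Polynomial.C 1 := by
      rw [Polynomial.C_neg, Polynomial.C_1]; ring
    rw [hd, Polynomial.leadingCoeff_add_of_degree_lt', Polynomial.leadingCoeff_C_mul_X_pow]
    · exact hu
    · rw [Polynomial.degree_C_mul_X_pow _ hu.ne_zero]
      exact lt_of_le_of_lt Polynomial.degree_C_le (by exact_mod_cast hi)
  | one => simp
  | mul a b _ _ ha hb =>
    rw [Polynomial.leadingCoeff_mul']
    · exact ha.mul hb
    · exact (ha.mul hb).ne_zero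

/-- The value at infinity is well defined. -/
theorem IsLimitAtInfinity.unique {Z : PowerSeries MMuHat} {l l' : MMuHat}
    (h : IsLimitAtInfinity Z l) (h' : IsLimitAtInfinity Z l') : l = l' := by
  obtain ⟨P, Q, hQ, hZ, hd, hc⟩ := h
  obtain ⟨P', Q', hQ', hZ', hd', hc'⟩ := h'
  have e : Q' * P = Q * P' := by
    apply Polynomial.coe_injective
    rw [Polynomial.coe_mul, Polynomial.coe_mul, ← hZ, ← hZ']
    ring
  have h1 := Polynomial.coeff_mul_add_eq_of_natDegree_le (le_refl Q'.natDegree) hd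
  have h2 := Polynomial.coeff_mul_add_eq_of_natDegree_le (le_refl Q.natDegree) hd'
  rw [e, add_comm, h2, hc, hc'] at h1
  have hu := (isUnit_leadingCoeff_of_mem hQ).mul (isUnit_leadingCoeff_of_mem hQ')
  apply hu.mul_right_cancel
  simp only [Polynomial.coeff_natDegree] at h1
  linear_combination -h1

open Classical in
/-- `lim_{T → ∞} Z`, the value at infinity of a rational `Z` (and `0` if there is none). -/
noncomputable def limitAtInfinity (Z : PowerSeries MMuHat) : MMuHat :=
  if h : ∃ l, IsLimitAtInfinity Z l then h.choose else 0

/-- The motivic Milnor fiber `S(f) = - lim_{T → ∞} Z(f)` of `f` at the origin. -/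
noncomputable def motivicMilnorFiber (f : MvPolynomial (Fin 2) ℂ) : MMuHat :=
  -limitAtInfinity (motivicZeta f)

/-- The function `f₁ = y ^ m - x ^ n`, where `x`, `y` are the coordinates with index `0`, `1`. -/
noncomputable def quasiHom (m n : ℕ+) : MvPolynomial (Fin 2) ℂ :=
  MvPolynomial.X 1 ^ (m : ℕ) - MvPolynomial.X 0 ^ (n : ℕ)

/-! If $f_1^{d}\circ\varphi=t^N+\cdots$, then $N=kd$, and $f_1\circ\varphi$ has order $k$ with a
$d$-th root of unity as leading coefficient. Let $u(k)$ be the motive of the set of these jets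
(`orderSet`), divided by $\mathbb L^{2N}$. It does not depend on the jet length $N\ge k$, and
everything follows from a recursion for $u$ with step $mn$.

Suppose that $f_1\circ\varphi$ has order $mn+e$ with $e>0$. Since $m,n$ are coprime, the terms of
order below $mn$ can only cancel if $x=t^m\tilde x$ and $y=t^n\tilde y$
(`vanishing_of_pow_sub_pow`), and then $\tilde y^m-\tilde x^n$ has order $e$, so $\tilde
y(0)^m=\tilde x(0)^n$. There are two cases. (1) $\tilde x(0)=\tilde y(0)=0$. Then $(\tilde x,\tilde
y)$ is a jet of the same kind for $e$, which contributes $\mathbb L^{-(m+n)}u(e)$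
(`motive_orderSet_inter_coord`). (2) $\tilde x(0)\ne0$. Then $(\tilde x(0),\tilde y(0))=(v^m,v^n)$
for a unique $v\in\mathbb C^*$, and $\tilde y$ modulo $t^{e+1}$ is the $m$-th root of $\tilde
x^n+ct^e$ with constant term $v^n$, where $c$ is the leading coefficient of $f_1\circ\varphi$. The
free data are $v$, $c$ and the remaining coefficients, which contribute $[\mu_d](\mathbb L-1)\mathbb
L^{-(m+n+e)}$ (`motive_unitLocus_orderSet`, `motive_unitLocus_torusSet`).

Dividing by $(t^m,t^n)$ turns $\varphi(\zeta t)$ into $(\zeta^m\tilde x(\zeta t),\zeta^n\tilde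
y(\zeta t))$. The sets are therefore studied with the action twisted $\rho$ times, and
`jetMotive_eq` shows that the twist does not affect the class.

With $u(mn)=[f_1^{d}-1]\,\mathbb L^{-(m+n)}$ (`zetaCoeff_mul`) the recursion gives rationality with
denominator $(1-\mathbb L^{-(m+n)}T^{mnd})(1-\mathbb L^{-1}T^d)$. The value at infinity sees only
the failure of the recursion at $e=0$, namely $[\mu_d](\mathbb L-1)-[f_1^{d}-1]$
(`coeff_denominator_mul`). The values $u(k)$ for $k<mn$ cancel. -/

/-! ## Coordinate rings and points -/

/-- The complex number underlying the image of `ξ` in `μ_k`. -/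
noncomputable def MuHat.root (k : ℕ+) (ξ : MuHat) : ℂ := ((MuHat.proj k ξ : ℂˣ) : ℂ)

theorem MuHat.root_pow_self (k : ℕ+) (ξ : MuHat) : MuHat.root k ξ ^ (k : ℕ) = 1 := by
  have := (mem_rootsOfUnity _ _).mp (MuHat.proj k ξ).2
  have h := congrArg Units.val this
  rwa [Units.val_pow_eq_pow_val, Units.val_one] at h

theorem MuHat.root_mul_pow (n k : ℕ+) (ξ : MuHat) :
    MuHat.root (n * k) ξ ^ (k : ℕ) = MuHat.root n ξ := by
  have h := congrArg Units.val (ξ.2 n k)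
  rwa [Units.val_pow_eq_pow_val] at h

/-- This is how actions of groups $\mu_K$ with different $K$ are compared: a weight $w$ dividing $K$
acts through $\mu_{K/w}$. -/
theorem MuHat.root_pow_of_eq {K k : ℕ+} {w : ℕ} (h : (K : ℕ) = k * w) (ξ : MuHat) :
    MuHat.root K ξ ^ w = MuHat.root k ξ := by
  have hw : 0 < w := Nat.pos_of_ne_zero fun h0 => K.ne_zero (by rw [h, h0, mul_zero])
  obtain rfl : K = k * ⟨w, hw⟩ := PNat.eq h
  exact MuHat.root_mul_pow k ⟨w, hw⟩ ξ

section Points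

variable {σ τ : Type}

/-- A function on `ℂ^σ` that agrees on `Z` with a polynomial. -/
def IsRegularOn (Z : Set (σ → ℂ)) (f : (σ → ℂ) → ℂ) : Prop :=
  ∃ p : MvPolynomial σ ℂ, ∀ a ∈ Z, f a = MvPolynomial.aeval a p

namespace IsRegularOn

variable {Z : Set (σ → ℂ)} {f g : (σ → ℂ) → ℂ}

theorem const (c : ℂ) : IsRegularOn Z fun _ => c := ⟨MvPolynomial.C c, fun a _ => by simp⟩

theorem coord (i : σ) : IsRegularOn Z fun a => a i := ⟨MvPolynomial.X i, fun a _ => by simp⟩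

theorem add (hf : IsRegularOn Z f) (hg : IsRegularOn Z g) : IsRegularOn Z fun a => f a + g a := by
  obtain ⟨p, hp⟩ := hf
  obtain ⟨q, hq⟩ := hg
  exact ⟨p + q, fun a ha => by simp only [map_add, hp a ha, hq a ha]⟩

theorem mul (hf : IsRegularOn Z f) (hg : IsRegularOn Z g) : IsRegularOn Z fun a => f a * g a := by
  obtain ⟨p, hp⟩ := hf
  obtain ⟨q, hq⟩ := hg
  exact ⟨p * q, fun a ha => by simp only [map_mul, hp a ha, hq a ha]⟩

theorem sub (hf : IsRegularOn Z f) (hg : IsRegularOn Z g) : IsRegularOn Z fun a => f a - g a := by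
  obtain ⟨p, hp⟩ := hf
  obtain ⟨q, hq⟩ := hg
  exact ⟨p - q, fun a ha => by simp only [map_sub, hp a ha, hq a ha]⟩

theorem pow (hf : IsRegularOn Z f) (n : ℕ) : IsRegularOn Z fun a => f a ^ n := by
  obtain ⟨p, hp⟩ := hf
  exact ⟨p ^ n, fun a ha => by simp only [map_pow, hp a ha]⟩

theorem sum {ι : Type*} (s : Finset ι) {f : ι → (σ → ℂ) → ℂ} (h : ∀ i ∈ s, IsRegularOn Z (f i)) :
    IsRegularOn Z fun a => ∑ i ∈ s, f i a := by
  classical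
  induction s using Finset.induction_on with
  | empty => simpa using const 0
  | insert i s hi ih =>
    simp only [Finset.sum_insert hi]
    exact (h i (Finset.mem_insert_self i s)).add
      (ih fun j hj => h j (Finset.mem_insert_of_mem hj))

end IsRegularOn

/-- Evaluation of a function on `Z` at a point of `Z`. -/
noncomputable def CoordRing.evalAt (Z : Set (σ → ℂ)) (a : Z) : CoordRing Z →ₐ[ℂ] ℂ :=
  Ideal.Quotient.liftₐ _ (MvPolynomial.aeval (a : σ → ℂ)) fun _ hp => hp a a.2

theorem CoordRing.evalAt_mk (Z : Set (σ → ℂ)) (a : Z) (p : MvPolynomial σ ℂ) :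
    CoordRing.evalAt Z a (Ideal.Quotient.mk _ p) = MvPolynomial.aeval (a : σ → ℂ) p := rfl

/-- The ring is the quotient by the full vanishing ideal, so its elements are functions on $Z$.
Identities and equivariance below are all checked on points. -/
theorem CoordRing.ext_points {Z : Set (σ → ℂ)} {p q : CoordRing Z}
    (h : ∀ a : Z, CoordRing.evalAt Z a p = CoordRing.evalAt Z a q) : p = q := by
  obtain ⟨p, rfl⟩ := Ideal.Quotient.mk_surjective p
  obtain ⟨q, rfl⟩ := Ideal.Quotient.mk_surjective q
  refine Ideal.Quotient.eq.mpr fun a ha => ?_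
  rw [map_sub, sub_eq_zero]
  exact h ⟨a, ha⟩

theorem CoordRing.evalAt_coordAction {k : ℕ+} {w : σ → ℕ} {Z : Set (σ → ℂ)}
    (hZ : ScaleInvariant k w Z) (ξ : MuHat) (a : Z)
    (h : (fun i => MuHat.root k ξ ^ w i * a.1 i) ∈ Z) (p : CoordRing Z) :
    CoordRing.evalAt Z a (coordAction k w Z hZ (MuHat.proj k ξ) p) =
      CoordRing.evalAt Z ⟨fun i => MuHat.root k ξ ^ w i * a.1 i, h⟩ p := by
  obtain ⟨p, rfl⟩ := Ideal.Quotient.mk_surjective p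
  exact aeval_scaleHom w _ _ p

theorem ScaleInvariant.root_mem {k : ℕ+} {w : σ → ℕ} {Z : Set (σ → ℂ)}
    (hZ : ScaleInvariant k w Z) (ξ : MuHat) {a : σ → ℂ} (ha : a ∈ Z) :
    (fun i => MuHat.root k ξ ^ w i * a i) ∈ Z :=
  hZ _ (MuHat.root_pow_self k ξ) a ha

/-- The pull-back of functions along a regular map `Z → W`. -/
noncomputable def CoordRing.pullback {Z : Set (σ → ℂ)} {W : Set (τ → ℂ)}
    (F : (σ → ℂ) → τ → ℂ) (hF : ∀ j, IsRegularOn Z fun a => F a j) (h : Set.MapsTo F Z W) :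
    CoordRing W →ₐ[ℂ] CoordRing Z :=
  Ideal.Quotient.liftₐ _
    (MvPolynomial.aeval fun j => (Ideal.Quotient.mk _ (hF j).choose : CoordRing Z)) (by
      intro p hp
      refine CoordRing.ext_points fun a => ?_
      rw [← AlgHom.comp_apply, MvPolynomial.comp_aeval, map_zero]
      have : (fun j => CoordRing.evalAt Z a (Ideal.Quotient.mk _ (hF j).choose)) = F a :=
        funext fun j => ((hF j).choose_spec a a.2).symm
      rw [this]
      exact hp _ (h a.2))

/-- By this formula the representatives chosen in `pullback` do not matter. -/
theorem CoordRing.evalAt_pullback {Z : Set (σ → ℂ)} {W : Set (τ → ℂ)}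
    (F : (σ → ℂ) → τ → ℂ) (hF : ∀ j, IsRegularOn Z fun a => F a j) (h : Set.MapsTo F Z W)
    (a : Z) (p : CoordRing W) :
    CoordRing.evalAt Z a (CoordRing.pullback F hF h p) = CoordRing.evalAt W ⟨F a, h a.2⟩ p := by
  obtain ⟨p, rfl⟩ := Ideal.Quotient.mk_surjective p
  change CoordRing.evalAt Z a (MvPolynomial.aeval _ p) = MvPolynomial.aeval (F a) p
  rw [← AlgHom.comp_apply, MvPolynomial.comp_aeval]
  have : (fun j => CoordRing.evalAt Z a (Ideal.Quotient.mk _ (hF j).choose)) = F a :=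
    funext fun j => ((hF j).choose_spec a a.2).symm
  rw [this]

end Points

/-! ## Equivariant morphisms of affine varieties -/

/-- The equivariant morphism given by an equivariant homomorphism of algebras. -/
noncomputable def MuHatVariety.affineHom {k k' : ℕ+} {A B : Type} [CommRing A] [Algebra ℂ A]
    [Algebra.FiniteType ℂ A] [_root_.IsReduced A] [CommRing B] [Algebra ℂ B]
    [Algebra.FiniteType ℂ B] [_root_.IsReduced B]
    (ρ : rootsOfUnity (k : ℕ) ℂ →* (A →ₐ[ℂ] A)) (ρ' : rootsOfUnity (k' : ℕ) ℂ →* (B →ₐ[ℂ] B))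
    (f : A →ₐ[ℂ] B)
    (hf : ∀ (ξ : MuHat) (p : A), f (ρ (MuHat.proj k ξ) p) = ρ' (MuHat.proj k' ξ) (f p)) :
    (MuHatVariety.affine k' B ρ').act ⟶ (MuHatVariety.affine k A ρ).act where
  hom := Over.homMk (Spec.map (CommRingCat.ofHom f.toRingHom)) (by
    change Spec.map (CommRingCat.ofHom f.toRingHom) ≫
      Spec.map (CommRingCat.ofHom (algebraMap ℂ A)) = Spec.map (CommRingCat.ofHom (algebraMap ℂ B))
    rw [← Spec.map_comp, ← CommRingCat.ofHom_comp]
    congr 2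
    exact f.comp_algebraMap)
  comm ξ := by
    apply Over.OverMorphism.ext
    change Spec.map (CommRingCat.ofHom (ρ' (MuHat.proj k' ξ)).toRingHom) ≫
      Spec.map (CommRingCat.ofHom f.toRingHom) = Spec.map (CommRingCat.ofHom f.toRingHom) ≫
      Spec.map (CommRingCat.ofHom (ρ (MuHat.proj k ξ)).toRingHom)
    rw [← Spec.map_comp, ← CommRingCat.ofHom_comp, ← Spec.map_comp, ← CommRingCat.ofHom_comp]
    congr 2
    exact RingHom.ext fun p => (hf ξ p).symm

theorem MuHatVariety.nonempty_affine_iso {k k' : ℕ+} {A B : Type} [CommRing A] [Algebra ℂ A]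
    [Algebra.FiniteType ℂ A] [_root_.IsReduced A] [CommRing B] [Algebra ℂ B]
    [Algebra.FiniteType ℂ B] [_root_.IsReduced B]
    (ρ : rootsOfUnity (k : ℕ) ℂ →* (A →ₐ[ℂ] A)) (ρ' : rootsOfUnity (k' : ℕ) ℂ →* (B →ₐ[ℂ] B))
    (f : A →ₐ[ℂ] B) (g : B →ₐ[ℂ] A) (hfg : ∀ p, f (g p) = p) (hgf : ∀ p, g (f p) = p)
    (hf : ∀ (ξ : MuHat) (p : A), f (ρ (MuHat.proj k ξ) p) = ρ' (MuHat.proj k' ξ) (f p)) :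
    Nonempty ((MuHatVariety.affine k' B ρ').act ≅ (MuHatVariety.affine k A ρ).act) := by
  have hg : ∀ (ξ : MuHat) (p : B), g (ρ' (MuHat.proj k' ξ) p) = ρ (MuHat.proj k ξ) (g p) := by
    intro ξ p
    rw [← hgf (ρ (MuHat.proj k ξ) (g p)), hf, hfg]
  refine ⟨⟨affineHom ρ ρ' f hf, affineHom ρ' ρ g hg, ?_, ?_⟩⟩
  · apply Action.Hom.ext
    apply Over.OverMorphism.ext
    change Spec.map (CommRingCat.ofHom f.toRingHom) ≫ Spec.map (CommRingCat.ofHom g.toRingHom) =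
      𝟙 (Spec (CommRingCat.of B))
    rw [← Spec.map_comp, ← CommRingCat.ofHom_comp, ← Spec.map_id]
    congr 1
    ext p
    exact hfg p
  · apply Action.Hom.ext
    apply Over.OverMorphism.ext
    change Spec.map (CommRingCat.ofHom g.toRingHom) ≫ Spec.map (CommRingCat.ofHom f.toRingHom) =
      𝟙 (Spec (CommRingCat.of A))
    rw [← Spec.map_comp, ← CommRingCat.ofHom_comp, ← Spec.map_id]
    congr 1
    ext p
    exact hgf p

theorem MuHatVariety.motive_eq_of_rel {X Y : MuHatVariety}
    (h : MuHatVariety.Rel (FreeCommRing.of X) (FreeCommRing.of Y)) : X.motive = Y.motive :=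
  congrArg (algebraMap KMuHat MMuHat) (Ideal.Quotient.eq.mpr (Ideal.subset_span
    ⟨_, _, h, by ring⟩))

/-! ## Relations between motives of affine varieties -/

/-- Mutually inverse regular maps on points induce inverse isomorphisms of coordinate rings.
Equivariance is tested on $\hat\mu$, so the two sides may use different levels and weights. -/
theorem MuHatVariety.motive_ofSet_congr {σ τ : Type} [Finite σ] [Finite τ] {k k' : ℕ+}
    {w : σ → ℕ} {w' : τ → ℕ} {Z : Set (σ → ℂ)} {W : Set (τ → ℂ)}
    (hZ : ScaleInvariant k w Z) (hW : ScaleInvariant k' w' W)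
    (F : (σ → ℂ) → τ → ℂ) (G : (τ → ℂ) → σ → ℂ)
    (hF : ∀ j, IsRegularOn Z fun a => F a j) (hG : ∀ i, IsRegularOn W fun b => G b i)
    (hFm : Set.MapsTo F Z W) (hGm : Set.MapsTo G W Z)
    (hGF : ∀ a ∈ Z, G (F a) = a) (hFG : ∀ b ∈ W, F (G b) = b)
    (hequiv : ∀ ξ : MuHat, ∀ a ∈ Z, ∀ j,
      F (fun i => MuHat.root k ξ ^ w i * a i) j = MuHat.root k' ξ ^ w' j * F a j) :
    (MuHatVariety.ofSet k w Z hZ).motive = (MuHatVariety.ofSet k' w' W hW).motive := by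
  have := isReduced_coordRing Z
  have := isReduced_coordRing W
  refine MuHatVariety.motive_eq_of_rel (.iso _ _ ?_)
  refine MuHatVariety.nonempty_affine_iso (coordAction k' w' W hW) (coordAction k w Z hZ)
    (CoordRing.pullback F hF hFm) (CoordRing.pullback G hG hGm) ?_ ?_ ?_
  · intro p
    refine CoordRing.ext_points fun a => ?_
    rw [CoordRing.evalAt_pullback, CoordRing.evalAt_pullback]
    congr 2
    exact Subtype.ext (hGF a a.2)
  · intro p
    refine CoordRing.ext_points fun a => ?_
    rw [CoordRing.evalAt_pullback, CoordRing.evalAt_pullback]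
    congr 2
    exact Subtype.ext (hFG a a.2)
  · intro ξ p
    refine CoordRing.ext_points fun a => ?_
    rw [CoordRing.evalAt_coordAction hZ ξ a (hZ.root_mem ξ a.2), CoordRing.evalAt_pullback,
      CoordRing.evalAt_pullback, CoordRing.evalAt_coordAction hW ξ _ (hW.root_mem ξ (hFm a.2))]
    congr 2
    exact Subtype.ext (funext fun j => (hequiv ξ a a.2 j).symm)

/-- The open part is $D(r)$. The conditions `hfr` and `hker` say that $\ker f$ and $(r)$ have the
same radical, so the closed part is $V(r)$. -/
theorem MuHatVariety.motive_affine_scissor {k k' k'' : ℕ+} {A B C : Type} [CommRing A]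
    [Algebra ℂ A] [Algebra.FiniteType ℂ A] [_root_.IsReduced A] [CommRing B] [Algebra ℂ B]
    [Algebra.FiniteType ℂ B] [_root_.IsReduced B] [CommRing C] [Algebra ℂ C]
    [Algebra.FiniteType ℂ C] [_root_.IsReduced C]
    (ρ : rootsOfUnity (k : ℕ) ℂ →* (A →ₐ[ℂ] A)) (ρ' : rootsOfUnity (k' : ℕ) ℂ →* (B →ₐ[ℂ] B))
    (ρ'' : rootsOfUnity (k'' : ℕ) ℂ →* (C →ₐ[ℂ] C))
    (f : A →ₐ[ℂ] B) (g : A →ₐ[ℂ] C) (r : A)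
    (hf : ∀ (ξ : MuHat) (p : A), f (ρ (MuHat.proj k ξ) p) = ρ' (MuHat.proj k' ξ) (f p))
    (hg : ∀ (ξ : MuHat) (p : A), g (ρ (MuHat.proj k ξ) p) = ρ'' (MuHat.proj k'' ξ) (g p))
    (hfs : Function.Surjective f) (hfr : f r = 0) (hker : ∀ p, f p = 0 → ∃ n : ℕ, r ∣ p ^ n)
    (hloc : @IsLocalization.Away A _ r C _ g.toRingHom.toAlgebra) :
    (MuHatVariety.affine k A ρ).motive =
      (MuHatVariety.affine k' B ρ').motive + (MuHatVariety.affine k'' C ρ'').motive := by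
  have key : MuHatVariety.Rel (FreeCommRing.of (MuHatVariety.affine k A ρ))
      (FreeCommRing.of (MuHatVariety.affine k' B ρ') +
        FreeCommRing.of (MuHatVariety.affine k'' C ρ'')) := by
    refine .scissor _ _ _ (affineHom ρ ρ' f hf) (affineHom ρ ρ'' g hg) ?_ ?_ ?_
    · exact IsClosedImmersion.spec_of_surjective _ hfs
    · let _ := g.toRingHom.toAlgebra
      exact IsOpenImmersion.of_isLocalization (S := C) r
    · let _ := g.toRingHom.toAlgebra
      have h1 : Set.range (affineHom ρ ρ'' g hg).hom.left =
          (PrimeSpectrum.basicOpen r : Set (PrimeSpectrum A)) :=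
        PrimeSpectrum.localization_away_comap_range C r
      have h2 : Set.range (affineHom ρ ρ' f hf).hom.left =
          PrimeSpectrum.zeroLocus (RingHom.ker f.toRingHom : Set A) :=
        range_comap_of_surjective _ f.toRingHom hfs
      rw [h1, h2, PrimeSpectrum.basicOpen_eq_zeroLocus_compl]
      congr 1
      refine Set.Subset.antisymm ?_ ?_
      · intro x hx p hp
        obtain ⟨n, hn⟩ := hker p hp
        refine x.2.mem_of_pow_mem n (Ideal.mem_of_dvd _ hn ?_)
        exact hx rfl
      · intro x hx p hp
        rw [Set.mem_singleton_iff.mp hp]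
        exact hx hfr
  have h := Ideal.Quotient.eq.mpr (Ideal.subset_span (s := {x | ∃ a b, Rel a b ∧ x + b = a})
    ⟨_, _, key, sub_add_cancel _ _⟩)
  rw [map_add] at h
  exact (congrArg (algebraMap KMuHat MMuHat) h).trans (map_add _ _ _)

theorem MuHatVariety.motive_affine_prod {k k' k'' : ℕ+} {A B C : Type} [CommRing A]
    [Algebra ℂ A] [Algebra.FiniteType ℂ A] [_root_.IsReduced A] [CommRing B] [Algebra ℂ B]
    [Algebra.FiniteType ℂ B] [_root_.IsReduced B] [CommRing C] [Algebra ℂ C]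
    [Algebra.FiniteType ℂ C] [_root_.IsReduced C]
    (ρ : rootsOfUnity (k : ℕ) ℂ →* (A →ₐ[ℂ] A)) (ρ' : rootsOfUnity (k' : ℕ) ℂ →* (B →ₐ[ℂ] B))
    (ρ'' : rootsOfUnity (k'' : ℕ) ℂ →* (C →ₐ[ℂ] C))
    (f : A →ₐ[ℂ] C) (g : B →ₐ[ℂ] C)
    (hf : ∀ (ξ : MuHat) (p : A), f (ρ (MuHat.proj k ξ) p) = ρ'' (MuHat.proj k'' ξ) (f p))
    (hg : ∀ (ξ : MuHat) (p : B), g (ρ' (MuHat.proj k' ξ) p) = ρ'' (MuHat.proj k'' ξ) (g p))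
    (h : IsPushout (CommRingCat.ofHom (algebraMap ℂ A)) (CommRingCat.ofHom (algebraMap ℂ B))
      (CommRingCat.ofHom f.toRingHom) (CommRingCat.ofHom g.toRingHom)) :
    (MuHatVariety.affine k'' C ρ'').motive =
      (MuHatVariety.affine k A ρ).motive * (MuHatVariety.affine k' B ρ').motive := by
  have key : MuHatVariety.Rel (FreeCommRing.of (MuHatVariety.affine k'' C ρ''))
      (FreeCommRing.of (MuHatVariety.affine k A ρ) *
        FreeCommRing.of (MuHatVariety.affine k' B ρ')) :=
    .prod _ _ _ (affineHom ρ ρ'' f hf) (affineHom ρ' ρ'' g hg)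
      (isPullback_SpecMap_of_isPushout _ _ _ _ h)
  have h := Ideal.Quotient.eq.mpr (Ideal.subset_span (s := {x | ∃ a b, Rel a b ∧ x + b = a})
    ⟨_, _, key, sub_add_cancel _ _⟩)
  rw [map_mul] at h
  exact (congrArg (algebraMap KMuHat MMuHat) h).trans (map_mul _ _ _)

/-! ## Cutting along a coordinate -/

/-- The set of common zeros of a family of polynomials. -/
def IsAlgebraicSet {σ : Type} (Z : Set (σ → ℂ)) : Prop :=
  ∃ S : Set (MvPolynomial σ ℂ), Z = {a | ∀ p ∈ S, MvPolynomial.aeval a p = 0}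

/-- The locus where the `i`-th coordinate is invertible, with its inverse as a new coordinate. -/
def unitLocus {σ : Type} (Z : Set (σ → ℂ)) (i : σ) : Set (Option σ → ℂ) :=
  {b | (fun j => b (some j)) ∈ Z ∧ b none * b (some i) = 1}

/-- The weights on the locus where the `i`-th coordinate is invertible. -/
def unitWeight {σ : Type} (k : ℕ+) (w : σ → ℕ) (i : σ) : Option σ → ℕ
  | none => (k - 1) * w i
  | some j => w j

/-- Weights are natural numbers, so the weight $-w$ of an inverse coordinate is represented by
$(k-1)w$. -/
theorem pow_pred_mul_pow_eq_one {k : ℕ+} {ζ : ℂ} (hζ : ζ ^ (k : ℕ) = 1) (w : ℕ) :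
    ζ ^ (((k : ℕ) - 1) * w) * ζ ^ w = 1 := by
  rw [← pow_add, ← Nat.succ_mul, Nat.succ_eq_add_one, Nat.sub_add_cancel k.pos, pow_mul, hζ,
    one_pow]

theorem unitLocus_invariant {σ : Type} {k : ℕ+} {w : σ → ℕ} {Z : Set (σ → ℂ)}
    (hZ : ScaleInvariant k w Z) (i : σ) :
    ScaleInvariant k (unitWeight k w i) (unitLocus Z i) := by
  rintro ζ hζ b ⟨hb, hb'⟩
  refine ⟨hZ ζ hζ _ hb, ?_⟩
  change ζ ^ (((k : ℕ) - 1) * w i) * b none * (ζ ^ w i * b (some i)) = 1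
  rw [mul_mul_mul_comm, pow_pred_mul_pow_eq_one hζ, hb', one_mul]

theorem ScaleInvariant.inter_coord {σ : Type} {k : ℕ+} {w : σ → ℕ} {Z : Set (σ → ℂ)}
    (hZ : ScaleInvariant k w Z) (i : σ) : ScaleInvariant k w (Z ∩ {a | a i = 0}) := by
  rintro ζ hζ a ⟨ha, ha'⟩
  refine ⟨hZ ζ hζ a ha, ?_⟩
  change ζ ^ w i * a i = 0
  rw [show a i = 0 from ha', mul_zero]

/-- Denominators are cleared by induction on polynomials, with $X_{\mathrm{none}}X_i=1$. If two
functions agree on the unit locus, they agree on $Z$ after multiplication by $X_i$: a point with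
$a_i\ne0$ lifts, and at the others both products vanish. -/
theorem isLocalization_unitLocus {σ : Type} (Z : Set (σ → ℂ)) (i : σ)
    (hF : ∀ j : σ, IsRegularOn (unitLocus Z i) fun b => b (some j))
    (hm : Set.MapsTo (fun b j => b (some j)) (unitLocus Z i) Z) :
    @IsLocalization.Away (CoordRing Z) _ (Ideal.Quotient.mk _ (MvPolynomial.X i))
      (CoordRing (unitLocus Z i)) _
      (CoordRing.pullback (fun b j => b (some j)) hF hm).toRingHom.toAlgebra := by
  set g := CoordRing.pullback (fun b j => b (some j)) hF hm with hg
  have hgX : ∀ j, g (Ideal.Quotient.mk _ (MvPolynomial.X j)) =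
      Ideal.Quotient.mk _ (MvPolynomial.X (some j)) := by
    intro j
    refine CoordRing.ext_points fun b => ?_
    rw [hg, CoordRing.evalAt_pullback, CoordRing.evalAt_mk, CoordRing.evalAt_mk,
      MvPolynomial.aeval_X, MvPolynomial.aeval_X]
  have hunit : (Ideal.Quotient.mk _ (MvPolynomial.X none) : CoordRing (unitLocus Z i)) *
      Ideal.Quotient.mk _ (MvPolynomial.X (some i)) = 1 := by
    refine CoordRing.ext_points fun b => ?_
    rw [map_mul, CoordRing.evalAt_mk, CoordRing.evalAt_mk, MvPolynomial.aeval_X,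
      MvPolynomial.aeval_X, map_one]
    exact b.2.2
  let _ := g.toRingHom.toAlgebra
  have halg : ∀ x, algebraMap (CoordRing Z) (CoordRing (unitLocus Z i)) x = g x := fun _ => rfl
  refine IsLocalization.Away.mk _ ?_ ?_ ?_
  · rw [halg, hgX]
    exact IsUnit.of_mul_eq_one_right _ hunit
  · intro s
    obtain ⟨p, rfl⟩ := Ideal.Quotient.mk_surjective s
    simp only [halg, hgX]
    induction p using MvPolynomial.induction_on with
    | C c => exact ⟨0, algebraMap ℂ _ c, by rw [pow_zero, mul_one, AlgHom.commutes]; rfl⟩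
    | add p q hp hq =>
      obtain ⟨n, a, ha⟩ := hp
      obtain ⟨n', a', ha'⟩ := hq
      refine ⟨n + n', a * Ideal.Quotient.mk _ (MvPolynomial.X i) ^ n' +
        a' * Ideal.Quotient.mk _ (MvPolynomial.X i) ^ n, ?_⟩
      simp only [map_add, map_mul, map_pow, hgX, ← ha, ← ha']
      ring
    | mul_X p j hp =>
      obtain ⟨n, a, ha⟩ := hp
      cases j with
      | none =>
        refine ⟨n + 1, a, ?_⟩
        rw [← ha, map_mul, pow_succ]
        linear_combination (Ideal.Quotient.mk _ p *
          Ideal.Quotient.mk _ (MvPolynomial.X (some i)) ^ n) * hunit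
      | some j =>
        refine ⟨n, a * Ideal.Quotient.mk _ (MvPolynomial.X j), ?_⟩
        simp only [map_mul, hgX, ← ha]
        ring
  · intro p q hpq
    refine ⟨1, CoordRing.ext_points fun a => ?_⟩
    rw [pow_one, map_mul, map_mul, CoordRing.evalAt_mk, MvPolynomial.aeval_X]
    by_cases h0 : a.1 i = 0
    · rw [h0, zero_mul, zero_mul]
    · have hb : (fun o : Option σ => o.elim (a.1 i)⁻¹ a.1) ∈ unitLocus Z i :=
        ⟨a.2, inv_mul_cancel₀ h0⟩
      have := congrArg (CoordRing.evalAt _ ⟨_, hb⟩) hpq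
      rw [halg, halg, hg, CoordRing.evalAt_pullback, CoordRing.evalAt_pullback] at this
      exact congrArg _ this

/-- Algebraicity of $Z$ enters through the Nullstellensatz: a polynomial vanishing on
$Z\cap\{a_i=0\}$ has a power in the ideal generated by the equations of $Z$ and $X_i$, so that power
is divisible by $X_i$ in the coordinate ring of $Z$. -/
theorem MuHatVariety.motive_ofSet_cut {σ : Type} [Finite σ] {k : ℕ+} {w : σ → ℕ}
    {Z : Set (σ → ℂ)} (hZ : ScaleInvariant k w Z) (hZa : IsAlgebraicSet Z) (i : σ) :
    (MuHatVariety.ofSet k w Z hZ).motive =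
      (MuHatVariety.ofSet k w (Z ∩ {a | a i = 0}) (hZ.inter_coord i)).motive +
      (MuHatVariety.ofSet k (unitWeight k w i) (unitLocus Z i)
        (unitLocus_invariant hZ i)).motive := by
  have := isReduced_coordRing Z
  have := isReduced_coordRing (Z ∩ {a | a i = 0})
  have := isReduced_coordRing (unitLocus Z i)
  have hF : ∀ j : σ, IsRegularOn (Z ∩ {a | a i = 0}) fun b => b j := fun j => .coord j
  have hm : Set.MapsTo (fun b : σ → ℂ => b) (Z ∩ {a | a i = 0}) Z := fun b hb => hb.1
  have hF' : ∀ j : σ, IsRegularOn (unitLocus Z i) fun b => b (some j) := fun j => .coord _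
  have hm' : Set.MapsTo (fun b j => b (some j)) (unitLocus Z i) Z := fun b hb => hb.1
  have hfm : ∀ p, CoordRing.pullback (fun b : σ → ℂ => b) hF hm (Ideal.Quotient.mk _ p) =
      Ideal.Quotient.mk _ p := by
    intro p
    refine CoordRing.ext_points fun a => ?_
    rw [CoordRing.evalAt_pullback, CoordRing.evalAt_mk, CoordRing.evalAt_mk]
  refine MuHatVariety.motive_affine_scissor (coordAction k w Z hZ)
    (coordAction k w _ (hZ.inter_coord i)) (coordAction k _ _ (unitLocus_invariant hZ i))
    (CoordRing.pullback (fun b : σ → ℂ => b) hF hm)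
    (CoordRing.pullback (fun b j => b (some j)) hF' hm')
    (Ideal.Quotient.mk _ (MvPolynomial.X i)) ?_ ?_ ?_ ?_ ?_ (isLocalization_unitLocus Z i hF' hm')
  · intro ξ p
    refine CoordRing.ext_points fun a => ?_
    rw [CoordRing.evalAt_pullback, CoordRing.evalAt_coordAction hZ ξ _ (hZ.root_mem ξ a.2.1),
      CoordRing.evalAt_coordAction (hZ.inter_coord i) ξ _ ((hZ.inter_coord i).root_mem ξ a.2),
      CoordRing.evalAt_pullback]
  · intro ξ p
    refine CoordRing.ext_points fun a => ?_
    rw [CoordRing.evalAt_pullback, CoordRing.evalAt_coordAction hZ ξ _ (hZ.root_mem ξ a.2.1),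
      CoordRing.evalAt_coordAction (unitLocus_invariant hZ i) ξ _
        ((unitLocus_invariant hZ i).root_mem ξ a.2),
      CoordRing.evalAt_pullback]
    rfl
  · intro p
    obtain ⟨p, rfl⟩ := Ideal.Quotient.mk_surjective p
    exact ⟨_, hfm p⟩
  · rw [hfm]
    refine CoordRing.ext_points fun a => ?_
    rw [CoordRing.evalAt_mk, MvPolynomial.aeval_X, map_zero]
    exact a.2.2
  · intro p hp
    obtain ⟨p, rfl⟩ := Ideal.Quotient.mk_surjective p
    rw [hfm] at hp
    obtain ⟨S, rfl⟩ := hZa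
    have h1 : p ∈ MvPolynomial.vanishingIdeal ℂ (MvPolynomial.zeroLocus ℂ
        (Ideal.span S ⊔ Ideal.span {(MvPolynomial.X i : MvPolynomial σ ℂ)})) := by
      intro a ha
      refine Ideal.Quotient.eq_zero_iff_mem.mp hp a ⟨?_, ?_⟩
      · exact fun q hq => ha q (Ideal.mem_sup_left (Ideal.subset_span hq))
      · have := ha _ (Ideal.mem_sup_right (Ideal.mem_span_singleton_self (MvPolynomial.X i)))
        rwa [MvPolynomial.aeval_X] at this
    rw [MvPolynomial.vanishingIdeal_zeroLocus_eq_radical] at h1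
    obtain ⟨n, hn⟩ := h1
    obtain ⟨s, hs, t, ht, hst⟩ := Submodule.mem_sup.mp hn
    obtain ⟨q, rfl⟩ := Ideal.mem_span_singleton.mp ht
    refine ⟨n, Ideal.Quotient.mk _ q, ?_⟩
    rw [← map_pow, ← hst, map_add, map_mul]
    have : (Ideal.Quotient.mk _ s : CoordRing {a : σ → ℂ | ∀ p ∈ S, MvPolynomial.aeval a p = 0})
        = 0 := by
      refine Ideal.Quotient.eq_zero_iff_mem.mpr fun a ha => ?_
      have : Ideal.span S ≤ RingHom.ker (MvPolynomial.aeval a : MvPolynomial σ ℂ →ₐ[ℂ] ℂ) :=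
        Ideal.span_le.mpr ha
      exact this hs
    rw [this, zero_add]

/-! ## Free coordinates -/

/-- The diagonal action of `μ_k` on the polynomial ring. -/
noncomputable def scaleAction {σ : Type} (k : ℕ+) (w : σ → ℕ) :
    rootsOfUnity (k : ℕ) ℂ →* (MvPolynomial σ ℂ →ₐ[ℂ] MvPolynomial σ ℂ) where
  toFun ζ := scaleHom w ((ζ : ℂˣ) : ℂ)
  map_one' := scaleHom_one w
  map_mul' a b := scaleHom_mul w ((a : ℂˣ) : ℂ) ((b : ℂˣ) : ℂ)

/-- The only use of the relation for linear actions: a line of any weight has class $\mathbb L$. -/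
theorem motive_affineLine (k : ℕ+) (w : Fin 1 → ℕ) :
    (MuHatVariety.affine k (MvPolynomial (Fin 1) ℂ) (scaleAction k w)).motive =
      (lefschetz : MMuHat) := by
  refine (MuHatVariety.motive_eq_of_rel (.linear 1 k (scaleAction k w) fun ζ i => ?_)).trans rfl
  change (scaleHom w _ (MvPolynomial.X i)).IsHomogeneous 1
  rw [scaleHom, MvPolynomial.aeval_X]
  exact (MvPolynomial.isHomogeneous_X ℂ i).C_mul _

/-- The set `Z` is stable under all changes of the `i`-th coordinate. -/
def IsFreeCoord {σ : Type} (Z : Set (σ → ℂ)) (i : σ) : Prop :=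
  ∀ a ∈ Z, ∀ c : ℂ, ∀ b : σ → ℂ, b i = c → (∀ j, j ≠ i → b j = a j) → b ∈ Z

/-- The coordinate ring of a set with a free coordinate, as a polynomial ring. -/
theorem exists_coordRing_toPolynomial {σ : Type} {Z : Set (σ → ℂ)} {i : σ}
    (hfree : IsFreeCoord Z i) :
    ∃ φ : CoordRing Z →+* Polynomial (CoordRing (Z ∩ {a | a i = 0})),
      (∀ c : ℂ, φ (algebraMap ℂ _ c) = Polynomial.C (algebraMap ℂ _ c)) ∧
      φ (Ideal.Quotient.mk _ (MvPolynomial.X i)) = Polynomial.X ∧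
      ∀ j, j ≠ i → φ (Ideal.Quotient.mk _ (MvPolynomial.X j)) =
        Polynomial.C (Ideal.Quotient.mk _ (MvPolynomial.X j)) := by
  classical
  set Z₀ := Z ∩ {a | a i = 0}
  let v : σ → Polynomial (CoordRing Z₀) := fun j =>
    if j = i then Polynomial.X else Polynomial.C (Ideal.Quotient.mk _ (MvPolynomial.X j))
  have key : ∀ p ∈ MvPolynomial.vanishingIdeal ℂ Z, MvPolynomial.aeval (R := ℂ) v p = 0 := by
    intro p hp
    refine Polynomial.ext fun n => CoordRing.ext_points fun a => ?_
    have h0 : Polynomial.mapAlgHom (CoordRing.evalAt Z₀ a) (MvPolynomial.aeval v p) = 0 := by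
      -- A polynomial over $\mathbb C$ is zero if all its values are. The value at $c$ is $p$ at the
      -- point $a$ with $i$-th coordinate changed to $c$, which lies in $Z$ by freeness.
      refine Polynomial.funext fun c => ?_
      have h1 := MvPolynomial.comp_aeval (R := ℂ) v
        ((Polynomial.aeval c : Polynomial ℂ →ₐ[ℂ] ℂ).comp
          (Polynomial.mapAlgHom (CoordRing.evalAt Z₀ a)))
      have h2 := DFunLike.congr_fun h1 p
      simp only [AlgHom.comp_apply] at h2
      have h3 : (fun j => ((Polynomial.aeval c : Polynomial ℂ →ₐ[ℂ] ℂ).comp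
          (Polynomial.mapAlgHom (CoordRing.evalAt Z₀ a))) (v j)) ∈ Z := by
        refine hfree a a.2.1 c _ ?_ ?_
        · simp only [v, if_true, AlgHom.comp_apply, Polynomial.coe_mapAlgHom, Polynomial.map_X,
            Polynomial.aeval_X]
        · intro j hj
          simp only [v, hj, if_false, AlgHom.comp_apply, Polynomial.coe_mapAlgHom,
            Polynomial.map_C, Polynomial.aeval_C]
          exact MvPolynomial.aeval_X _ j
      rw [Polynomial.eval_zero]
      exact h2.trans (hp _ h3)
    have := congrArg (fun q => Polynomial.coeff q n) h0
    rw [Polynomial.coeff_zero, map_zero]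
    exact (Polynomial.coeff_map (CoordRing.evalAt Z₀ a : CoordRing Z₀ →+* ℂ) n).symm.trans this
  refine ⟨(Ideal.Quotient.liftₐ _ (MvPolynomial.aeval v) key).toRingHom, ?_, ?_, ?_⟩
  · intro c
    change MvPolynomial.aeval v (MvPolynomial.C c) = _
    rw [MvPolynomial.aeval_C, Polynomial.algebraMap_apply]
  · change MvPolynomial.aeval v (MvPolynomial.X i) = _
    simp [v]
  · intro j hj
    change MvPolynomial.aeval v (MvPolynomial.X j) = _
    simp [v, hj]

theorem CoordRing.ringHom_ext {σ : Type} {Z : Set (σ → ℂ)} {B : Type*} [CommRing B]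
    {f g : CoordRing Z →+* B} (h : ∀ c : ℂ, f (algebraMap ℂ _ c) = g (algebraMap ℂ _ c))
    (h' : ∀ j, f (Ideal.Quotient.mk _ (MvPolynomial.X j)) =
      g (Ideal.Quotient.mk _ (MvPolynomial.X j))) : f = g := by
  refine Ideal.Quotient.ringHom_ext (MvPolynomial.ringHom_ext ?_ ?_)
  · exact h
  · exact h'

/-- Maps out of $\mathbb C[Z]$ are produced by passing to $\mathbb C[Z\cap\{a_i=0\}][X]$ and
evaluating there. Only a homomorphism to that polynomial ring is needed, since uniqueness is checked
on coordinates. -/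
theorem isPushout_of_isFreeCoord {σ : Type} {Z : Set (σ → ℂ)} {i : σ} (hfree : IsFreeCoord Z i)
    (f : CoordRing (Z ∩ {a | a i = 0}) →ₐ[ℂ] CoordRing Z)
    (hi : f (Ideal.Quotient.mk _ (MvPolynomial.X i)) = 0)
    (hj : ∀ j, j ≠ i → f (Ideal.Quotient.mk _ (MvPolynomial.X j)) =
      Ideal.Quotient.mk _ (MvPolynomial.X j))
    (g : MvPolynomial (Fin 1) ℂ →ₐ[ℂ] CoordRing Z)
    (hg : ∀ j, g (MvPolynomial.X j) = Ideal.Quotient.mk _ (MvPolynomial.X i)) :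
    IsPushout (CommRingCat.ofHom (algebraMap ℂ (CoordRing (Z ∩ {a | a i = 0}))))
      (CommRingCat.ofHom (algebraMap ℂ (MvPolynomial (Fin 1) ℂ)))
      (CommRingCat.ofHom f.toRingHom) (CommRingCat.ofHom g.toRingHom) := by
  obtain ⟨φ, hφc, hφi, hφj⟩ := exists_coordRing_toPolynomial hfree
  have hX0 : (Ideal.Quotient.mk _ (MvPolynomial.X i) : CoordRing (Z ∩ {a | a i = 0})) = 0 :=
    CoordRing.ext_points fun a => by
      rw [CoordRing.evalAt_mk, MvPolynomial.aeval_X, map_zero]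
      exact a.2.2
  have hcomm : CommRingCat.ofHom (algebraMap ℂ (CoordRing (Z ∩ {a | a i = 0}))) ≫
      CommRingCat.ofHom f.toRingHom =
      CommRingCat.ofHom (algebraMap ℂ (MvPolynomial (Fin 1) ℂ)) ≫
        CommRingCat.ofHom g.toRingHom := by
    rw [← CommRingCat.ofHom_comp, ← CommRingCat.ofHom_comp]
    congr 1
    exact f.comp_algebraMap.trans g.comp_algebraMap.symm
  refine IsPushout.of_isColimit' ⟨hcomm⟩ (Limits.PushoutCocone.IsColimit.mk _
    (fun s => CommRingCat.ofHom ((Polynomial.eval₂RingHom s.inl.hom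
      (s.inr.hom (MvPolynomial.X 0))).comp φ)) ?_ ?_ ?_)
  · intro s
    apply CommRingCat.hom_ext
    refine CoordRing.ringHom_ext (fun c => ?_) fun j => ?_
    · change Polynomial.eval₂ s.inl.hom _ (φ (f (algebraMap ℂ _ c))) = _
      rw [AlgHom.commutes, hφc, Polynomial.eval₂_C]
    · change Polynomial.eval₂ s.inl.hom _ (φ (f _)) = _
      by_cases h : j = i
      · subst h
        rw [hi, hX0, map_zero, Polynomial.eval₂_zero]
        exact (map_zero s.inl.hom).symm
      · rw [hj j h, hφj j h, Polynomial.eval₂_C]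
  · intro s
    apply CommRingCat.hom_ext
    refine MvPolynomial.ringHom_ext (fun c => ?_) fun j => ?_
    · change Polynomial.eval₂ s.inl.hom _ (φ (g (algebraMap ℂ _ c))) = s.inr.hom _
      rw [AlgHom.commutes, hφc, Polynomial.eval₂_C]
      exact DFunLike.congr_fun (congrArg CommRingCat.Hom.hom s.condition) c
    · change Polynomial.eval₂ s.inl.hom _ (φ (g _)) = s.inr.hom _
      rw [hg, hφi, Polynomial.eval₂_X, Subsingleton.elim j 0]
  · intro s t hinl hinr
    have h1 : ∀ x, t.hom (f x) = s.inl.hom x := fun x =>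
      DFunLike.congr_fun (congrArg CommRingCat.Hom.hom hinl) x
    have h2 : ∀ x, t.hom (g x) = s.inr.hom x := fun x =>
      DFunLike.congr_fun (congrArg CommRingCat.Hom.hom hinr) x
    apply CommRingCat.hom_ext
    refine CoordRing.ringHom_ext (fun c => ?_) fun j => ?_
    · change _ = Polynomial.eval₂ s.inl.hom _ (φ _)
      rw [hφc, Polynomial.eval₂_C, ← h1, AlgHom.commutes]
    · change _ = Polynomial.eval₂ s.inl.hom _ (φ _)
      by_cases h : j = i
      · subst h
        rw [hφi, Polynomial.eval₂_X, ← h2, hg]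
      · rw [hφj j h, Polynomial.eval₂_C, ← h1, hj j h]

/-- $Z$ is equivariantly the product of its slice $a_i=0$ and a line of weight $w_i$, because the
action is diagonal. -/
theorem MuHatVariety.motive_ofSet_free {σ : Type} [Finite σ] {k : ℕ+} {w : σ → ℕ}
    {Z : Set (σ → ℂ)} (hZ : ScaleInvariant k w Z) (i : σ) (hfree : IsFreeCoord Z i) :
    (MuHatVariety.ofSet k w Z hZ).motive =
      (MuHatVariety.ofSet k w (Z ∩ {a | a i = 0}) (hZ.inter_coord i)).motive *
        (lefschetz : MMuHat) := by
  classical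
  have := isReduced_coordRing Z
  have := isReduced_coordRing (Z ∩ {a | a i = 0})
  let F : (σ → ℂ) → σ → ℂ := fun a j => if j = i then 0 else a j
  have hF : ∀ j, IsRegularOn Z fun a => F a j := by
    intro j
    by_cases h : j = i
    · simpa only [F, h, if_true] using IsRegularOn.const 0
    · simpa only [F, h, if_false] using IsRegularOn.coord j
  have hFm : Set.MapsTo F Z (Z ∩ {a | a i = 0}) := fun a ha =>
    ⟨hfree a ha 0 _ (if_pos rfl) fun j hj => if_neg hj, if_pos rfl⟩
  have hFX : ∀ j, CoordRing.pullback F hF hFm (Ideal.Quotient.mk _ (MvPolynomial.X j)) =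
      if j = i then 0 else Ideal.Quotient.mk _ (MvPolynomial.X j) := by
    intro j
    refine CoordRing.ext_points fun a => ?_
    rw [CoordRing.evalAt_pullback, CoordRing.evalAt_mk, MvPolynomial.aeval_X]
    by_cases h : j = i
    · simp [F, h]
    · simp [F, h, CoordRing.evalAt_mk]
  rw [← motive_affineLine k fun _ => w i]
  refine MuHatVariety.motive_affine_prod (coordAction k w _ (hZ.inter_coord i))
    (scaleAction k fun _ => w i) (coordAction k w Z hZ) (CoordRing.pullback F hF hFm)
    (MvPolynomial.aeval fun _ => Ideal.Quotient.mk _ (MvPolynomial.X i)) ?_ ?_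
    (isPushout_of_isFreeCoord hfree _ ?_ ?_ _ fun j => MvPolynomial.aeval_X _ _)
  · intro ξ p
    refine CoordRing.ext_points fun a => ?_
    rw [CoordRing.evalAt_pullback, CoordRing.evalAt_coordAction (hZ.inter_coord i) ξ _
      ((hZ.inter_coord i).root_mem ξ (hFm a.2)), CoordRing.evalAt_coordAction hZ ξ _
      (hZ.root_mem ξ a.2), CoordRing.evalAt_pullback]
    congr 2
    refine Subtype.ext (funext fun j => ?_)
    simp [F]
  · intro ξ p
    refine CoordRing.ext_points fun a => ?_
    rw [CoordRing.evalAt_coordAction hZ ξ _ (hZ.root_mem ξ a.2)]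
    have h1 := DFunLike.congr_fun (MvPolynomial.comp_aeval (R := ℂ)
      (fun _ : Fin 1 => (Ideal.Quotient.mk _ (MvPolynomial.X i) : CoordRing Z))
      (CoordRing.evalAt Z a)) (scaleAction k (fun _ => w i) (MuHat.proj k ξ) p)
    refine h1.trans ((aeval_scaleHom _ _ _ p).trans ?_)
    rw [← AlgHom.comp_apply, MvPolynomial.comp_aeval]
    congr 2
    funext j
    rw [CoordRing.evalAt_mk, CoordRing.evalAt_mk, MvPolynomial.aeval_X, MvPolynomial.aeval_X]
    rfl
  · rw [hFX, if_pos rfl]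
  · intro j hj
    rw [hFX, if_neg hj]

theorem ScaleInvariant.inter_coords {σ : Type} {k : ℕ+} {w : σ → ℕ} {Z : Set (σ → ℂ)}
    (hZ : ScaleInvariant k w Z) (s : Finset σ) :
    ScaleInvariant k w (Z ∩ {a | ∀ i ∈ s, a i = 0}) := by
  rintro ζ hζ a ⟨ha, ha'⟩
  refine ⟨hZ ζ hζ a ha, fun i hi => ?_⟩
  change ζ ^ w i * a i = 0
  rw [ha' i hi, mul_zero]

theorem MuHatVariety.motive_ofSet_of_eq {σ : Type} [Finite σ] {k : ℕ+} {w : σ → ℕ}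
    {Z Z' : Set (σ → ℂ)} (hZ : ScaleInvariant k w Z) (h : Z = Z') :
    (MuHatVariety.ofSet k w Z hZ).motive = (MuHatVariety.ofSet k w Z' (h ▸ hZ)).motive := by
  subst h
  rfl

theorem MuHatVariety.motive_ofSet_frees {σ : Type} [Finite σ] {k : ℕ+} {w : σ → ℕ}
    {Z : Set (σ → ℂ)} (hZ : ScaleInvariant k w Z) (s : Finset σ)
    (hfree : ∀ i ∈ s, IsFreeCoord Z i) :
    (MuHatVariety.ofSet k w Z hZ).motive =
      (MuHatVariety.ofSet k w (Z ∩ {a | ∀ i ∈ s, a i = 0}) (hZ.inter_coords s)).motive *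
        (lefschetz : MMuHat) ^ s.card := by
  classical
  induction s using Finset.induction_on with
  | empty =>
    rw [Finset.card_empty, pow_zero, mul_one]
    exact motive_ofSet_of_eq hZ (by ext; simp)
  | insert i s hi ih =>
    rw [ih fun j hj => hfree j (Finset.mem_insert_of_mem hj),
      motive_ofSet_free (hZ.inter_coords s) i, Finset.card_insert_of_notMem hi, pow_succ',
      mul_assoc]
    · congr 1
      refine motive_ofSet_of_eq _ ?_
      ext a
      simp only [Set.mem_inter_iff, Set.mem_ofPred_eq, Finset.forall_mem_insert]
      tauto
    · rintro a ⟨ha, ha'⟩ c b hb hba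
      refine ⟨hfree i (Finset.mem_insert_self i s) a ha c b hb hba, fun j hj => ?_⟩
      rw [hba j (fun h => hi (h ▸ hj))]
      exact ha' j hj

/-! ## Orders of vanishing of polynomials -/

namespace Polynomial

theorem coeff_iterate_divX (p : ℂ[X]) (m l : ℕ) : (divX^[m] p).coeff l = p.coeff (l + m) := by
  induction m generalizing p with
  | zero => rfl
  | succ m ih => rw [Function.iterate_succ_apply, ih, coeff_divX, add_assoc]

theorem X_pow_mul_iterate_divX {p : ℂ[X]} {m : ℕ} (h : ∀ i < m, p.coeff i = 0) :
    X ^ m * divX^[m] p = p := by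
  ext l
  rw [coeff_X_pow_mul']
  split_ifs with hl
  · rw [coeff_iterate_divX, Nat.sub_add_cancel hl]
  · exact (h l (not_le.mp hl)).symm

/-- The rounded quotient `k / n` allows one formula for all $k$: if $n\nmid k$, its index is in the
range where $p$ vanishes, and both sides are $0$. -/
theorem coeff_pow_of_vanishing {p : ℂ[X]} {n k : ℕ} (hn : 0 < n)
    (h : ∀ i, n * i < k → p.coeff i = 0) :
    (∀ j < k, (p ^ n).coeff j = 0) ∧ (p ^ n).coeff k = p.coeff (k / n) ^ n := by
  by_cases hd : n ∣ k
  · obtain ⟨c, rfl⟩ := hd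
    have h1 := X_pow_mul_iterate_divX (p := p) (m := c)
      fun i hi => h i (Nat.mul_lt_mul_of_pos_left hi hn)
    have h2 : p ^ n = X ^ (n * c) * (divX^[c] p) ^ n := by
      conv_lhs => rw [← h1]
      rw [mul_pow, ← pow_mul, mul_comm c n]
    rw [h2, Nat.mul_div_cancel_left c hn]
    refine ⟨fun j hj => ?_, ?_⟩
    · rw [coeff_X_pow_mul', if_neg (not_le.mpr hj)]
    · rw [coeff_X_pow_mul', if_pos le_rfl, Nat.sub_self, coeff_zero_eq_eval_zero, eval_pow,
        ← coeff_zero_eq_eval_zero, coeff_iterate_divX, zero_add]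
  · have hlt : n * (k / n) < k := lt_of_le_of_ne (Nat.mul_div_le k n)
      fun he => hd ⟨_, he.symm⟩
    have hlt' : k < n * (k / n + 1) := Nat.lt_mul_div_succ k hn
    have h1 := X_pow_mul_iterate_divX (p := p) (m := k / n + 1)
      fun i hi => h i (lt_of_le_of_lt (Nat.mul_le_mul_left n (Nat.lt_succ_iff.mp hi)) hlt)
    have h2 : p ^ n = X ^ (n * (k / n + 1)) * (divX^[k / n + 1] p) ^ n := by
      conv_lhs => rw [← h1]
      rw [mul_pow, ← pow_mul, mul_comm n]
    have h3 : ∀ j ≤ k, (p ^ n).coeff j = 0 := fun j hj => by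
      rw [h2, coeff_X_pow_mul', if_neg (not_le.mpr (lt_of_le_of_lt hj hlt'))]
    exact ⟨fun j hj => h3 j hj.le, by rw [h3 k le_rfl, h _ hlt, zero_pow hn.ne']⟩

theorem exists_order {p : ℂ[X]} (hp : p ≠ 0) :
    ∃ a, p.coeff a ≠ 0 ∧ ∀ i < a, p.coeff i = 0 := by
  classical
  have h : ∃ a, p.coeff a ≠ 0 := by
    by_contra! h
    exact hp (Polynomial.ext h)
  exact ⟨Nat.find h, Nat.find_spec h, fun i hi => not_not.mp (Nat.find_min h hi)⟩

theorem coeff_pow_of_order {p : ℂ[X]} {a n : ℕ} (hn : 0 < n) (h : ∀ i < a, p.coeff i = 0) :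
    (∀ j < n * a, (p ^ n).coeff j = 0) ∧ (p ^ n).coeff (n * a) = p.coeff a ^ n := by
  have := coeff_pow_of_vanishing (k := n * a) hn fun i hi => h i (Nat.lt_of_mul_lt_mul_left hi)
  rwa [Nat.mul_div_cancel_left a hn] at this

/-- If $x$ had order $a$ with $na<k$, then $x^n$ would have to cancel against $y^m$, so $na=mb$ with
$b$ the order of $y$. Coprimality gives $m\mid a$, and $a>0$ gives $na\ge mn\ge k$. Once $x^n$ has
order at least $k$, so has $y^m$. -/
theorem vanishing_of_pow_sub_pow {m n k : ℕ} (hm : 0 < m) (hn : 0 < n) (hmn : Nat.Coprime m n)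
    (hk : k ≤ m * n) {x y : ℂ[X]} (hx : x.coeff 0 = 0)
    (h : ∀ j < k, (y ^ m - x ^ n).coeff j = 0) :
    (∀ i, n * i < k → x.coeff i = 0) ∧ ∀ i, m * i < k → y.coeff i = 0 := by
  have key : ∀ i, n * i < k → x.coeff i = 0 := by
    by_contra! hcon
    obtain ⟨i, hi, hxi⟩ := hcon
    have hx0 : x ≠ 0 := fun h0 => hxi (by rw [h0, coeff_zero])
    obtain ⟨a, ha, ha'⟩ := exists_order hx0
    have hai : a ≤ i := not_lt.mp fun hlt => hxi (ha' i hlt)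
    have hak : n * a < k := lt_of_le_of_lt (Nat.mul_le_mul_left n hai) hi
    obtain ⟨hl, he⟩ := coeff_pow_of_order hn ha'
    have hyl : ∀ j < n * a, (y ^ m).coeff j = 0 := fun j hj => by
      have := h j (hj.trans hak)
      rwa [coeff_sub, hl j hj, sub_zero] at this
    have hye : (y ^ m).coeff (n * a) ≠ 0 := by
      have := h _ hak
      rw [coeff_sub, he, sub_eq_zero] at this
      rw [this]
      exact pow_ne_zero n ha
    have hy0 : y ≠ 0 := by
      rintro rfl
      rw [zero_pow hm.ne', coeff_zero] at hye
      exact hye rfl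
    obtain ⟨b, hb, hb'⟩ := exists_order hy0
    obtain ⟨hbl, hbe⟩ := coeff_pow_of_order hm hb'
    have hab : n * a = m * b := by
      refine le_antisymm (not_lt.mp fun hlt => ?_) (not_lt.mp fun hlt => hye (hbl _ hlt))
      have := hyl _ hlt
      rw [hbe] at this
      exact pow_ne_zero m hb this
    have hma : m ∣ a := hmn.dvd_of_dvd_mul_left ⟨b, hab⟩
    have ha0 : 0 < a := Nat.pos_of_ne_zero fun h0 => ha (h0 ▸ hx)
    have := Nat.mul_le_mul_left n (Nat.le_of_dvd ha0 hma)
    rw [mul_comm n m] at this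
    omega
  refine ⟨key, ?_⟩
  by_contra! hcon
  obtain ⟨i, hi, hyi⟩ := hcon
  have hy0 : y ≠ 0 := fun h0 => hyi (by rw [h0, coeff_zero])
  obtain ⟨b, hb, hb'⟩ := exists_order hy0
  have hbi : b ≤ i := not_lt.mp fun hlt => hyi (hb' i hlt)
  have hbk : m * b < k := lt_of_le_of_lt (Nat.mul_le_mul_left m hbi) hi
  have := h _ hbk
  rw [coeff_sub, (coeff_pow_of_order hm hb').2, (coeff_pow_of_vanishing hn key).1 _ hbk,
    sub_zero] at this
  exact pow_ne_zero m hb this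

theorem X_pow_dvd_pow_sub_X_pow_iff {G : ℂ[X]} {N d : ℕ} (hd : 0 < d) :
    X ^ (N + 1) ∣ G ^ d - X ^ N ↔
      ∃ k, N = k * d ∧ (∀ j < k, G.coeff j = 0) ∧ G.coeff k ^ d = 1 := by
  rw [X_pow_dvd_iff]
  constructor
  · intro h
    have hN := h N N.lt_succ_self
    rw [coeff_sub, coeff_X_pow, if_pos rfl, sub_eq_zero] at hN
    have hG : G ≠ 0 := by
      rintro rfl
      rw [zero_pow hd.ne', coeff_zero] at hN
      exact zero_ne_one hN
    obtain ⟨k, hk, hk'⟩ := exists_order hG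
    obtain ⟨hl, he⟩ := coeff_pow_of_order hd hk'
    have hNk : N = d * k := by
      refine le_antisymm (not_lt.mp fun hlt => ?_) (not_lt.mp fun hlt => ?_)
      · have := h _ (hlt.trans N.lt_succ_self)
        rw [coeff_sub, coeff_X_pow, if_neg hlt.ne, sub_zero, he] at this
        exact pow_ne_zero d hk this
      · rw [hl _ hlt] at hN
        exact zero_ne_one hN
    refine ⟨k, by rw [hNk, mul_comm], hk', ?_⟩
    rw [← he, ← hNk, hN]
  · rintro ⟨k, rfl, hk, hk'⟩ j hj
    obtain ⟨hl, he⟩ := coeff_pow_of_order hd hk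
    rw [coeff_sub, coeff_X_pow]
    rcases (Nat.lt_succ_iff.mp hj).lt_or_eq with hlt | rfl
    · rw [hl j (by rwa [mul_comm] at hlt), if_neg hlt.ne, sub_zero]
    · rw [mul_comm k d, he, hk', if_pos rfl, sub_self]

/-- Uniqueness of $m$-th roots with given nonzero constant term: the cofactor $\sum p^iq^{m-1-i}$ of
$p-q$ has constant term $m\,q(0)^{m-1}\ne0$, so it is prime to $X$. -/
theorem X_pow_dvd_of_pow_sub_pow {m e : ℕ} (hm : 0 < m) {p q : ℂ[X]}
    (h : X ^ e ∣ p ^ m - q ^ m) (h0 : p.coeff 0 = q.coeff 0) (hq : q.coeff 0 ≠ 0) :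
    X ^ e ∣ p - q := by
  rw [← Commute.mul_geom_sum₂ (Commute.all p q)] at h
  refine (IsCoprime.pow_left ?_).dvd_of_dvd_mul_right h
  refine (irreducible_X.coprime_iff_not_dvd).mpr fun hX => ?_
  rw [X_dvd_iff, coeff_zero_eq_eval_zero, eval_finsetSum] at hX
  simp only [eval_mul, eval_pow, ← coeff_zero_eq_eval_zero, h0] at hX
  have : ∀ i ∈ Finset.range m, q.coeff 0 ^ i * q.coeff 0 ^ (m - 1 - i) = q.coeff 0 ^ (m - 1) := by
    intro i hi
    rw [← pow_add]
    congr 1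
    have := Finset.mem_range.mp hi
    omega
  rw [Finset.sum_congr rfl this, Finset.sum_const, Finset.card_range, nsmul_eq_mul] at hX
  exact mul_ne_zero (Nat.cast_ne_zero.mpr hm.ne') (pow_ne_zero _ hq) hX

/-- Approximate `m`-th roots of `1 + X`. -/
theorem exists_approx_root {m : ℕ} (hm : 0 < m) (e : ℕ) :
    ∃ B : ℂ[X], B.coeff 0 = 1 ∧ X ^ (e + 1) ∣ B ^ m - (1 + X) := by
  induction e with
  | zero =>
    refine ⟨1, coeff_one_zero, ?_⟩
    rw [one_pow, zero_add, pow_one, sub_add_cancel_left]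
    exact (dvd_refl _).neg_right
  | succ e ih =>
    obtain ⟨B, hB, r, hr⟩ := ih
    obtain ⟨s, hs⟩ : X ∣ C (r.coeff 0) - r := by
      rw [X_dvd_iff, coeff_sub, coeff_C_zero, sub_self]
    obtain ⟨s', hs'⟩ : X ∣ B ^ (m - 1) - 1 := by
      rw [X_dvd_iff, coeff_sub, coeff_zero_eq_eval_zero, eval_pow, ← coeff_zero_eq_eval_zero, hB,
        one_pow, coeff_one_zero, sub_self]
    -- Newton step: since $B(0)=1$, adding $cX^{e+1}$ to $B$ changes $B^m$ by $mcX^{e+1}$ modulo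
    -- $X^{e+2}$, which must cancel $r(0)X^{e+1}$.
    set c : ℂ := -(r.coeff 0 / m) with hc
    have hmc : (m : ℂ) ≠ 0 := Nat.cast_ne_zero.mpr hm.ne'
    have hcm : (m : ℂ[X]) * C c = -C (r.coeff 0) := by
      rw [← C_eq_natCast, ← C_mul, ← C_neg]
      congr 1
      rw [hc]
      field_simp
    obtain ⟨t, ht⟩ : ∃ t, (B + C c * X ^ (e + 1)) ^ m =
        B ^ m + (m : ℂ[X]) * B ^ (m - 1) * (C c * X ^ (e + 1)) + t * (C c * X ^ (e + 1)) ^ 2 := by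
      obtain ⟨t, ht⟩ := Polynomial.powAddExpansion B (C c * X ^ (e + 1)) m
      exact ⟨t, ht⟩
    refine ⟨B + C c * X ^ (e + 1), ?_, -s - C (r.coeff 0) * s' + t * C c ^ 2 * X ^ e, ?_⟩
    · rw [coeff_add, hB, coeff_C_mul, coeff_X_pow, if_neg (by omega), mul_zero, add_zero]
    · rw [ht]
      linear_combination hr + X ^ (e + 1) * hcm * B ^ (m - 1) -
        X ^ (e + 1) * hs - C (r.coeff 0) * X ^ (e + 1) * hs'

end Polynomial

/-! ## Families of polynomials with regular coefficients -/

/-- A family of polynomials in one variable whose coefficients are regular on `Z`. -/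
def IsRegularPoly {σ : Type} (Z : Set (σ → ℂ)) (p : (σ → ℂ) → Polynomial ℂ) : Prop :=
  ∀ l, IsRegularOn Z fun a => (p a).coeff l

namespace IsRegularPoly

variable {σ : Type} {Z : Set (σ → ℂ)} {p q : (σ → ℂ) → Polynomial ℂ}

theorem const (c : Polynomial ℂ) : IsRegularPoly Z fun _ => c := fun _ => .const _

theorem C {f : (σ → ℂ) → ℂ} (hf : IsRegularOn Z f) :
    IsRegularPoly Z fun a => Polynomial.C (f a) := by
  intro l
  simp only [Polynomial.coeff_C]
  split_ifs
  · exact hf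
  · exact .const 0

theorem add (hp : IsRegularPoly Z p) (hq : IsRegularPoly Z q) :
    IsRegularPoly Z fun a => p a + q a := fun l => by
  simpa only [Polynomial.coeff_add] using (hp l).add (hq l)

theorem sub (hp : IsRegularPoly Z p) (hq : IsRegularPoly Z q) :
    IsRegularPoly Z fun a => p a - q a := fun l => by
  simpa only [Polynomial.coeff_sub] using (hp l).sub (hq l)

theorem mul (hp : IsRegularPoly Z p) (hq : IsRegularPoly Z q) :
    IsRegularPoly Z fun a => p a * q a := fun l => by
  simpa only [Polynomial.coeff_mul] using
    IsRegularOn.sum _ fun i _ => (hp i.1).mul (hq i.2)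

theorem pow (hp : IsRegularPoly Z p) (n : ℕ) : IsRegularPoly Z fun a => p a ^ n := by
  induction n with
  | zero => simpa only [pow_zero] using const 1
  | succ n ih => simpa only [pow_succ] using ih.mul hp

theorem comp_left (hp : IsRegularPoly Z p) (B : Polynomial ℂ) :
    IsRegularPoly Z fun a => B.comp (p a) := by
  intro l
  simp only [Polynomial.comp, Polynomial.eval₂_eq_sum_range, Polynomial.finsetSum_coeff]
  exact IsRegularOn.sum _ fun i _ => ((const (Polynomial.C (B.coeff i))).mul (hp.pow i)) l

theorem iterate_divX (hp : IsRegularPoly Z p) (m : ℕ) :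
    IsRegularPoly Z fun a => Polynomial.divX^[m] (p a) := fun l => by
  simpa only [Polynomial.coeff_iterate_divX] using hp (l + m)

end IsRegularPoly

/-! ## Jets -/

section Jets

variable {N : ℕ+}

theorem jet_coeff_succ (a : Fin 2 × Fin N → ℂ) (j : Fin 2) (i : Fin N) :
    (jet N a j).coeff (i + 1) = a (j, i) := by
  rw [jet, Polynomial.finsetSum_coeff, Finset.sum_eq_single i]
  · rw [Polynomial.coeff_C_mul, Polynomial.coeff_X_pow, if_pos rfl, mul_one]
  · intro l _ hl
    rw [Polynomial.coeff_C_mul, Polynomial.coeff_X_pow, if_neg, mul_zero]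
    exact fun h => hl (Fin.ext (by omega))
  · intro h
    exact absurd (Finset.mem_univ i) h

theorem jet_coeff_zero (a : Fin 2 × Fin N → ℂ) (j : Fin 2) : (jet N a j).coeff 0 = 0 := by
  rw [jet, Polynomial.finsetSum_coeff]
  refine Finset.sum_eq_zero fun l _ => ?_
  rw [Polynomial.coeff_C_mul, Polynomial.coeff_X_pow, if_neg (by omega), mul_zero]

theorem jet_coeff_of_lt (a : Fin 2 × Fin N → ℂ) (j : Fin 2) {l : ℕ} (hl : N < l) :
    (jet N a j).coeff l = 0 := by
  rw [jet, Polynomial.finsetSum_coeff]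
  refine Finset.sum_eq_zero fun i _ => ?_
  rw [Polynomial.coeff_C_mul, Polynomial.coeff_X_pow, if_neg (by omega), mul_zero]

theorem jet_coeff (a : Fin 2 × Fin N → ℂ) (j : Fin 2) {l : ℕ} (h0 : 0 < l) (hl : l ≤ N) :
    (jet N a j).coeff l = a (j, ⟨l - 1, by omega⟩) := by
  have := jet_coeff_succ a j ⟨l - 1, by omega⟩
  rwa [show ((⟨l - 1, by omega⟩ : Fin N) : ℕ) + 1 = l from Nat.sub_add_cancel h0] at this

theorem jet_scale (w : Fin 2 → ℕ) (ζ : ℂ) (a : Fin 2 × Fin N → ℂ) (j : Fin 2) :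
    jet N (fun i => ζ ^ ((i.2 : ℕ) + 1 + w i.1) * a i) j =
      Polynomial.C (ζ ^ w j) * (jet N a j).comp (Polynomial.C ζ * Polynomial.X) := by
  ext l
  rw [Polynomial.coeff_C_mul, Polynomial.comp_C_mul_X_coeff]
  rcases Nat.eq_zero_or_pos l with rfl | h0
  · simp only [jet_coeff_zero, zero_mul, mul_zero]
  · rcases le_or_gt l N with hl | hl
    · rw [jet_coeff _ _ h0 hl, jet_coeff _ _ h0 hl]
      simp only [Nat.sub_add_cancel h0, pow_add]
      ring
    · simp only [jet_coeff_of_lt _ _ hl, zero_mul, mul_zero]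

theorem jet_coeff_scale (w : Fin 2 → ℕ) (ζ : ℂ) (a : Fin 2 × Fin N → ℂ) (j : Fin 2) (l : ℕ) :
    (jet N (fun i => ζ ^ ((i.2 : ℕ) + 1 + w i.1) * a i) j).coeff l =
      ζ ^ (l + w j) * (jet N a j).coeff l := by
  rw [jet_scale, Polynomial.coeff_C_mul, Polynomial.comp_C_mul_X_coeff, pow_add]
  ring

theorem isRegularPoly_jet_comp {σ : Type} {Z : Set (σ → ℂ)} {φ : (σ → ℂ) → Fin 2 × Fin N → ℂ}
    (hφ : ∀ i, IsRegularOn Z fun a => φ a i) (j : Fin 2) :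
    IsRegularPoly Z fun a => jet N (φ a) j := by
  intro l
  rcases Nat.eq_zero_or_pos l with rfl | h0
  · simpa only [jet_coeff_zero] using IsRegularOn.const 0
  · rcases le_or_gt l N with hl | hl
    · simpa only [jet_coeff _ _ h0 hl] using hφ _
    · simpa only [jet_coeff_of_lt _ _ hl] using IsRegularOn.const 0

theorem isRegularPoly_jet (Z : Set (Fin 2 × Fin N → ℂ)) (j : Fin 2) :
    IsRegularPoly Z fun a => jet N a j :=
  isRegularPoly_jet_comp (fun i => .coord i) j

/-- The value of `y ^ m - x ^ n` at a jet. -/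
noncomputable def jetValue (m n : ℕ+) (a : Fin 2 × Fin N → ℂ) : Polynomial ℂ :=
  jet N a 1 ^ (m : ℕ) - jet N a 0 ^ (n : ℕ)

theorem aeval_jet_quasiHom (m n : ℕ+) (d : ℕ) (a : Fin 2 × Fin N → ℂ) :
    MvPolynomial.aeval (jet N a) (quasiHom m n ^ d) = jetValue m n a ^ d := by
  simp [quasiHom, jetValue]

/-- The polynomial $f_1$ is quasi-homogeneous of degree $mn$ for the weights $(m,n)$, so each twist
contributes a factor $\zeta^{mn}$. -/
theorem jetValue_scale (m n : ℕ+) (ρ : ℕ) (ζ : ℂ) (a : Fin 2 × Fin N → ℂ) (l : ℕ) :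
    (jetValue m n
      (fun i => ζ ^ ((i.2 : ℕ) + 1 + ![(m : ℕ) * ρ, (n : ℕ) * ρ] i.1) * a i)).coeff l =
      ζ ^ ((m : ℕ) * n * ρ + l) * (jetValue m n a).coeff l := by
  have h : jetValue m n
      (fun i => ζ ^ ((i.2 : ℕ) + 1 + ![(m : ℕ) * ρ, (n : ℕ) * ρ] i.1) * a i) =
      Polynomial.C (ζ ^ ((m : ℕ) * n * ρ)) *
        (jetValue m n a).comp (Polynomial.C ζ * Polynomial.X) := by
    rw [jetValue, jet_scale, jet_scale, jetValue, Polynomial.sub_comp, Polynomial.pow_comp,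
      Polynomial.pow_comp, mul_pow, mul_pow, ← Polynomial.C_pow, ← Polynomial.C_pow, ← pow_mul,
      ← pow_mul, mul_sub]
    simp only [Matrix.cons_val_zero, Matrix.cons_val_one]
    congr 4 <;> ring
  rw [h, Polynomial.coeff_C_mul, Polynomial.comp_C_mul_X_coeff, pow_add]
  ring

theorem isRegularPoly_jetValue (m n : ℕ+) {σ : Type} {Z : Set (σ → ℂ)}
    {φ : (σ → ℂ) → Fin 2 × Fin N → ℂ} (hφ : ∀ i, IsRegularOn Z fun a => φ a i) :
    IsRegularPoly Z fun a => jetValue m n (φ a) :=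
  ((isRegularPoly_jet_comp hφ 1).pow _).sub ((isRegularPoly_jet_comp hφ 0).pow _)

end Jets

/-! ### Sets of jets with prescribed order, and their twisted actions -/

/-- The `N`-jets `φ` at the origin such that `f₁ ∘ φ` has order `k`, with a `d`-th root of unity
as leading coefficient. -/
def orderSet (m n d N k : ℕ+) : Set (Fin 2 × Fin N → ℂ) :=
  {a | (∀ j < (k : ℕ), (jetValue m n a).coeff j = 0) ∧
    (jetValue m n a).coeff k ^ (d : ℕ) = 1}

/-- The weights of the action `ζ · (x(t), y(t)) = (ζ ^ (mρ) x(ζ t), ζ ^ (nρ) y(ζ t))`. -/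
def jetWeight (m n : ℕ+) (ρ : ℕ) {N : ℕ+} (i : Fin 2 × Fin N) : ℕ :=
  (i.2 : ℕ) + 1 + ![(m : ℕ) * ρ, (n : ℕ) * ρ] i.1

/-- The order `(mnρ + k)d` of the group that acts on `orderSet m n d N k` with weights
`jetWeight m n ρ`. -/
def jetLevel (m n d k : ℕ+) (ρ : ℕ) : ℕ+ := ⟨(m * n * ρ + k) * d, by positivity⟩

theorem jetLevel_coe (m n d k : ℕ+) (ρ : ℕ) :
    (jetLevel m n d k ρ : ℕ) = ((m : ℕ) * n * ρ + k) * d := rfl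

/-- The leading coefficient of $f_1\circ\varphi$ is multiplied by $\zeta^{mn\rho+k}$, whose $d$-th
power is $1$ by the choice of `jetLevel`. -/
theorem orderSet_invariant (m n d N k : ℕ+) (ρ : ℕ) :
    ScaleInvariant (jetLevel m n d k ρ) (jetWeight m n ρ) (orderSet m n d N k) := by
  rintro ζ hζ a ⟨ha, ha'⟩
  refine ⟨fun j hj => (jetValue_scale m n ρ ζ a j).trans ?_, ?_⟩
  · rw [ha j hj, mul_zero]
  · refine (congrArg (· ^ (d : ℕ)) (jetValue_scale m n ρ ζ a k)).trans ?_
    rw [jetLevel_coe, pow_mul] at hζ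
    rw [mul_pow, ha', hζ, mul_one]

theorem isAlgebraicSet_of_isRegularOn {σ ι : Type} (f : ι → (σ → ℂ) → ℂ)
    (hf : ∀ i, IsRegularOn Set.univ (f i)) : IsAlgebraicSet {a | ∀ i, f i a = 0} := by
  choose p hp using hf
  refine ⟨Set.range p, ?_⟩
  ext a
  simp only [Set.mem_ofPred_eq, Set.forall_mem_range]
  exact forall_congr' fun i => by rw [hp i a trivial]

theorem IsAlgebraicSet.inter {σ : Type} {Z W : Set (σ → ℂ)} (hZ : IsAlgebraicSet Z)
    (hW : IsAlgebraicSet W) : IsAlgebraicSet (Z ∩ W) := by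
  obtain ⟨S, rfl⟩ := hZ
  obtain ⟨T, rfl⟩ := hW
  refine ⟨S ∪ T, ?_⟩
  ext a
  simp only [Set.mem_inter_iff, Set.mem_ofPred_eq, Set.mem_union, or_imp, forall_and]

theorem isAlgebraicSet_orderSet (m n d N k : ℕ+) : IsAlgebraicSet (orderSet m n d N k) := by
  have h1 := isAlgebraicSet_of_isRegularOn
    (fun (j : Fin k) (a : Fin 2 × Fin N → ℂ) => (jetValue m n a).coeff j)
    fun j => isRegularPoly_jetValue m n (fun i => .coord i) j
  have h2 := isAlgebraicSet_of_isRegularOn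
    (fun (_ : Unit) (a : Fin 2 × Fin N → ℂ) => (jetValue m n a).coeff k ^ (d : ℕ) - 1)
    fun _ => ((isRegularPoly_jetValue m n (fun i => .coord i) k).pow _).sub (.const 1)
  convert h1.inter h2 using 1
  ext a
  simp only [Set.mem_inter_iff, Set.mem_ofPred_eq, orderSet, sub_eq_zero, forall_const]
  exact and_congr_left' ⟨fun h j => h j j.2, fun h j hj => h ⟨j, hj⟩⟩

theorem jetSet_eq_orderSet (m n d N k : ℕ+) (h : N = k * d) :
    jetSet (quasiHom m n ^ (d : ℕ)) N = orderSet m n d N k := by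
  ext a
  change Polynomial.X ^ ((N : ℕ) + 1) ∣ MvPolynomial.aeval (jet N a) _ - _ ↔ _
  rw [aeval_jet_quasiHom, Polynomial.X_pow_dvd_pow_sub_X_pow_iff d.pos]
  constructor
  · rintro ⟨l, hl, h1, h2⟩
    obtain rfl : l = k := by
      have : (N : ℕ) = k * d := by rw [h]; rfl
      exact Nat.eq_of_mul_eq_mul_right d.pos (hl.symm.trans this)
    exact ⟨h1, h2⟩
  · rintro ⟨h1, h2⟩
    exact ⟨k, by rw [h]; rfl, h1, h2⟩

theorem jetSet_eq_empty (m n d N : ℕ+) (h : ¬ (d : ℕ) ∣ N) :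
    jetSet (quasiHom m n ^ (d : ℕ)) N = ∅ := by
  refine Set.eq_empty_iff_forall_notMem.mpr fun a ha => ?_
  change Polynomial.X ^ ((N : ℕ) + 1) ∣ MvPolynomial.aeval (jet N a) _ - _ at ha
  rw [aeval_jet_quasiHom, Polynomial.X_pow_dvd_pow_sub_X_pow_iff d.pos] at ha
  obtain ⟨k, hk, -⟩ := ha
  exact h ⟨k, by rw [hk, mul_comm]⟩

/-- Cutting the empty set along a coordinate gives $[\emptyset]=[\emptyset]+[\emptyset]$. -/
theorem MuHatVariety.motive_ofSet_empty {σ : Type} [Finite σ] [Nonempty σ] {k : ℕ+} {w : σ → ℕ}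
    {Z : Set (σ → ℂ)} (hZ : ScaleInvariant k w Z) (h : Z = ∅) :
    (MuHatVariety.ofSet k w Z hZ).motive = 0 := by
  subst h
  obtain ⟨i⟩ := ‹Nonempty σ›
  have h1 := MuHatVariety.motive_ofSet_cut hZ ⟨{1}, by ext; simp⟩ i
  rw [← MuHatVariety.motive_ofSet_of_eq hZ (Set.empty_inter _).symm] at h1
  have h2 : (MuHatVariety.ofSet k w ∅ hZ).motive = (MuHatVariety.ofSet k (unitWeight k w i)
      (unitLocus ∅ i) (unitLocus_invariant hZ i)).motive := by
    refine MuHatVariety.motive_ofSet_congr _ _ (fun _ _ => 0) (fun _ _ => 0)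
      (fun _ => .const 0) (fun _ => .const 0) ?_ ?_ ?_ ?_ ?_
    · exact fun a ha => ha.elim
    · exact fun a ha => ha.1.elim
    · exact fun a ha => ha.elim
    · exact fun a ha => ha.1.elim
    · exact fun _ a ha => ha.elim
  rw [← h2] at h1
  exact left_eq_add.mp h1

/-- High coefficients of a jet do not matter for membership in `orderSet`. -/
theorem orderSet_free (m n d N k : ℕ+) (i : Fin 2 × Fin N) (hi : (k : ℕ) < i.2 + 1) :
    IsFreeCoord (orderSet m n d N k) i := by
  intro a ha c b _ hb
  have hjet : ∀ j, Polynomial.X ^ ((k : ℕ) + 1) ∣ jet N b j - jet N a j := by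
    intro j
    rw [Polynomial.X_pow_dvd_iff]
    intro l hl
    rw [Polynomial.coeff_sub, sub_eq_zero]
    rcases Nat.eq_zero_or_pos l with rfl | h0
    · rw [jet_coeff_zero, jet_coeff_zero]
    · have hlN : l ≤ N := by have := i.2.2; omega
      rw [jet_coeff _ _ h0 hlN, jet_coeff _ _ h0 hlN]
      refine hb _ fun h => ?_
      have := congrArg (fun q : Fin 2 × Fin N => (q.2 : ℕ)) h
      simp only at this
      omega
  have hval : ∀ l ≤ (k : ℕ), (jetValue m n b).coeff l = (jetValue m n a).coeff l := by
    intro l hl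
    have : Polynomial.X ^ ((k : ℕ) + 1) ∣ jetValue m n b - jetValue m n a := by
      have h1 := (hjet 1).trans (sub_dvd_pow_sub_pow _ _ (m : ℕ))
      have h0 := (hjet 0).trans (sub_dvd_pow_sub_pow _ _ (n : ℕ))
      convert dvd_sub h1 h0 using 1
      simp only [jetValue]
      ring
    have := Polynomial.X_pow_dvd_iff.mp this l (by omega)
    rwa [Polynomial.coeff_sub, sub_eq_zero] at this
  refine ⟨fun j hj => ?_, ?_⟩
  · rw [hval j hj.le]
    exact ha.1 j hj
  · rw [hval k le_rfl]
    exact ha.2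

/-! ## Jets of low order -/

/-- The leading coefficients of the jets for which `f₁ ∘ φ` has order `k ≤ mn`. -/
def leadingSet (m n d k : ℕ+) : Set (Fin 2 → ℂ) :=
  {z | (¬ (n : ℕ) ∣ k → z 0 = 0) ∧ (¬ (m : ℕ) ∣ k → z 1 = 0) ∧
    (z 1 ^ (m : ℕ) - z 0 ^ (n : ℕ)) ^ (d : ℕ) = 1}

theorem leadingSet_invariant (m n d k : ℕ+) :
    ScaleInvariant (m * n * d) ![(m : ℕ), (n : ℕ)] (leadingSet m n d k) := by
  rintro ζ hζ a ⟨h0, h1, ha⟩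
  refine ⟨fun h => ?_, fun h => ?_, ?_⟩
  · change ζ ^ (m : ℕ) * a 0 = 0
    rw [h0 h, mul_zero]
  · change ζ ^ (n : ℕ) * a 1 = 0
    rw [h1 h, mul_zero]
  · change ((ζ ^ (n : ℕ) * a 1) ^ (m : ℕ) - (ζ ^ (m : ℕ) * a 0) ^ (n : ℕ)) ^ (d : ℕ) = 1
    have h : (ζ ^ (n : ℕ) * a 1) ^ (m : ℕ) - (ζ ^ (m : ℕ) * a 0) ^ (n : ℕ) =
        ζ ^ ((m : ℕ) * n) * (a 1 ^ (m : ℕ) - a 0 ^ (n : ℕ)) := by ring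
    have h' : (ζ ^ ((m : ℕ) * n)) ^ (d : ℕ) = 1 := by
      rw [← pow_mul]
      simpa using hζ
    rw [h, mul_pow, h', ha, one_mul]

/-- For $k\le mn$ there is no cancellation below order $k$, so the condition only involves the
coefficients that contribute to $y^m$ and $x^n$ in degrees up to $k$. -/
theorem mem_orderSet_iff_of_le {m n d N k : ℕ+} (hmn : Nat.Coprime m n) (hk : (k : ℕ) ≤ m * n)
    (a : Fin 2 × Fin N → ℂ) :
    a ∈ orderSet m n d N k ↔ (∀ i, (n : ℕ) * i < k → (jet N a 0).coeff i = 0) ∧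
      (∀ i, (m : ℕ) * i < k → (jet N a 1).coeff i = 0) ∧
      ((jet N a 1).coeff (k / m) ^ (m : ℕ) - (jet N a 0).coeff (k / n) ^ (n : ℕ)) ^ (d : ℕ) = 1 := by
  have key : (∀ i, (n : ℕ) * i < k → (jet N a 0).coeff i = 0) →
      (∀ i, (m : ℕ) * i < k → (jet N a 1).coeff i = 0) →
      (∀ j < (k : ℕ), (jetValue m n a).coeff j = 0) ∧ (jetValue m n a).coeff k =
      (jet N a 1).coeff (k / m) ^ (m : ℕ) - (jet N a 0).coeff (k / n) ^ (n : ℕ) := by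
    intro h0 h1
    obtain ⟨h2, h3⟩ := Polynomial.coeff_pow_of_vanishing n.pos h0
    obtain ⟨h4, h5⟩ := Polynomial.coeff_pow_of_vanishing m.pos h1
    refine ⟨fun j hj => ?_, ?_⟩
    · rw [jetValue, Polynomial.coeff_sub, h2 j hj, h4 j hj, sub_zero]
    · rw [jetValue, Polynomial.coeff_sub, h3, h5]
  constructor
  · rintro ⟨h, h'⟩
    obtain ⟨h0, h1⟩ := Polynomial.vanishing_of_pow_sub_pow m.pos n.pos hmn hk
      (jet_coeff_zero a 0) h
    exact ⟨h0, h1, (key h0 h1).2 ▸ h'⟩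
  · rintro ⟨h0, h1, h⟩
    exact ⟨(key h0 h1).1, (key h0 h1).2 ▸ h⟩

/-- The coordinates of an `N`-jet with degree greater than `c j` in the `j`-th component. -/
def tailCoords (N : ℕ+) (c : Fin 2 → ℕ) : Finset (Fin 2 × Fin N) :=
  Finset.univ.filter fun i => c i.1 ≤ i.2

theorem mem_tailCoords {N : ℕ+} {c : Fin 2 → ℕ} {i : Fin 2 × Fin N} :
    i ∈ tailCoords N c ↔ c i.1 ≤ i.2 := by
  simp [tailCoords]

theorem card_tailCoords (N : ℕ+) (c : Fin 2 → ℕ) :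
    (tailCoords N c).card = (N - c 0) + (N - c 1) := by
  have h : ∀ b : ℕ, (∑ i : Fin N, if b ≤ (i : ℕ) then 1 else 0) = N - b := by
    intro b
    rw [Fin.sum_univ_eq_sum_range (fun i => if b ≤ i then 1 else 0) N, ← Finset.card_filter]
    have : (Finset.range N).filter (fun i => b ≤ i) = Finset.Ico b N := by
      ext i
      simp only [Finset.mem_filter, Finset.mem_range, Finset.mem_Ico]
      tauto
    rw [this, Nat.card_Ico]
  rw [tailCoords, Finset.card_filter, Fintype.sum_prod_type, Fin.sum_univ_two]
  exact congrArg₂ _ (h (c 0)) (h (c 1))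

/-- Coefficients of $x$ above degree $\lfloor k/n\rfloor$ and of $y$ above $\lfloor k/m\rfloor$ are
free, and those below vanish. The leading coefficients carry an action that does not depend on
$\rho$. -/
theorem motive_orderSet_of_le {m n d N k : ℕ+} (hmn : Nat.Coprime m n) (hk : (k : ℕ) ≤ m * n)
    (hkN : k ≤ N) (ρ : ℕ) :
    (MuHatVariety.ofSet _ _ _ (orderSet_invariant m n d N k ρ)).motive =
      (MuHatVariety.ofSet _ _ _ (leadingSet_invariant m n d k)).motive *
        (lefschetz : MMuHat) ^ ((N - (k : ℕ) / n) + (N - (k : ℕ) / m)) := by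
  have hkN' : (k : ℕ) ≤ N := hkN
  obtain ⟨e, he⟩ : ∃ e : Fin 2 → ℕ, e = ![(n : ℕ), (m : ℕ)] := ⟨_, rfl⟩
  have he0 : e 0 = n := by rw [he]; rfl
  have he1 : e 1 = m := by rw [he]; rfl
  have hepos : ∀ j, 0 < e j := Fin.forall_fin_two.mpr ⟨he0 ▸ n.pos, he1 ▸ m.pos⟩
  have hcN : ∀ j, (k : ℕ) / e j ≤ N := fun j => (Nat.div_le_self _ _).trans hkN'
  have hmem : ∀ a : Fin 2 × Fin N → ℂ, a ∈ orderSet m n d N k ↔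
      (∀ j i, e j * i < k → (jet N a j).coeff i = 0) ∧
      ((jet N a 1).coeff (k / e 1) ^ (m : ℕ) - (jet N a 0).coeff (k / e 0) ^ (n : ℕ)) ^ (d : ℕ) =
        1 := by
    intro a
    rw [mem_orderSet_iff_of_le hmn hk, Fin.forall_fin_two, he0, he1, and_assoc]
  have hmem' : ∀ z : Fin 2 → ℂ, z ∈ leadingSet m n d k ↔ (∀ j, ¬ e j ∣ k → z j = 0) ∧
      (z 1 ^ (m : ℕ) - z 0 ^ (n : ℕ)) ^ (d : ℕ) = 1 := by
    intro z
    rw [Fin.forall_fin_two, he0, he1, and_assoc]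
    rfl
  have hlt : ∀ j i, i < (k : ℕ) / e j → e j * i < k := fun j i hi =>
    (Nat.mul_lt_mul_of_pos_left hi (hepos j)).trans_le (Nat.mul_div_le _ _)
  have hle : ∀ j i, e j * i ≤ k → i ≤ (k : ℕ) / e j := fun j i hi =>
    (Nat.le_div_iff_mul_le (hepos j)).mpr (by rwa [mul_comm])
  rw [MuHatVariety.motive_ofSet_frees _ (tailCoords N fun j => k / e j), card_tailCoords, he0, he1]
  · congr 1
    let G : (Fin 2 → ℂ) → Fin 2 × Fin N → ℂ := fun z i =>
      if (i.2 : ℕ) + 1 = k / e i.1 then z i.1 else 0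
    have hjet : ∀ z ∈ leadingSet m n d k, ∀ j l,
        (jet N (G z) j).coeff l = if l = k / e j then z j else 0 := by
      intro z hz j l
      rcases Nat.eq_zero_or_pos l with rfl | h0
      · rw [jet_coeff_zero]
        split_ifs with h
        -- A jet has no constant term to hold $z_j$ if `k / e j` is $0$. In that case `e j` does not
        -- divide $k$, and $z_j=0$ anyway.
        · refine (((hmem' z).mp hz).1 j fun hd => ?_).symm
          exact (Nat.div_pos (Nat.le_of_dvd k.pos hd) (hepos j)).ne h
        · rfl
      · rcases le_or_gt l N with hl | hl
        · rw [jet_coeff _ _ h0 hl]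
          simp only [G, Nat.sub_add_cancel h0]
        · rw [jet_coeff_of_lt _ _ hl, if_neg]
          have := hcN j
          omega
    have hGmem : ∀ z ∈ leadingSet m n d k, G z ∈ orderSet m n d N k := by
      intro z hz
      refine (hmem _).mpr ⟨fun j i hi => ?_, ?_⟩
      · rw [hjet z hz]
        split_ifs with h
        · refine ((hmem' z).mp hz).1 j fun hd => ?_
          rw [h, Nat.mul_div_cancel' hd] at hi
          exact lt_irrefl _ hi
        · rfl
      · rw [hjet z hz, hjet z hz, if_pos rfl, if_pos rfl]
        exact ((hmem' z).mp hz).2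
    have hFz : ∀ a ∈ orderSet m n d N k, ∀ j, ¬ e j ∣ k →
        (jet N a j).coeff (k / e j) = 0 := by
      intro a ha j hj
      refine ((hmem a).mp ha).1 j _ (lt_of_le_of_ne (Nat.mul_div_le _ _) fun h => hj ⟨_, h.symm⟩)
    refine MuHatVariety.motive_ofSet_congr _ _ (fun a j => (jet N a j).coeff (k / e j)) G ?_ ?_ ?_
      ?_ ?_ ?_ ?_
    · exact fun j => isRegularPoly_jet _ j _
    · intro i
      by_cases h : (i.2 : ℕ) + 1 = k / e i.1
      · simpa only [G, if_pos h] using IsRegularOn.coord i.1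
      · simpa only [G, if_neg h] using IsRegularOn.const 0
    · exact fun a ha => (hmem' _).mpr ⟨hFz a ha.1, ((hmem a).mp ha.1).2⟩
    · refine fun z hz => ⟨hGmem z hz, fun i hi => if_neg ?_⟩
      have := mem_tailCoords.mp hi
      omega
    · rintro a ⟨ha, ha'⟩
      funext i
      by_cases h : (i.2 : ℕ) + 1 = k / e i.1
      · simp only [G, if_pos h]
        rw [← h, jet_coeff_succ]
      · simp only [G, if_neg h]
        by_cases h' : (k : ℕ) / e i.1 ≤ i.2
        · exact (ha' i (mem_tailCoords.mpr h')).symm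
        · rw [← Prod.mk.eta (p := i), ← jet_coeff_succ a]
          exact (((hmem a).mp ha).1 i.1 _ (hlt _ _ (by omega))).symm
    · intro z hz
      funext j
      rw [hjet z hz, if_pos rfl]
    · rintro ξ a ⟨ha, -⟩ j
      refine (jet_coeff_scale ![(m : ℕ) * ρ, (n : ℕ) * ρ] _ a j _).trans ?_
      by_cases hd : e j ∣ k
      · congr 1
        obtain ⟨q, hq⟩ := hd
        have hK := jetLevel_coe m n d k ρ
        rw [hq] at hK
        rw [hq, Nat.mul_div_cancel_left q (hepos j)]
        clear hq
        revert j
        refine Fin.forall_fin_two.mpr ⟨fun hK => ?_, fun hK => ?_⟩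
        · rw [he0] at hK
          -- For $k=nq$ both actions on this coordinate factor through $\mu_{nd}$:
          -- $(mn\rho+k)d=nd\,(m\rho+q)$ and $mnd=nd\cdot m$.
          refine (MuHat.root_pow_of_eq (k := n * d) ?_ ξ).trans
            (MuHat.root_pow_of_eq (k := n * d) ?_ ξ).symm
          · simp only [hK, PNat.mul_coe, Matrix.cons_val_zero]
            ring
          · simp only [PNat.mul_coe, Matrix.cons_val_zero]
            ring
        · rw [he1] at hK
          refine (MuHat.root_pow_of_eq (k := m * d) ?_ ξ).trans
            (MuHat.root_pow_of_eq (k := m * d) ?_ ξ).symm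
          · simp only [hK, PNat.mul_coe, Matrix.cons_val_one, Matrix.cons_val_fin_one]
            ring
          · simp only [PNat.mul_coe, Matrix.cons_val_one, Matrix.cons_val_fin_one]
            ring
      · rw [hFz a ha j hd, mul_zero, mul_zero]
  · intro i hi a ha c b _ hb
    have hi' := mem_tailCoords.mp hi
    have hco : ∀ j l, l ≤ (k : ℕ) / e j → (jet N b j).coeff l = (jet N a j).coeff l := by
      intro j l hl
      rcases Nat.eq_zero_or_pos l with rfl | h0
      · rw [jet_coeff_zero, jet_coeff_zero]
      · have hlN : l ≤ N := hl.trans (hcN j)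
        rw [jet_coeff _ _ h0 hlN, jet_coeff _ _ h0 hlN]
        refine hb _ fun h => ?_
        subst h
        simp only at hi'
        omega
    obtain ⟨h1, h2⟩ := (hmem a).mp ha
    refine (hmem b).mpr ⟨fun j l hl => ?_, ?_⟩
    · rw [hco j l (hle j l hl.le)]
      exact h1 j l hl
    · rw [hco 0 _ le_rfl, hco 1 _ le_rfl]
      exact h2

theorem motive_leadingSet_mul (m n d : ℕ+) :
    (MuHatVariety.ofSet _ _ _ (leadingSet_invariant m n d (m * n))).motive =
      (quasiHomFiber m n d).motive := by
  refine MuHatVariety.motive_ofSet_of_eq _ ?_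
  ext z
  simp [leadingSet]

/-! ## Jets of high order: passing to a smaller order -/

theorem jetValue_of_shift {m n N : ℕ+} {a : Fin 2 × Fin N → ℂ} {p : Fin 2 → Polynomial ℂ}
    (h : ∀ j, jet N a j = Polynomial.X ^ (![(m : ℕ), (n : ℕ)] j) * p j) :
    jetValue m n a =
      Polynomial.X ^ ((m : ℕ) * n) * (p 1 ^ (m : ℕ) - p 0 ^ (n : ℕ)) := by
  rw [jetValue, h 0, h 1, mul_pow, mul_pow, ← pow_mul, ← pow_mul, mul_sub]
  simp only [Matrix.cons_val_zero, Matrix.cons_val_one, Matrix.cons_val_fin_one]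
  rw [mul_comm (n : ℕ) m]

theorem mem_orderSet_iff_of_shift {m n d N e : ℕ+} {a : Fin 2 × Fin N → ℂ}
    {p : Fin 2 → Polynomial ℂ}
    (h : ∀ j, jet N a j = Polynomial.X ^ (![(m : ℕ), (n : ℕ)] j) * p j) :
    a ∈ orderSet m n d N (m * n + e) ↔
      (∀ l < (e : ℕ), (p 1 ^ (m : ℕ) - p 0 ^ (n : ℕ)).coeff l = 0) ∧
        (p 1 ^ (m : ℕ) - p 0 ^ (n : ℕ)).coeff e ^ (d : ℕ) = 1 := by
  have hc : ((m * n + e : ℕ+) : ℕ) = e + m * n := by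
    rw [add_comm]
    rfl
  rw [orderSet, Set.mem_ofPred_eq, jetValue_of_shift h, hc, Polynomial.coeff_X_pow_mul]
  refine and_congr_left' ⟨fun h l hl => ?_, fun h l hl => ?_⟩
  · have := h (l + m * n) (by omega)
    rwa [Polynomial.coeff_X_pow_mul] at this
  · rw [Polynomial.coeff_X_pow_mul']
    split_ifs with hle
    · exact h _ (by omega)
    · rfl

/-- Order greater than $mn$ allows `vanishing_of_pow_sub_pow` with its largest bound $mn$, which
makes $x$ divisible by $t^m$ and $y$ by $t^n$. -/
theorem coeff_eq_zero_of_mem_orderSet {m n d N e : ℕ+} (hmn : Nat.Coprime m n)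
    {a : Fin 2 × Fin N → ℂ} (ha : a ∈ orderSet m n d N (m * n + e)) :
    ∀ j, ∀ l < ![(m : ℕ), (n : ℕ)] j, (jet N a j).coeff l = 0 := by
  obtain ⟨h0, h1⟩ := Polynomial.vanishing_of_pow_sub_pow m.pos n.pos hmn le_rfl
    (jet_coeff_zero a 0) fun j hj => ha.1 j (hj.trans (Nat.lt_add_of_pos_right e.pos))
  refine Fin.forall_fin_two.mpr ⟨fun l hl => h0 l ?_, fun l hl => h1 l ?_⟩
  · rw [mul_comm]
    exact Nat.mul_lt_mul_of_pos_right hl n.pos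
  · exact Nat.mul_lt_mul_of_pos_left hl m.pos

theorem jet_eq_shift_of_mem_orderSet {m n d N e : ℕ+} (hmn : Nat.Coprime m n)
    {a : Fin 2 × Fin N → ℂ} (ha : a ∈ orderSet m n d N (m * n + e)) (j : Fin 2) :
    jet N a j = Polynomial.X ^ (![(m : ℕ), (n : ℕ)] j) *
      Polynomial.divX^[![(m : ℕ), (n : ℕ)] j] (jet N a j) :=
  (Polynomial.X_pow_mul_iterate_divX (coeff_eq_zero_of_mem_orderSet hmn ha j)).symm

theorem coeff_pow_eq_of_mem_orderSet {m n d N e : ℕ+} (hmn : Nat.Coprime m n)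
    {a : Fin 2 × Fin N → ℂ} (ha : a ∈ orderSet m n d N (m * n + e)) :
    (jet N a 1).coeff n ^ (m : ℕ) = (jet N a 0).coeff m ^ (n : ℕ) := by
  have h := ((mem_orderSet_iff_of_shift (jet_eq_shift_of_mem_orderSet hmn ha)).mp ha).1 0 e.pos
  rw [Polynomial.coeff_sub, sub_eq_zero, Polynomial.coeff_zero_eq_eval_zero,
    Polynomial.coeff_zero_eq_eval_zero, Polynomial.eval_pow, Polynomial.eval_pow,
    ← Polynomial.coeff_zero_eq_eval_zero, ← Polynomial.coeff_zero_eq_eval_zero,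
    Polynomial.coeff_iterate_divX, Polynomial.coeff_iterate_divX, zero_add, zero_add] at h
  exact h

/-- The index of the coefficient of `t ^ i` in the `j`-th component of an `N`-jet. -/
def jetIndex (j : Fin 2) {N i : ℕ+} (h : i ≤ N) : Fin 2 × Fin N :=
  (j, ⟨i - 1, by have := i.pos; have : (i : ℕ) ≤ N := h; omega⟩)

theorem jet_coeff_jetIndex (j : Fin 2) {N i : ℕ+} (h : i ≤ N)
    (a : Fin 2 × Fin N → ℂ) : (jet N a j).coeff i = a (jetIndex j h) :=
  jet_coeff a j i.pos h

/-- Division by $(t^m,t^n)$ identifies these jets with the $N$-jets for $e$ whose top $m$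
coefficients of $x$ and top $n$ of $y$ are zero. Those coefficients are free because their degrees
exceed $e$, which explains $\mathbb L^{m+n}$. The division adds one twist, and
$mn\rho+(mn+e)=mn(\rho+1)+e$ keeps the level. -/
theorem motive_orderSet_inter_coord {m n d N e : ℕ+} (hmn : Nat.Coprime m n)
    (hN : m * n + e ≤ N) (hm : m ≤ N) (ρ : ℕ) :
    (MuHatVariety.ofSet _ _ _
      ((orderSet_invariant m n d N (m * n + e) ρ).inter_coord (jetIndex 0 hm))).motive *
        (lefschetz : MMuHat) ^ ((m : ℕ) + n) =
      (MuHatVariety.ofSet _ _ _ (orderSet_invariant m n d N e (ρ + 1))).motive := by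
  have hN' : (m : ℕ) * n + e ≤ N := hN
  have hmle : (m : ℕ) ≤ m * n := Nat.le_mul_of_pos_right _ n.pos
  have hnle : (n : ℕ) ≤ m * n := Nat.le_mul_of_pos_left _ m.pos
  obtain ⟨w, hw⟩ : ∃ w : Fin 2 → ℕ, w = ![(m : ℕ), (n : ℕ)] := ⟨_, rfl⟩
  have hw0 : w 0 = m := by rw [hw]; rfl
  have hw1 : w 1 = n := by rw [hw]; rfl
  have hwpos : ∀ j, 0 < w j := Fin.forall_fin_two.mpr ⟨hw0 ▸ m.pos, hw1 ▸ n.pos⟩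
  have hwle : ∀ j, w j + e ≤ N := Fin.forall_fin_two.mpr ⟨by omega, by omega⟩
  rw [MuHatVariety.motive_ofSet_frees (orderSet_invariant m n d N e (ρ + 1))
    (tailCoords N fun j => N - w j), card_tailCoords, hw0, hw1,
    Nat.sub_sub_self (by omega), Nat.sub_sub_self (by omega)]
  · congr 1
    let F : (Fin 2 × Fin N → ℂ) → Fin 2 × Fin N → ℂ := fun a i =>
      (jet N a i.1).coeff ((i.2 : ℕ) + 1 + w i.1)
    -- The inverse multiplies by $(t^m,t^n)$. The index `i.2` stands for degree `i.2 + 1`, so the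
    -- test below selects the degrees greater than `w i.1`.
    let G : (Fin 2 × Fin N → ℂ) → Fin 2 × Fin N → ℂ := fun b i =>
      if w i.1 ≤ i.2 then (jet N b i.1).coeff ((i.2 : ℕ) + 1 - w i.1) else 0
    have hvan : ∀ a ∈ orderSet m n d N (m * n + e) ∩ {a | a (jetIndex 0 hm) = 0},
        ∀ j, ∀ l ≤ w j, (jet N a j).coeff l = 0 := by
      rintro a ⟨ha, ha'⟩ j l hl
      rcases hl.lt_or_eq with hl | rfl
      · exact coeff_eq_zero_of_mem_orderSet hmn ha j l (hw ▸ hl)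
      · have h0 : (jet N a 0).coeff m = 0 := (jet_coeff_jetIndex 0 hm a).trans ha'
        -- If the coefficient of $t^m$ in $x$ vanishes, so does that of $t^n$ in $y$, since
        -- $y_n^m=x_m^n$.
        have h1 := coeff_pow_eq_of_mem_orderSet hmn ha
        rw [h0, zero_pow n.ne_zero] at h1
        revert j
        refine Fin.forall_fin_two.mpr ⟨fun _ => hw0.symm ▸ h0,
          fun _ => hw1.symm ▸ eq_zero_of_pow_eq_zero h1⟩
    have hF : ∀ a ∈ orderSet m n d N (m * n + e) ∩ {a | a (jetIndex 0 hm) = 0},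
        ∀ j, jet N a j = Polynomial.X ^ (w j) * jet N (F a) j := by
      intro a ha j
      ext l
      rw [Polynomial.coeff_X_pow_mul']
      split_ifs with hl
      · rcases Nat.eq_zero_or_pos (l - w j) with h0 | h0
        · rw [h0, jet_coeff_zero]
          exact hvan a ha j l (by omega)
        · rcases le_or_gt (l - w j) N with hl' | hl'
          · rw [jet_coeff _ _ h0 hl']
            simp only [F]
            congr 1
            omega
          · rw [jet_coeff_of_lt _ _ hl', jet_coeff_of_lt _ _ (by omega)]
      · exact hvan a ha j l (by omega)
    have hG : ∀ b ∈ orderSet m n d N e ∩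
        {b | ∀ i ∈ tailCoords N fun j => N - w j, b i = 0},
        ∀ j, jet N (G b) j = Polynomial.X ^ (w j) * jet N b j := by
      rintro b ⟨-, hb⟩ j
      ext l
      rw [Polynomial.coeff_X_pow_mul']
      rcases Nat.eq_zero_or_pos l with rfl | h0
      · rw [jet_coeff_zero, if_neg (by have := hwpos j; omega)]
      rcases le_or_gt l N with hlN | hlN
      · rw [jet_coeff _ _ h0 hlN]
        simp only [G]
        split_ifs with h1 h2 h2
        · congr 1
          omega
        · omega
        · rw [show l - w j = 0 by omega, jet_coeff_zero]
        · rfl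
      · rw [jet_coeff_of_lt _ _ hlN]
        split_ifs with h1
        · rcases le_or_gt (l - w j) N with hl' | hl'
          · rw [jet_coeff _ _ (by have := hwle j; omega) hl']
            exact (hb _ (mem_tailCoords.mpr (by simp only; omega))).symm
          · rw [jet_coeff_of_lt _ _ hl']
        · rfl
    refine MuHatVariety.motive_ofSet_congr _ _ F G ?_ ?_ ?_ ?_ ?_ ?_ ?_
    · exact fun i => isRegularPoly_jet _ _ _
    · intro i
      by_cases h : w i.1 ≤ i.2
      · simpa only [G, if_pos h] using isRegularPoly_jet _ _ _
      · simpa only [G, if_neg h] using IsRegularOn.const 0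
    · intro a ha
      refine ⟨(mem_orderSet_iff_of_shift (hw ▸ hF a ha)).mp ha.1, fun i hi => ?_⟩
      have := mem_tailCoords.mp hi
      exact jet_coeff_of_lt _ _ (by omega)
    · intro b hb
      refine ⟨(mem_orderSet_iff_of_shift (hw ▸ hG b hb)).mpr hb.1, ?_⟩
      refine if_neg ?_
      change ¬ w 0 ≤ (m : ℕ) - 1
      have := m.pos
      omega
    · intro a ha
      funext i
      rw [← Prod.mk.eta (p := i), ← jet_coeff_succ a, hF a ha, Polynomial.coeff_X_pow_mul']
      simp only [G]
      split_ifs with h1 h2 h2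
      · rfl
      · omega
      · rw [show (i.2 : ℕ) + 1 - w i.1 = 0 by omega, jet_coeff_zero]
      · rfl
    · intro b hb
      funext i
      simp only [F]
      rw [hG b hb, Polynomial.coeff_X_pow_mul, jet_coeff_succ]
    · rintro ξ a ⟨ha, -⟩ i
      refine (jet_coeff_scale ![(m : ℕ) * ρ, (n : ℕ) * ρ] _ a _ _).trans ?_
      congr 1
      rw [show jetLevel m n d (m * n + e) ρ = jetLevel m n d e (ρ + 1) from PNat.eq (by
        simp only [jetLevel_coe, PNat.add_coe, PNat.mul_coe]
        ring)]
      congr 1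
      obtain ⟨j, l⟩ := i
      simp only [jetWeight]
      revert j
      refine Fin.forall_fin_two.mpr ⟨?_, ?_⟩
      · simp only [hw0, Matrix.cons_val_zero]
        ring
      · simp only [hw1, Matrix.cons_val_one, Matrix.cons_val_fin_one]
        ring
  · intro i hi
    refine orderSet_free m n d N e i ?_
    have := mem_tailCoords.mp hi
    have := hwle i.1
    omega

/-! ### Approximate roots of a polynomial with given constant term -/

namespace Polynomial

theorem X_pow_dvd_sub_C_mul_X_pow_iff {P : ℂ[X]} {c : ℂ} {e : ℕ} :
    X ^ (e + 1) ∣ P - C c * X ^ e ↔ (∀ l < e, P.coeff l = 0) ∧ P.coeff e = c := by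
  rw [X_pow_dvd_iff]
  simp only [coeff_sub, coeff_C_mul, coeff_X_pow]
  constructor
  · intro h
    refine ⟨fun l hl => ?_, ?_⟩
    · have := h l (by omega)
      rwa [if_neg hl.ne, mul_zero, sub_zero] at this
    · have := h e (by omega)
      rwa [if_pos rfl, mul_one, sub_eq_zero] at this
  · rintro ⟨h, h'⟩ l hl
    rcases (Nat.lt_succ_iff.mp hl).lt_or_eq with hl | rfl
    · rw [if_neg hl.ne, mul_zero, sub_zero, h l hl]
    · rw [if_pos rfl, mul_one, sub_eq_zero, h']

/-- An approximate `m`-th root of a polynomial with constant term `u ^ (mn)`, if `uv = 1`. -/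
theorem approx_root_comp {m n e : ℕ} {B : ℂ[X]} (hB0 : B.coeff 0 = 1)
    (hB : X ^ (e + 1) ∣ B ^ m - (1 + X)) {u v : ℂ} (huv : v * u = 1) {p : ℂ[X]}
    (hp : p.coeff 0 = u ^ (m * n)) :
    (C (u ^ n) * B.comp (C (v ^ (m * n)) * p - 1)).coeff 0 = u ^ n ∧
      X ^ (e + 1) ∣ (C (u ^ n) * B.comp (C (v ^ (m * n)) * p - 1)) ^ m - p := by
  have hvu : v ^ (m * n) * u ^ (m * n) = 1 := by rw [← mul_pow, huv, one_pow]
  have hs0 : (C (v ^ (m * n)) * p - 1).coeff 0 = 0 := by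
    rw [coeff_sub, coeff_C_mul, hp, hvu, coeff_one_zero, sub_self]
  refine ⟨?_, ?_⟩
  · rw [coeff_C_mul, coeff_zero_eq_eval_zero, eval_comp, ← coeff_zero_eq_eval_zero, hs0,
      ← coeff_zero_eq_eval_zero, hB0, mul_one]
  -- Here $p=u^{mn}(1+s)$ with $s(0)=0$, so substituting $s$ for $X$ in the approximate root of
  -- $1+X$ keeps its precision.
  · set s := C (v ^ (m * n)) * p - 1 with hs
    obtain ⟨r, hr⟩ := hB
    obtain ⟨t, ht⟩ : X ∣ s := X_dvd_iff.mpr hs0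
    have h1 := congrArg (fun P => comp P s) hr
    simp only [sub_comp, pow_comp, add_comp, one_comp, X_comp, mul_comp] at h1
    have h2 : C (u ^ (m * n)) * (1 + s) = p := by
      rw [hs, add_sub_cancel, ← mul_assoc, ← C_mul, mul_comm (u ^ _), hvu, C_1, one_mul]
    refine ⟨C (u ^ (m * n)) * (t ^ (e + 1) * r.comp s), ?_⟩
    rw [mul_pow, ← C_pow, ← pow_mul, mul_comm n m]
    rw [ht, mul_pow, ← ht] at h1
    linear_combination C (u ^ (m * n)) * h1 + h2

end Polynomial

/-! ## Jets of high order: the part with invertible leading coefficients -/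

/-- Pairs of a complex number (in the place of the coefficient of `t ^ m` in `x`) and a `d`-th root
of unity (in the place of the coefficient of `t ^ n` in `y`), with free coordinates. -/
def torusSet (d : ℕ+) {N : ℕ+} (i₀ i₁ : Fin 2 × Fin N) (c : Fin 2 → ℕ) :
    Set (Fin 2 × Fin N → ℂ) :=
  {b | (∀ i, i ≠ i₀ → i ≠ i₁ → (i.2 : ℕ) < c i.1 → b i = 0) ∧ b i₁ ^ (d : ℕ) = 1}

theorem torusSet_invariant {d N : ℕ+} {i₀ i₁ : Fin 2 × Fin N} (c : Fin 2 → ℕ) {K : ℕ+}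
    {w : Fin 2 × Fin N → ℕ} (hw : w i₁ * d = K) :
    ScaleInvariant K w (torusSet d i₀ i₁ c) := by
  rintro ζ hζ b ⟨hb, hb'⟩
  refine ⟨fun i h0 h1 h2 => ?_, ?_⟩
  · change ζ ^ w i * b i = 0
    rw [hb i h0 h1 h2, mul_zero]
  · change (ζ ^ w i₁ * b i₁) ^ (d : ℕ) = 1
    rw [mul_pow, ← pow_mul, hw, hζ, hb', one_mul]

theorem isAlgebraicSet_torusSet (d : ℕ+) {N : ℕ+} (i₀ i₁ : Fin 2 × Fin N) (c : Fin 2 → ℕ) :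
    IsAlgebraicSet (torusSet d i₀ i₁ c) := by
  have h1 := isAlgebraicSet_of_isRegularOn
    (fun (j : {i : Fin 2 × Fin N // i ≠ i₀ ∧ i ≠ i₁ ∧ (i.2 : ℕ) < c i.1})
      (a : Fin 2 × Fin N → ℂ) => a j.1) fun j => .coord _
  have h2 := isAlgebraicSet_of_isRegularOn
    (fun (_ : Unit) (a : Fin 2 × Fin N → ℂ) => a i₁ ^ (d : ℕ) - 1)
    fun _ => ((IsRegularOn.coord _).pow _).sub (.const 1)
  convert h1.inter h2 using 1
  ext a
  simp only [Set.mem_inter_iff, Set.mem_ofPred_eq, torusSet, sub_eq_zero, forall_const,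
    Subtype.forall, and_imp]

/-- The whole set is $\mathbb A^1\times\mu_d$ times the free tail. Removing the slice where the `i₀`
coordinate is zero replaces the factor $\mathbb L$ by $\mathbb L-1$. -/
theorem motive_unitLocus_torusSet {d N : ℕ+} {i₀ i₁ : Fin 2 × Fin N} {c : Fin 2 → ℕ} {K : ℕ+}
    {w : Fin 2 × Fin N → ℕ} (hw : w i₁ * d = K) (h01 : i₀ ≠ i₁) (h0 : (i₀.2 : ℕ) < c i₀.1)
    (h1 : (i₁.2 : ℕ) < c i₁.1) :
    (MuHatVariety.ofSet _ _ _ (unitLocus_invariant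
      (torusSet_invariant (i₀ := i₀) c hw) i₀)).motive =
      (muVariety d).motive * ((lefschetz : MMuHat) - 1) *
        (lefschetz : MMuHat) ^ ((N - c 0) + (N - c 1)) := by
  have hT := torusSet_invariant (i₀ := i₀) c hw
  have hfree₀ : IsFreeCoord (torusSet d i₀ i₁ c) i₀ := by
    rintro a ⟨ha, ha'⟩ z b _ hb
    refine ⟨fun i hi0 hi1 hi => ?_, ?_⟩
    · rw [hb i hi0, ha i hi0 hi1 hi]
    · rw [hb i₁ h01.symm, ha']
  have hfree : ∀ i ∈ tailCoords N c, IsFreeCoord (torusSet d i₀ i₁ c ∩ {a | a i₀ = 0}) i := by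
    rintro i hi a ⟨⟨ha, ha'⟩, ha''⟩ z b _ hb
    have hic := mem_tailCoords.mp hi
    have hlt : ∀ j : Fin 2 × Fin N, (j.2 : ℕ) < c j.1 → j ≠ i := by
      rintro j hj rfl
      omega
    refine ⟨⟨fun j hj0 hj1 hj => ?_, ?_⟩, ?_⟩
    · rw [hb j (hlt j hj), ha j hj0 hj1 hj]
    · rw [hb i₁ (hlt _ h1), ha']
    · exact (hb i₀ (hlt _ h0)).trans ha''
  have hcut := MuHatVariety.motive_ofSet_cut hT (isAlgebraicSet_torusSet d i₀ i₁ c) i₀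
  rw [MuHatVariety.motive_ofSet_free hT i₀ hfree₀,
    MuHatVariety.motive_ofSet_frees (hT.inter_coord i₀) _ hfree, card_tailCoords] at hcut
  have hmu : (MuHatVariety.ofSet _ _ _
      ((hT.inter_coord i₀).inter_coords (tailCoords N c))).motive = (muVariety d).motive := by
    refine MuHatVariety.motive_ofSet_congr _ _ (fun a _ => a i₁)
      (fun z i => if i = i₁ then z 0 else 0) ?_ ?_ ?_ ?_ ?_ ?_ ?_
    · exact fun _ => .coord _
    · intro i
      by_cases h : i = i₁
      · simpa only [if_pos h] using IsRegularOn.coord 0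
      · simpa only [if_neg h] using IsRegularOn.const 0
    · exact fun a ha => ha.1.1.2
    · refine fun z hz => ⟨⟨⟨fun i _ hi _ => if_neg hi, ?_⟩, if_neg h01⟩, fun i hi => if_neg ?_⟩
      · simpa only [if_true] using (show z 0 ^ (d : ℕ) = 1 from hz)
      · rintro rfl
        have := mem_tailCoords.mp hi
        omega
    · rintro a ⟨⟨⟨ha, -⟩, ha0⟩, hat⟩
      funext i
      by_cases hi : i = i₁
      · simp only [hi, if_true]
      · rw [if_neg hi]
        by_cases hi0 : i = i₀
        · rw [hi0]
          exact ha0.symm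
        · rcases lt_or_ge (i.2 : ℕ) (c i.1) with h | h
          · exact (ha i hi0 hi h).symm
          · exact (hat i (mem_tailCoords.mpr h)).symm
    · intro z _
      funext j
      simp only [if_true, Subsingleton.elim j 0]
    · intro ξ a _ j
      change MuHat.root K ξ ^ w i₁ * a i₁ = MuHat.root d ξ ^ 1 * a i₁
      rw [pow_one, MuHat.root_pow_of_eq (k := d) (by rw [← hw, mul_comm])]
  rw [hmu] at hcut
  linear_combination -hcut

/-- The extra coordinate is determined as an inverse, so it need not be checked in identities
between points. -/
theorem unitLocus_ext {σ : Type} {Z : Set (σ → ℂ)} {i : σ} {b b' : Option σ → ℂ}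
    (hb : b ∈ unitLocus Z i) (hb' : b' ∈ unitLocus Z i) (h : ∀ j, b (some j) = b' (some j)) :
    b = b' := by
  funext o
  cases o with
  | none =>
    have h1 := hb.2
    rw [h i] at h1
    have h2 : b' (some i) ≠ 0 := right_ne_zero_of_mul_eq_one hb'.2
    exact mul_right_cancel₀ h2 (h1.trans hb'.2.symm)
  | some j => exact h j

theorem exists_mul_add_one_eq {m n : ℕ} (hm : 0 < m) (hn : 0 < n) (h : Nat.Coprime m n) :
    ∃ A B : ℕ, n * B = m * A + 1 := by
  rcases Nat.eq_or_lt_of_le (Nat.succ_le_of_lt hm) with h1 | h1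
  · exact ⟨n - 1, 1, by simp at h1; subst h1; omega⟩
  · obtain ⟨B, hB⟩ := Nat.exists_mul_mod_eq_one_of_coprime h.symm h1
    exact ⟨n * B / m, B, by rw [← hB.2]; exact (Nat.div_add_mod _ _).symm⟩

/-- The parameter $v=y^Bz^A$, with $z$ the inverse of the coefficient of $x$, has weight
$nrB-mrA=r$. -/
theorem root_monomial_scale {K : ℕ+} {ζ : ℂ} (hζ : ζ ^ (K : ℕ) = 1) {m n A B : ℕ}
    (hAB : n * B = m * A + 1) (r : ℕ) (y z : ℂ) :
    (ζ ^ (n * r) * y) ^ B * (ζ ^ (((K : ℕ) - 1) * (m * r)) * z) ^ A =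
      ζ ^ r * (y ^ B * z ^ A) := by
  have h1 := pow_pred_mul_pow_eq_one hζ (m * r)
  have h2 : (ζ ^ (n * r)) ^ B = (ζ ^ (m * r)) ^ A * ζ ^ r := by
    rw [← pow_mul, ← pow_mul, ← pow_add]
    congr 1
    linear_combination r * hAB
  rw [mul_pow, mul_pow, h2]
  calc _ = (ζ ^ (((K : ℕ) - 1) * (m * r)) * ζ ^ (m * r)) ^ A * (ζ ^ r * (y ^ B * z ^ A)) := by
        rw [mul_pow]
        ring
    _ = _ := by rw [h1, one_pow, one_mul]

/-- The weights on `torusSet` that correspond to the action on jets. -/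
def torusWeight (m n k : ℕ+) (ρ : ℕ) {N : ℕ+} (i₀ i₁ : Fin 2 × Fin N) (i : Fin 2 × Fin N) : ℕ :=
  if i = i₀ then 1 + ρ else if i = i₁ then m * n * ρ + k else jetWeight m n ρ i

theorem torusWeight_snd {m n k d N : ℕ+} (ρ : ℕ) {i₀ i₁ : Fin 2 × Fin N} (h : i₀ ≠ i₁) :
    torusWeight m n k ρ i₀ i₁ i₁ * d = jetLevel m n d k ρ := by
  rw [torusWeight, if_neg h.symm, if_pos rfl, jetLevel_coe]

theorem jetIndex_ne {N i i' : ℕ+} (h : i ≤ N) (h' : i' ≤ N) : jetIndex 0 h ≠ jetIndex 1 h' :=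
  fun h => zero_ne_one (congrArg Prod.fst h)

/-- With $x_m$, $y_n$ the leading coefficients and $nB=mA+1$, the relation $y_n^m=x_m^n$ is
parametrized by $v=y_n^Bx_m^{-A}$, for which $v^m=x_m$ and $v^n=y_n$. The isomorphism puts $v$ in
place of $x_m$ and the leading coefficient of $f_1\circ\varphi$ in place of $y_n$. It forgets the
coefficients of $t^{n+1},\dots,t^{n+e}$ in $y$, which the inverse recovers from the $m$-th root. -/
theorem motive_unitLocus_orderSet {m n d N e : ℕ+} (hmn : Nat.Coprime m n)
    (hN : m * n + e ≤ N) (hm : m ≤ N) (hn : n ≤ N) (ρ : ℕ) {i₀ i₁ : Fin 2 × Fin N}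
    (hi₀ : i₀ = jetIndex 0 hm) (hi₁ : i₁ = jetIndex 1 hn) (h01 : i₀ ≠ i₁) :
    (MuHatVariety.ofSet _ _ _ (unitLocus_invariant
      (orderSet_invariant m n d N (m * n + e) ρ) i₀)).motive =
    (MuHatVariety.ofSet _ _ _ (unitLocus_invariant
      (torusSet_invariant (i₀ := i₀) ![(m : ℕ), (n : ℕ) + e]
        (torusWeight_snd (m := m) (n := n) (k := m * n + e) (d := d) ρ h01)) i₀)).motive := by
  have hN' : (m : ℕ) * n + e ≤ N := hN
  have hmle : (m : ℕ) ≤ m * n := Nat.le_mul_of_pos_right _ n.pos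
  have hnle : (n : ℕ) ≤ m * n := Nat.le_mul_of_pos_left _ m.pos
  have hm0 := m.pos
  have hn0 := n.pos
  have he0 := e.pos
  have hiff₀ : ∀ l : Fin N, (0, l) = i₀ ↔ (l : ℕ) + 1 = m := by
    intro l
    rw [hi₀, jetIndex, Prod.mk.injEq]
    simp only [true_and, Fin.ext_iff]
    omega
  have hiff₁ : ∀ l : Fin N, (1, l) = i₁ ↔ (l : ℕ) + 1 = n := by
    intro l
    rw [hi₁, jetIndex, Prod.mk.injEq]
    simp only [true_and, Fin.ext_iff]
    omega
  have h10 : ∀ l : Fin N, ((1, l) : Fin 2 × Fin N) ≠ i₀ := fun l h =>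
    one_ne_zero (congrArg Prod.fst (h.trans hi₀))
  have hc₀ : ∀ a : Fin 2 × Fin N → ℂ, (jet N a 0).coeff m = a i₀ := fun a =>
    hi₀ ▸ jet_coeff_jetIndex 0 hm a
  have hc₁ : ∀ a : Fin 2 × Fin N → ℂ, (jet N a 1).coeff n = a i₁ := fun a =>
    hi₁ ▸ jet_coeff_jetIndex 1 hn a
  obtain ⟨A, B, hAB⟩ := exists_mul_add_one_eq m.pos n.pos hmn
  obtain ⟨R, hR0, hR⟩ := Polynomial.exists_approx_root m.pos (e : ℕ)
  set Y := orderSet m n d N (m * n + e) with hY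
  set T := torusSet d i₀ i₁ ![(m : ℕ), (n : ℕ) + e] with hT
  -- the map from jets
  let c : (Option (Fin 2 × Fin N) → ℂ) → ℂ := fun b =>
    (jetValue m n fun i => b (some i)).coeff (m * n + e : ℕ+)
  -- On the source, `b none` is $x_m^{-1}$. The first expression is $v^{-1}=x_m^Ay_n^{-B}$, with
  -- $y_n^{-1}=y_n^{m-1}x_m^{-n}$ to remain polynomial.
  let F : (Option (Fin 2 × Fin N) → ℂ) → Option (Fin 2 × Fin N) → ℂ := fun b o => o.elim
    (b (some i₀) ^ A * (b (some i₁) ^ ((m : ℕ) - 1) * b none ^ (n : ℕ)) ^ B) fun i =>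
      if i = i₀ then b (some i₁) ^ B * b none ^ A else if i = i₁ then c b
      else if (i.2 : ℕ) < ![(m : ℕ), (n : ℕ) + e] i.1 then 0 else b (some i)
  -- the inverse map
  let x : (Option (Fin 2 × Fin N) → ℂ) → Polynomial ℂ := fun b =>
    Polynomial.divX^[(m : ℕ)] (jet N (fun i => if i = i₀ then b (some i₀) ^ (m : ℕ)
      else b (some i)) 0)
  let p : (Option (Fin 2 × Fin N) → ℂ) → Polynomial ℂ := fun b =>
    x b ^ (n : ℕ) + Polynomial.C (b (some i₁)) * Polynomial.X ^ (e : ℕ)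
  -- On the target, `b (some i₀)` is $v$ and `b none` is $v^{-1}$. Thus `q b` is the approximate
  -- $m$-th root of `p b` with constant term $v^n$.
  let q : (Option (Fin 2 × Fin N) → ℂ) → Polynomial ℂ := fun b =>
    Polynomial.C (b (some i₀) ^ (n : ℕ)) *
      R.comp (Polynomial.C (b none ^ ((m : ℕ) * n)) * p b - 1)
  let G : (Option (Fin 2 × Fin N) → ℂ) → Option (Fin 2 × Fin N) → ℂ := fun b o => o.elim
    (b none ^ (m : ℕ)) fun i => if i = i₀ then b (some i₀) ^ (m : ℕ)
      else if i.1 = 1 ∧ (i.2 : ℕ) < n + e ∧ (n : ℕ) ≤ i.2 + 1 then (q b).coeff (i.2 + 1 - n)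
      else b (some i)
  have hx0 : ∀ b, (x b).coeff 0 = b (some i₀) ^ (m : ℕ) := by
    intro b
    rw [Polynomial.coeff_iterate_divX, zero_add, hc₀, if_pos rfl]
  have hp0 : ∀ b, (p b).coeff 0 = b (some i₀) ^ ((m : ℕ) * n) := by
    intro b
    rw [Polynomial.coeff_add, Polynomial.coeff_C_mul, Polynomial.coeff_X_pow,
      if_neg he0.ne, mul_zero, add_zero, Polynomial.coeff_zero_eq_eval_zero, Polynomial.eval_pow,
      ← Polynomial.coeff_zero_eq_eval_zero, hx0, pow_mul]
  have hq : ∀ b ∈ unitLocus T i₀, (q b).coeff 0 = b (some i₀) ^ (n : ℕ) ∧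
      Polynomial.X ^ ((e : ℕ) + 1) ∣ q b ^ (m : ℕ) - p b := fun b hb =>
    Polynomial.approx_root_comp hR0 hR hb.2 (hp0 b)
  -- jets on the source
  have hYp : ∀ b ∈ unitLocus Y i₀, ∀ a, (∀ i, a i = b (some i)) →
      Polynomial.X ^ ((e : ℕ) + 1) ∣ Polynomial.divX^[(n : ℕ)] (jet N a 1) ^ (m : ℕ) -
        Polynomial.divX^[(m : ℕ)] (jet N a 0) ^ (n : ℕ) -
        Polynomial.C (c b) * Polynomial.X ^ (e : ℕ) := by
    rintro b ⟨hb, -⟩ a ha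
    obtain rfl : a = fun i => b (some i) := funext ha
    have hs := jet_eq_shift_of_mem_orderSet hmn hb
    rw [Polynomial.X_pow_dvd_sub_C_mul_X_pow_iff]
    refine ⟨((mem_orderSet_iff_of_shift hs).mp hb).1, ?_⟩
    simp only [c]
    rw [jetValue_of_shift hs, PNat.add_coe, PNat.mul_coe, add_comm, Polynomial.coeff_X_pow_mul]
    rfl
  have hpow : ∀ b ∈ unitLocus Y i₀, b (some i₁) ^ (m : ℕ) = b (some i₀) ^ (n : ℕ) := by
    rintro b ⟨hb, -⟩
    have := coeff_pow_eq_of_mem_orderSet hmn hb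
    rwa [hc₀, hc₁] at this
  have hum : ∀ b ∈ unitLocus Y i₀, (b (some i₁) ^ B * b none ^ A) ^ (m : ℕ) = b (some i₀) := by
    intro b hb
    have h1 := hpow b hb
    have h2 : b none * b (some i₀) = 1 := hb.2
    calc (b (some i₁) ^ B * b none ^ A) ^ (m : ℕ)
        = (b (some i₁) ^ (m : ℕ)) ^ B * b none ^ ((m : ℕ) * A) := by ring
      _ = b (some i₀) ^ ((n : ℕ) * B) * b none ^ ((m : ℕ) * A) := by rw [h1]; ring
      _ = b (some i₀) * (b none * b (some i₀)) ^ ((m : ℕ) * A) := by rw [hAB]; ring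
      _ = b (some i₀) := by rw [h2, one_pow, mul_one]
  have hun : ∀ b ∈ unitLocus Y i₀, (b (some i₁) ^ B * b none ^ A) ^ (n : ℕ) = b (some i₁) := by
    intro b hb
    have h1 := hpow b hb
    have h2 : b none * b (some i₀) = 1 := hb.2
    calc (b (some i₁) ^ B * b none ^ A) ^ (n : ℕ)
        = b (some i₁) ^ ((n : ℕ) * B) * (b none ^ (n : ℕ)) ^ A := by ring
      _ = b (some i₁) * (b (some i₁) ^ (m : ℕ) * b none ^ (n : ℕ)) ^ A := by rw [hAB]; ring
      _ = b (some i₁) * ((b none * b (some i₀)) ^ (n : ℕ)) ^ A := by rw [h1]; ring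
      _ = b (some i₁) := by rw [h2, one_pow, one_pow, mul_one]
  have hFm : Set.MapsTo F (unitLocus Y i₀) (unitLocus T i₀) := by
    intro b hb
    refine ⟨⟨fun i h0 h1 hi => ?_, ?_⟩, ?_⟩
    · simp only [F, Option.elim_some, if_neg h0, if_neg h1, if_pos hi]
    · simp only [F, Option.elim_some, if_neg h01.symm, if_true]
      exact hb.1.2
    · simp only [F, Option.elim_some, Option.elim_none, if_true]
      have h1 := hpow b hb
      have h2 : b none * b (some i₀) = 1 := hb.2
      calc b (some i₀) ^ A * (b (some i₁) ^ ((m : ℕ) - 1) * b none ^ (n : ℕ)) ^ B *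
            (b (some i₁) ^ B * b none ^ A)
          = (b none * b (some i₀)) ^ A *
            (b (some i₁) ^ ((m : ℕ) - 1) * b (some i₁) * b none ^ (n : ℕ)) ^ B := by ring
        _ = 1 := by
          rw [← pow_succ, Nat.sub_add_cancel hm0, h1, ← mul_pow, mul_comm (b (some i₀)), h2,
            one_pow, one_pow, one_pow, mul_one]
  -- jets on the target
  have hTp : ∀ b ∈ unitLocus T i₀, ∀ j, jet N (fun i => G b (some i)) j =
      Polynomial.X ^ (![(m : ℕ), (n : ℕ)] j) *
        ![x b, Polynomial.divX^[(n : ℕ)] (jet N (fun i => G b (some i)) 1)] j := by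
    intro b hb
    refine Fin.forall_fin_two.mpr ⟨?_, ?_⟩
    · have h1 : jet N (fun i => G b (some i)) 0 = jet N (fun i => if i = i₀ then
          b (some i₀) ^ (m : ℕ) else b (some i)) 0 := by
        rw [jet, jet]
        refine Finset.sum_congr rfl fun l _ => ?_
        simp [G]
      rw [h1]
      refine (Polynomial.X_pow_mul_iterate_divX fun l hl => ?_).symm
      change l < (m : ℕ) at hl
      rcases Nat.eq_zero_or_pos l with rfl | hl0
      · exact jet_coeff_zero _ _
      · rw [jet_coeff _ _ hl0 (by omega), if_neg (by rw [hiff₀]; simp only; omega)]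
        refine hb.1.1 _ (by rw [ne_eq, hiff₀]; simp only; omega) ?_ ?_
        · exact fun h => zero_ne_one (congrArg Prod.fst (h.trans hi₁))
        · change l - 1 < (m : ℕ)
          omega
    · refine (Polynomial.X_pow_mul_iterate_divX fun l hl => ?_).symm
      change l < (n : ℕ) at hl
      rcases Nat.eq_zero_or_pos l with rfl | hl0
      · exact jet_coeff_zero _ _
      · rw [jet_coeff _ _ hl0 (by omega)]
        simp only [G, Option.elim_some, if_neg (h10 _)]
        rw [if_neg (by omega)]
        refine hb.1.1 _ (h10 _) (by rw [ne_eq, hiff₁]; simp only; omega) ?_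
        change l - 1 < (n : ℕ) + e
        omega
  have hTq : ∀ b ∈ unitLocus T i₀, Polynomial.X ^ ((e : ℕ) + 1) ∣
      Polynomial.divX^[(n : ℕ)] (jet N (fun i => G b (some i)) 1) ^ (m : ℕ) -
        x b ^ (n : ℕ) - Polynomial.C (b (some i₁)) * Polynomial.X ^ (e : ℕ) := by
    intro b hb
    have h1 : Polynomial.X ^ ((e : ℕ) + 1) ∣
        Polynomial.divX^[(n : ℕ)] (jet N (fun i => G b (some i)) 1) - q b := by
      rw [Polynomial.X_pow_dvd_iff]
      intro l hl
      rw [Polynomial.coeff_sub, Polynomial.coeff_iterate_divX, jet_coeff _ _ (by omega) (by omega)]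
      simp only [G, Option.elim_some, if_neg (h10 _)]
      rw [if_pos ⟨trivial, show l + n - 1 < (n : ℕ) + e by omega,
        show (n : ℕ) ≤ l + n - 1 + 1 by omega⟩, sub_eq_zero]
      congr 1
      omega
    have h2 := dvd_add (h1.trans (sub_dvd_pow_sub_pow _ _ (m : ℕ))) (hq b hb).2
    convert h2 using 1
    simp only [p]
    ring
  have hGc : ∀ b ∈ unitLocus T i₀, c (G b) = b (some i₁) := by
    intro b hb
    simp only [c]
    rw [jetValue_of_shift (hTp b hb), PNat.add_coe, PNat.mul_coe, add_comm,
      Polynomial.coeff_X_pow_mul]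
    exact (Polynomial.X_pow_dvd_sub_C_mul_X_pow_iff.mp (hTq b hb)).2
  have hGm : Set.MapsTo G (unitLocus T i₀) (unitLocus Y i₀) := by
    intro b hb
    have h1 := Polynomial.X_pow_dvd_sub_C_mul_X_pow_iff.mp (hTq b hb)
    refine ⟨(mem_orderSet_iff_of_shift (hTp b hb)).mpr ⟨h1.1, ?_⟩, ?_⟩
    · exact (congrArg (· ^ (d : ℕ)) h1.2).trans hb.1.2
    · simp only [G, Option.elim_some, Option.elim_none, if_true]
      have h2 : b none * b (some i₀) = 1 := hb.2
      rw [← mul_pow, h2, one_pow]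
  refine MuHatVariety.motive_ofSet_congr _ _ F G ?_ ?_ hFm hGm ?_ ?_ ?_
  · intro o
    cases o with
    | none =>
      exact ((IsRegularOn.coord _).pow _).mul
        ((((IsRegularOn.coord _).pow _).mul ((IsRegularOn.coord _).pow _)).pow _)
    | some i =>
      simp only [F, Option.elim_some]
      split_ifs
      · exact ((IsRegularOn.coord _).pow _).mul ((IsRegularOn.coord _).pow _)
      · exact isRegularPoly_jetValue m n (fun i => .coord _) _
      · exact .const 0
      · exact .coord _
  · have hx : IsRegularPoly (unitLocus T i₀) x := by
      refine (isRegularPoly_jet_comp (fun i => ?_) 0).iterate_divX _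
      by_cases h : i = i₀
      · simpa only [if_pos h] using (IsRegularOn.coord (some i₀)).pow _
      · simpa only [if_neg h] using IsRegularOn.coord (some i)
    have hq' : IsRegularPoly (unitLocus T i₀) q :=
      (IsRegularPoly.C ((IsRegularOn.coord _).pow _)).mul
        ((((IsRegularPoly.C ((IsRegularOn.coord _).pow _)).mul ((hx.pow _).add
          ((IsRegularPoly.C (.coord _)).mul (.const _)))).sub (.const _)).comp_left R)
    intro o
    cases o with
    | none => exact (IsRegularOn.coord _).pow _
    | some i =>
      simp only [G, Option.elim_some]
      split_ifs
      · exact (IsRegularOn.coord _).pow _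
      · exact hq' _
      · exact .coord _
  · intro b hb
    refine unitLocus_ext (hGm (hFm hb)) hb fun i => ?_
    have hvan : ∀ j, ∀ l : Fin N, (l : ℕ) + 1 < ![(m : ℕ), (n : ℕ)] j → b (some (j, l)) = 0 :=
      fun j l hl => (jet_coeff_succ (fun i => b (some i)) j l).symm.trans
        (coeff_eq_zero_of_mem_orderSet hmn hb.1 j _ hl)
    have hi₀ne : b (some i₀) ≠ 0 := right_ne_zero_of_mul_eq_one hb.2
    by_cases h0 : i = i₀
    · simp only [G, F, h0, Option.elim_some, if_true]
      exact hum b hb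
    by_cases hw : i.1 = 1 ∧ (i.2 : ℕ) < n + e ∧ (n : ℕ) ≤ i.2 + 1
    · simp only [G, Option.elim_some, if_neg h0, if_pos hw]
      have hjet : jet N (fun i => if i = i₀ then F b (some i₀) ^ (m : ℕ) else F b (some i)) 0 =
          jet N (fun i => b (some i)) 0 := by
        rw [jet, jet]
        refine Finset.sum_congr rfl fun l _ => ?_
        congr 2
        split_ifs with h
        · rw [h]
          simp only [F, Option.elim_some, if_true]
          exact hum b hb
        · have h1 : ((0, l) : Fin 2 × Fin N) ≠ i₁ := fun h =>
            zero_ne_one (congrArg Prod.fst (h.trans hi₁))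
          simp only [F, Option.elim_some, if_neg h, if_neg h1]
          split_ifs with hl
          · refine (hvan 0 l ?_).symm
            rw [hiff₀] at h
            change (l : ℕ) < m at hl
            change (l : ℕ) + 1 < m
            omega
          · rfl
      have hFc : F b (some i₁) = c b := by
        simp only [F, Option.elim_some, if_neg h01.symm, if_true]
      have hFu : F b (some i₀) ^ (n : ℕ) = b (some i₁) := by
        simp only [F, Option.elim_some, if_true]
        exact hun b hb
      have hpF : p (F b) = Polynomial.divX^[(m : ℕ)] (jet N (fun i => b (some i)) 0) ^ (n : ℕ) +
          Polynomial.C (c b) * Polynomial.X ^ (e : ℕ) := by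
        simp only [p, x, hjet, hFc]
      have hqF := hq _ (hFm hb)
      have hdiv : Polynomial.X ^ ((e : ℕ) + 1) ∣
          Polynomial.divX^[(n : ℕ)] (jet N (fun i => b (some i)) 1) - q (F b) := by
        -- The given $\tilde y$ and the reconstructed `q (F b)` are $m$-th roots of the same
        -- polynomial modulo $t^{e+1}$, with the same nonzero constant term.
        refine Polynomial.X_pow_dvd_of_pow_sub_pow m.pos ?_ ?_ ?_
        · have := dvd_sub (hYp b hb _ fun i => rfl) hqF.2
          rw [hpF] at this
          convert this using 1
          ring
        · rw [hqF.1, hFu, Polynomial.coeff_iterate_divX, zero_add, hc₁]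
        · rw [hqF.1, hFu]
          intro h
          have := hpow b hb
          rw [h, zero_pow m.ne_zero] at this
          exact pow_ne_zero _ hi₀ne this.symm
      obtain ⟨j, l⟩ := i
      obtain ⟨rfl, hl1, hl2⟩ := hw
      simp only at hl1 hl2 ⊢
      have := Polynomial.X_pow_dvd_iff.mp hdiv ((l : ℕ) + 1 - n) (by omega)
      rw [Polynomial.coeff_sub, sub_eq_zero, Polynomial.coeff_iterate_divX,
        Nat.sub_add_cancel hl2, jet_coeff_succ] at this
      exact this.symm
    · simp only [G, Option.elim_some, if_neg h0, if_neg hw]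
      have h1 : i ≠ i₁ := by
        rintro rfl
        refine hw ?_
        rw [hi₁]
        refine ⟨rfl, ?_, ?_⟩
        · change (n : ℕ) - 1 < n + e
          omega
        · change (n : ℕ) ≤ n - 1 + 1
          omega
      simp only [F, Option.elim_some, if_neg h0, if_neg h1]
      split_ifs with hl
      · obtain ⟨j, l⟩ := i
        refine (hvan j l ?_).symm
        revert j
        refine Fin.forall_fin_two.mpr ⟨fun h0 hw h1 hl => ?_, fun h0 hw h1 hl => ?_⟩
        · rw [hiff₀] at h0
          change (l : ℕ) < m at hl
          change (l : ℕ) + 1 < m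
          omega
        · change (l : ℕ) < n + e at hl
          change (l : ℕ) + 1 < n
          simp only [true_and, not_and, not_le] at hw
          exact hw hl
      · rfl
  · intro b hb
    refine unitLocus_ext (hFm (hGm hb)) hb fun i => ?_
    have huv : b none * b (some i₀) = 1 := hb.2
    by_cases h0 : i = i₀
    · have hw : i₁.1 = 1 ∧ (i₁.2 : ℕ) < n + e ∧ (n : ℕ) ≤ i₁.2 + 1 := by
        rw [hi₁]
        refine ⟨rfl, ?_, ?_⟩
        · change (n : ℕ) - 1 < n + e
          omega
        · change (n : ℕ) ≤ n - 1 + 1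
          omega
      have hs : (i₁.2 : ℕ) + 1 - n = 0 := by
        rw [hi₁]
        change (n : ℕ) - 1 + 1 - n = 0
        omega
      simp only [F, G, h0, Option.elim_some, Option.elim_none, if_true, if_neg h01.symm, if_pos hw]
      rw [hs, (hq b hb).1, ← pow_mul, ← pow_mul, hAB, pow_succ, mul_right_comm, ← mul_pow,
        mul_comm (b (some i₀)), huv, one_pow, one_mul]
    by_cases h1 : i = i₁
    · simp only [F, h1, Option.elim_some, if_neg h01.symm, if_true]
      exact hGc b hb
    simp only [F, Option.elim_some, if_neg h0, if_neg h1]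
    split_ifs with hl
    · exact (hb.1.1 i h0 h1 hl).symm
    · simp only [G, Option.elim_some, if_neg h0]
      rw [if_neg]
      rintro ⟨hj, hlt, -⟩
      rw [hj] at hl
      exact hl hlt
  · intro ξ b hb o
    have hζ := MuHat.root_pow_self (jetLevel m n d (m * n + e) ρ) ξ
    have hmem₁ := hFm (unitLocus_invariant (orderSet_invariant m n d N (m * n + e) ρ) i₀ _ hζ b hb)
    have hmem₂ := unitLocus_invariant (torusSet_invariant (i₀ := i₀) ![(m : ℕ), (n : ℕ) + e]
      (torusWeight_snd (m := m) (n := n) (k := m * n + e) (d := d) ρ h01)) i₀ _ hζ _ (hFm hb)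
    generalize MuHat.root (jetLevel m n d (m * n + e) ρ) ξ = ζ at hζ hmem₁ hmem₂ ⊢
    generalize jetLevel m n d (m * n + e) ρ = K at hζ hmem₁ hmem₂ ⊢
    -- Both sides lie in the unit locus, so by `unitLocus_ext` the inverse coordinate needs no
    -- check.
    refine congrFun (f := F fun o => ζ ^ unitWeight K (jetWeight m n ρ) i₀ o * b o)
      (g := fun o => ζ ^ unitWeight K (torusWeight m n (m * n + e) ρ i₀ i₁) i₀ o * F b o)
      (unitLocus_ext hmem₁ hmem₂ fun i => ?_) o
    change F (fun o => ζ ^ unitWeight K (jetWeight m n ρ) i₀ o * b o) (some i) =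
      ζ ^ torusWeight m n (m * n + e) ρ i₀ i₁ i * F b (some i)
    by_cases h0 : i = i₀
    · have hw₀ : jetWeight m n ρ i₀ = m * (1 + ρ) := by
        rw [hi₀]
        change (m : ℕ) - 1 + 1 + m * ρ = _
        rw [Nat.sub_add_cancel m.pos]
        ring
      have hw₁ : jetWeight m n ρ i₁ = n * (1 + ρ) := by
        rw [hi₁]
        change (n : ℕ) - 1 + 1 + n * ρ = _
        rw [Nat.sub_add_cancel n.pos]
        ring
      simp only [F, h0, Option.elim_some, if_true, unitWeight, torusWeight]
      rw [hw₀, hw₁]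
      exact root_monomial_scale hζ hAB (1 + ρ) _ _
    by_cases h1 : i = i₁
    · simp only [F, h1, Option.elim_some, if_neg h01.symm, if_true, torusWeight]
      exact jetValue_scale m n ρ ζ (fun i => b (some i)) _
    simp only [F, Option.elim_some, if_neg h0, if_neg h1, torusWeight]
    split_ifs with hl
    · rw [mul_zero]
    · rfl

/-! ## The recursion for the normalized motives of jets -/

/-- The motive of `orderSet m n d N k`, divided by the motive of the space of all jets. -/
noncomputable def jetMotive (m n d N k : ℕ+) (ρ : ℕ) : MMuHat :=
  (MuHatVariety.ofSet _ _ _ (orderSet_invariant m n d N k ρ)).motive *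
    ((lefschetz ^ (-2 * (N : ℤ)) : MMuHatˣ) : MMuHat)

theorem lefschetz_pow_mul_zpow (a : ℕ) (b c : ℤ) (h : (a : ℤ) + b = c) :
    (lefschetz : MMuHat) ^ a * ((lefschetz ^ b : MMuHatˣ) : MMuHat) =
      ((lefschetz ^ c : MMuHatˣ) : MMuHat) := by
  rw [← h, zpow_add, zpow_natCast, Units.val_mul, Units.val_pow_eq_pow_val]

theorem jetMotive_of_le {m n d N k : ℕ+} (hmn : Nat.Coprime m n) (hk : (k : ℕ) ≤ m * n)
    (hkN : k ≤ N) (ρ : ℕ) :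
    jetMotive m n d N k ρ =
      (MuHatVariety.ofSet _ _ _ (leadingSet_invariant m n d k)).motive *
        ((lefschetz ^ (-(((k : ℕ) / n + (k : ℕ) / m : ℕ) : ℤ)) : MMuHatˣ) : MMuHat) := by
  rw [jetMotive, motive_orderSet_of_le hmn hk hkN, mul_assoc]
  congr 1
  apply lefschetz_pow_mul_zpow
  have hkN' : (k : ℕ) ≤ N := hkN
  have h1 := (Nat.div_le_self (k : ℕ) n).trans hkN'
  have h2 := (Nat.div_le_self (k : ℕ) m).trans hkN'
  push_cast [Nat.cast_sub h1, Nat.cast_sub h2]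
  ring

/-- The set is cut by the coefficient of $t^m$ in $x$. Its zero locus gives the first summand and
its unit locus the second, where $(N-m)+(N-n-e)$ coefficients are free. -/
theorem jetMotive_add {m n d N e : ℕ+} (hmn : Nat.Coprime m n) (hN : m * n + e ≤ N) (ρ : ℕ) :
    jetMotive m n d N (m * n + e) ρ =
      ((lefschetz ^ (-((m : ℤ) + n)) : MMuHatˣ) : MMuHat) * jetMotive m n d N e (ρ + 1) +
      (muVariety d).motive * ((lefschetz : MMuHat) - 1) *
        ((lefschetz ^ (-((m : ℤ) + n + e)) : MMuHatˣ) : MMuHat) := by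
  have hN' : (m : ℕ) * n + e ≤ N := hN
  have hmle : (m : ℕ) ≤ m * n := Nat.le_mul_of_pos_right _ n.pos
  have hnle : (n : ℕ) ≤ m * n := Nat.le_mul_of_pos_left _ m.pos
  have hm0 := m.pos
  have hn0 := n.pos
  have he0 := e.pos
  have hm : m ≤ N := show (m : ℕ) ≤ N by omega
  have hn : n ≤ N := show (n : ℕ) ≤ N by omega
  have h0 : ((jetIndex 0 hm).2 : ℕ) < ![(m : ℕ), (n : ℕ) + e] (jetIndex 0 hm).1 := by
    change (m : ℕ) - 1 < m
    omega
  have h1 : ((jetIndex 1 hn).2 : ℕ) < ![(m : ℕ), (n : ℕ) + e] (jetIndex 1 hn).1 := by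
    change (n : ℕ) - 1 < n + e
    omega
  have hU := motive_unitLocus_orderSet (d := d) hmn hN hm hn ρ rfl rfl (jetIndex_ne hm hn)
  rw [motive_unitLocus_torusSet (torusWeight_snd ρ (jetIndex_ne hm hn)) (jetIndex_ne hm hn) h0 h1]
    at hU
  rw [jetMotive, jetMotive, ← motive_orderSet_inter_coord hmn hN hm ρ,
    MuHatVariety.motive_ofSet_cut _ (isAlgebraicSet_orderSet m n d N _) (jetIndex 0 hm), hU]
  have e1 : ((lefschetz ^ (-((m : ℤ) + n)) : MMuHatˣ) : MMuHat) *
      (lefschetz : MMuHat) ^ ((m : ℕ) + n) = 1 := by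
    rw [mul_comm, lefschetz_pow_mul_zpow _ _ 0 (by push_cast; ring), zpow_zero, Units.val_one]
  have e2 : (lefschetz : MMuHat) ^ (((N : ℕ) - m) + (N - (n + e))) *
      ((lefschetz ^ (-2 * (N : ℤ)) : MMuHatˣ) : MMuHat) =
      ((lefschetz ^ (-((m : ℤ) + n + e)) : MMuHatˣ) : MMuHat) := by
    apply lefschetz_pow_mul_zpow
    push_cast [Nat.cast_sub (show (m : ℕ) ≤ N by omega),
      Nat.cast_sub (show (n : ℕ) + e ≤ N by omega)]
    ring
  simp only [Matrix.cons_val_zero, Matrix.cons_val_one, Matrix.cons_val_fin_one]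
  rw [add_mul, ← e2]
  linear_combination (-(MuHatVariety.ofSet _ _ _ ((orderSet_invariant m n d N (m * n + e)
    ρ).inter_coord (jetIndex 0 hm))).motive *
      ((lefschetz ^ (-2 * (N : ℤ)) : MMuHatˣ) : MMuHat)) * e1

/-- Induction in steps of $mn$: neither the formula for $k\le mn$ nor the second summand of the
recursion involves $N$ or $\rho$. All $\rho$ are treated at once because the recursion raises it. -/
theorem jetMotive_eq {m n d : ℕ+} (hmn : Nat.Coprime m n) (k : ℕ) :
    ∀ (k' N N' : ℕ+) (ρ ρ' : ℕ), (k' : ℕ) = k → k' ≤ N → k' ≤ N' →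
      jetMotive m n d N k' ρ = jetMotive m n d N' k' ρ' := by
  induction k using Nat.strong_induction_on with
  | _ k ih =>
    intro k' N N' ρ ρ' hk hN hN'
    rcases le_or_gt (k' : ℕ) (m * n) with h | h
    · rw [jetMotive_of_le hmn h hN, jetMotive_of_le hmn h hN']
    · have h' : m * n < k' := h
      obtain ⟨e, rfl⟩ : ∃ e, k' = m * n + e := ⟨k' - m * n, (PNat.add_sub_of_lt h').symm⟩
      have hek : e ≤ m * n + e := (PNat.lt_add_left e _).le
      rw [jetMotive_add hmn hN, jetMotive_add hmn hN',
        ih e (hk ▸ PNat.lt_add_left e (m * n)) e N N' (ρ + 1) (ρ' + 1) rfl (hek.trans hN)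
          (hek.trans hN')]

theorem motive_jetVariety {m n d N k : ℕ+} (h : N = k * d) :
    (jetVariety (quasiHom m n ^ (d : ℕ)) N).motive =
      (MuHatVariety.ofSet _ _ _ (orderSet_invariant m n d N k 0)).motive := by
  have hs := jetSet_eq_orderSet m n d N k h
  refine MuHatVariety.motive_ofSet_congr _ _ id id (fun i => .coord i) (fun i => .coord i) ?_ ?_
    (fun _ _ => rfl) (fun _ _ => rfl) ?_
  · exact fun a ha => hs ▸ ha
  · exact fun a ha => hs ▸ ha
  · intro ξ a _ i
    have hK : jetLevel m n d k 0 = N := PNat.eq (by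
      rw [jetLevel_coe, h, PNat.mul_coe, mul_zero, zero_add])
    have hw : jetWeight m n 0 i = (i.2 : ℕ) + 1 := by
      obtain ⟨j, l⟩ := i
      revert j
      exact Fin.forall_fin_two.mpr ⟨rfl, rfl⟩
    rw [hK, hw]
    rfl

/-! ## The motivic zeta function -/

/-- The coefficients of the motivic zeta function of a power of `y ^ m - x ^ n`. -/
noncomputable def zetaCoeff (m n d : ℕ+) (k : ℕ) : MMuHat :=
  if h : 0 < k then jetMotive m n d ⟨k, h⟩ ⟨k, h⟩ 0 else 0

theorem zetaCoeff_coe (m n d k : ℕ+) : zetaCoeff m n d k = jetMotive m n d k k 0 := dif_pos k.pos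

theorem coeff_motivicZeta (f : MvPolynomial (Fin 2) ℂ) (N : ℕ+) :
    PowerSeries.coeff (N : ℕ) (motivicZeta f) =
      (jetVariety f N).motive * ((lefschetz ^ (-2 * ((N : ℕ) : ℤ)) : MMuHatˣ) : MMuHat) := by
  rw [motivicZeta, PowerSeries.coeff_mk]
  exact dif_pos N.pos

/-- The zeta function uses jets of length $kd$ here, and `zetaCoeff` jets of length $k$.
`jetMotive_eq` makes the normalized classes agree. -/
theorem coeff_motivicZeta_mul {m n d : ℕ+} (hmn : Nat.Coprime m n) (k : ℕ) :
    PowerSeries.coeff (k * d) (motivicZeta (quasiHom m n ^ (d : ℕ))) = zetaCoeff m n d k := by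
  rcases Nat.eq_zero_or_pos k with rfl | hk
  · rw [motivicZeta, PowerSeries.coeff_mk, zetaCoeff, dif_neg (by simp), dif_neg (lt_irrefl 0)]
  · obtain ⟨k, rfl⟩ : ∃ k' : ℕ+, (k' : ℕ) = k := ⟨⟨k, hk⟩, rfl⟩
    rw [← PNat.mul_coe, coeff_motivicZeta, motive_jetVariety rfl, zetaCoeff_coe,
      jetMotive_eq hmn k k k (k * d) 0 0 rfl le_rfl
        (show (k : ℕ) ≤ k * d from Nat.le_mul_of_pos_right _ d.pos)]
    rfl

theorem coeff_motivicZeta_of_not_dvd {m n d : ℕ+} {N : ℕ} (h : ¬ (d : ℕ) ∣ N) :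
    PowerSeries.coeff N (motivicZeta (quasiHom m n ^ (d : ℕ))) = 0 := by
  have h0 : 0 < N := Nat.pos_of_ne_zero fun h0 => h (h0 ▸ dvd_zero _)
  obtain ⟨N, rfl⟩ : ∃ N' : ℕ+, (N' : ℕ) = N := ⟨⟨N, h0⟩, rfl⟩
  have : Nonempty (Fin 2 × Fin (N : ℕ)) := ⟨(0, ⟨0, h0⟩)⟩
  have h1 : (jetVariety (quasiHom m n ^ (d : ℕ)) N).motive = 0 :=
    MuHatVariety.motive_ofSet_empty _ (jetSet_eq_empty m n d N h)
  rw [coeff_motivicZeta, h1, zero_mul]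

theorem zetaCoeff_mul {m n d : ℕ+} (hmn : Nat.Coprime m n) :
    zetaCoeff m n d (m * n) = (quasiHomFiber m n d).motive *
      ((lefschetz ^ (-((m : ℤ) + n)) : MMuHatˣ) : MMuHat) := by
  rw [← PNat.mul_coe, zetaCoeff_coe, jetMotive_of_le hmn le_rfl le_rfl, motive_leadingSet_mul,
    PNat.mul_coe, Nat.mul_div_cancel _ n.pos, Nat.mul_div_cancel_left _ m.pos]
  push_cast
  rfl

theorem zetaCoeff_add {m n d : ℕ+} (hmn : Nat.Coprime m n) {e : ℕ} (he : 0 < e) :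
    zetaCoeff m n d (m * n + e) =
      ((lefschetz ^ (-((m : ℤ) + n)) : MMuHatˣ) : MMuHat) * zetaCoeff m n d e +
      (muVariety d).motive * ((lefschetz : MMuHat) - 1) *
        (((lefschetz ^ (-((m : ℤ) + n)) : MMuHatˣ) : MMuHat) *
          ((lefschetz ^ (-1 : ℤ) : MMuHatˣ) : MMuHat) ^ e) := by
  obtain ⟨e, rfl⟩ : ∃ e' : ℕ+, (e' : ℕ) = e := ⟨⟨e, he⟩, rfl⟩
  rw [← PNat.mul_coe, ← PNat.add_coe, zetaCoeff_coe, zetaCoeff_coe, jetMotive_add hmn le_rfl,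
    jetMotive_eq hmn e e (m * n + e) e (0 + 1) 0 rfl (PNat.lt_add_left _ _).le le_rfl]
  congr 2
  rw [← Units.val_pow_eq_pow_val, ← Units.val_mul, ← zpow_natCast, ← zpow_mul, ← zpow_add]
  congr 2
  ring

/-! ### Rationality and value at infinity from the recursion -/

section Series

variable {R : Type*} [CommRing R]

/-- The factor $1-aT^{Md}$ leaves the geometric terms $cab^e$, which $1-bT^d$ kills. In degree
$(M+1)d$ the recursion holds for $u(M+1)$ but $u(M)=fa$ replaces $ca$, so $cab-fab$ survives. -/
theorem coeff_denominator_mul {Z : PowerSeries R} {u : ℕ → R} {M d : ℕ} {a b c f : R}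
    (hd : 0 < d) (hZ : ∀ k, PowerSeries.coeff (k * d) Z = u k)
    (hZ' : ∀ N, ¬ d ∣ N → PowerSeries.coeff N Z = 0) (h0 : u 0 = 0) (hM : u M = f * a)
    (hadd : ∀ e, 0 < e → u (M + e) = a * u e + c * (a * b ^ e)) :
    PowerSeries.coeff ((M + 1) * d) ((((1 - Polynomial.C a * Polynomial.X ^ (M * d)) *
      (1 - Polynomial.C b * Polynomial.X ^ d) : Polynomial R) : PowerSeries R) * Z) =
        (c - f) * (a * b) ∧
    ∀ N, (M + 1) * d < N → PowerSeries.coeff N ((((1 - Polynomial.C a * Polynomial.X ^ (M * d)) *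
      (1 - Polynomial.C b * Polynomial.X ^ d) : Polynomial R) : PowerSeries R) * Z) = 0 := by
  have hQ : ((((1 - Polynomial.C a * Polynomial.X ^ (M * d)) *
      (1 - Polynomial.C b * Polynomial.X ^ d) : Polynomial R) : PowerSeries R) * Z) =
      Z - PowerSeries.C a * (PowerSeries.X ^ (M * d) * Z) -
        PowerSeries.C b * (PowerSeries.X ^ d * Z) +
        PowerSeries.C (a * b) * (PowerSeries.X ^ ((M + 1) * d) * Z) := by
    push_cast
    rw [map_mul, add_mul, pow_add, one_mul]
    ring
  have hcoeff : ∀ e, PowerSeries.coeff ((M + (e + 1)) * d) ((((1 - Polynomial.C a *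
      Polynomial.X ^ (M * d)) * (1 - Polynomial.C b * Polynomial.X ^ d) : Polynomial R) :
      PowerSeries R) * Z) = u (M + (e + 1)) - a * u (e + 1) - b * u (M + e) + a * b * u e := by
    intro e
    have e1 : (M + (e + 1)) * d = (e + 1) * d + M * d := by ring
    have e2 : (M + (e + 1)) * d = (M + e) * d + d := by ring
    have e3 : (M + (e + 1)) * d = e * d + (M + 1) * d := by ring
    rw [hQ, map_add, map_sub, map_sub, PowerSeries.coeff_C_mul, PowerSeries.coeff_C_mul,
      PowerSeries.coeff_C_mul, hZ]
    congr 1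
    · congr 1
      · congr 2
        rw [e1, PowerSeries.coeff_X_pow_mul, hZ]
      · congr 1
        rw [e2, PowerSeries.coeff_X_pow_mul, hZ]
    · congr 1
      rw [e3, PowerSeries.coeff_X_pow_mul, hZ]
  refine ⟨?_, fun N hN => ?_⟩
  · have := hcoeff 0
    rw [zero_add] at this
    rw [this, hadd 1 one_pos, add_zero, h0, hM]
    ring
  · by_cases hdN : d ∣ N
    · obtain ⟨k, rfl⟩ := hdN
      rw [mul_comm d k] at hN ⊢
      have hk := Nat.lt_of_mul_lt_mul_right hN
      -- Beyond degree $(M+1)d$ the recursion applies to both $u(k)$ and $u(k-1)$, with positive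
      -- arguments.
      obtain ⟨e, rfl⟩ : ∃ e, k = M + ((e + 1) + 1) := ⟨k - M - 2, by omega⟩
      rw [hcoeff, hadd _ (Nat.succ_pos (e + 1)), hadd _ (Nat.succ_pos e)]
      simp only [Nat.succ_eq_add_one]
      ring
    · have hz : ∀ i, i ≤ N → d ∣ i → PowerSeries.coeff (N - i) Z = 0 := fun i hi hdi =>
        hZ' _ fun h => hdN ((Nat.dvd_sub_iff_left hi hdi).mp h)
      have h1 : M * d ≤ N := by nlinarith
      have h2 : d ≤ N := by nlinarith
      rw [hQ, map_add, map_sub, map_sub, PowerSeries.coeff_C_mul, PowerSeries.coeff_C_mul,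
        PowerSeries.coeff_C_mul, PowerSeries.coeff_X_pow_mul', PowerSeries.coeff_X_pow_mul',
        PowerSeries.coeff_X_pow_mul', if_pos h1, if_pos h2, if_pos hN.le,
        hz _ h1 (dvd_mul_left d M), hz _ h2 dvd_rfl, hz _ hN.le (dvd_mul_left d _), hZ' N hdN]
      ring

theorem natDegree_leadingCoeff_one_sub [Nontrivial R] (a : Rˣ) {i : ℕ} (hi : 0 < i) :
    (1 - Polynomial.C (a : R) * Polynomial.X ^ i).natDegree = i ∧
      (1 - Polynomial.C (a : R) * Polynomial.X ^ i).leadingCoeff = -(a : R) := by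
  have h : 1 - Polynomial.C (a : R) * Polynomial.X ^ i =
      Polynomial.C (-(a : R)) * Polynomial.X ^ i + Polynomial.C 1 := by
    rw [Polynomial.C_neg, Polynomial.C_1]
    ring
  have ha : -(a : R) ≠ 0 := neg_ne_zero.mpr a.ne_zero
  have hdeg : (Polynomial.C (1 : R)).degree <
      (Polynomial.C (-(a : R)) * Polynomial.X ^ i).degree := by
    rw [Polynomial.degree_C_mul_X_pow _ ha]
    exact lt_of_le_of_lt Polynomial.degree_C_le (by exact_mod_cast hi)
  rw [h]
  refine ⟨?_, ?_⟩
  · rw [Polynomial.natDegree_add_C, Polynomial.natDegree_C_mul_X_pow _ _ ha]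
  · rw [Polynomial.leadingCoeff_add_of_degree_lt' hdeg, Polynomial.leadingCoeff_C_mul_X_pow]

end Series

theorem isLimitAtInfinity_of_recursion {Z : PowerSeries MMuHat} {u : ℕ → MMuHat} {M d : ℕ}
    {s t : ℤ} {c f : MMuHat} (hM0 : 0 < M) (hd : 0 < d)
    (hZ : ∀ k, PowerSeries.coeff (k * d) Z = u k)
    (hZ' : ∀ N, ¬ d ∣ N → PowerSeries.coeff N Z = 0) (h0 : u 0 = 0)
    (hM : u M = f * ((lefschetz ^ s : MMuHatˣ) : MMuHat))
    (hadd : ∀ e, 0 < e → u (M + e) = ((lefschetz ^ s : MMuHatˣ) : MMuHat) * u e +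
      c * (((lefschetz ^ s : MMuHatˣ) : MMuHat) * ((lefschetz ^ t : MMuHatˣ) : MMuHat) ^ e)) :
    IsLimitAtInfinity Z (c - f) := by
  rcases subsingleton_or_nontrivial MMuHat with hs | hn
  -- The degree of the denominator can only be computed if $1\ne0$, so the zero ring is treated
  -- apart.
  · exact ⟨0, 1, one_mem _, Subsingleton.elim _ _, by simp, Subsingleton.elim _ _⟩
  obtain ⟨h1, h2⟩ := coeff_denominator_mul hd hZ hZ' h0 hM hadd
  generalize ha : (lefschetz ^ s : MMuHatˣ) = a at h1 h2
  generalize hb : (lefschetz ^ t : MMuHatˣ) = b at h1 h2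
  obtain ⟨d1, l1⟩ := natDegree_leadingCoeff_one_sub a (Nat.mul_pos hM0 hd)
  obtain ⟨d2, l2⟩ := natDegree_leadingCoeff_one_sub b hd
  have hne : (1 - Polynomial.C (a : MMuHat) * Polynomial.X ^ (M * d)).leadingCoeff *
      (1 - Polynomial.C (b : MMuHat) * Polynomial.X ^ d).leadingCoeff ≠ 0 := by
    rw [l1, l2, neg_mul_neg, ← Units.val_mul]
    exact Units.ne_zero _
  have hdeg := Polynomial.natDegree_mul' hne
  have hlead := Polynomial.leadingCoeff_mul' hne
  rw [d1, d2, ← Nat.succ_mul] at hdeg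
  rw [l1, l2, neg_mul_neg] at hlead
  set Q := (1 - Polynomial.C (a : MMuHat) * Polynomial.X ^ (M * d)) *
      (1 - Polynomial.C (b : MMuHat) * Polynomial.X ^ d) with hQ
  -- The numerator is $QZ$ itself, which has no terms above degree $(M+1)d=\deg Q$. Its top
  -- coefficient $(c-f)ab$ is divided by the leading coefficient $ab$ of $Q$.
  refine ⟨PowerSeries.trunc ((M + 1) * d + 1) ((Q : PowerSeries MMuHat) * Z), Q, ?_, ?_, ?_, ?_⟩
  · refine mul_mem (Submonoid.subset_closure ⟨s, _, Nat.mul_pos hM0 hd, by rw [ha]⟩)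
      (Submonoid.subset_closure ⟨t, _, hd, by rw [hb]⟩)
  · ext N
    rw [Polynomial.coeff_coe, PowerSeries.coeff_trunc]
    split_ifs with hN
    · rfl
    · exact h2 N (by omega)
  · rw [hdeg]
    exact Nat.lt_succ_iff.mp (PowerSeries.natDegree_trunc_lt _ _)
  · rw [hdeg, hlead, PowerSeries.coeff_trunc, if_pos (Nat.lt_succ_self _)]
    exact h1

theorem theorem2 (m n d : ℕ+) (hmn : Nat.Coprime m n) :
    (∃ l : MMuHat, IsLimitAtInfinity (motivicZeta (quasiHom m n ^ (d : ℕ))) l) ∧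
    motivicMilnorFiber (quasiHom m n ^ (d : ℕ)) =
      (quasiHomFiber m n d).motive - (muVariety d).motive * ((lefschetz : MMuHat) - 1) := by
  have key : IsLimitAtInfinity (motivicZeta (quasiHom m n ^ (d : ℕ)))
      ((muVariety d).motive * ((lefschetz : MMuHat) - 1) - (quasiHomFiber m n d).motive) :=
    isLimitAtInfinity_of_recursion (Nat.mul_pos m.pos n.pos) d.pos (coeff_motivicZeta_mul hmn)
      (fun _ h => coeff_motivicZeta_of_not_dvd h) (dif_neg (lt_irrefl 0)) (zetaCoeff_mul hmn)
      fun _ he => zetaCoeff_add hmn he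
  have hex : ∃ l, IsLimitAtInfinity (motivicZeta (quasiHom m n ^ (d : ℕ))) l := ⟨_, key⟩
  refine ⟨hex, ?_⟩
  rw [motivicMilnorFiber, limitAtInfinity, dif_pos hex, hex.choose_spec.unique key, neg_sub]
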